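/- Work in the complex projective plane $\mathbb{P}^2_{\mathbb{C}}$. For a finite set $\mathcal{L}$ of lines, let $\Lambda_{\{2\},m}(\mathcal{L})$ be the arrangement of all lines of $\mathbb{P}^2_{\mathbb{C}}$ that contain at least $m$ of the points lying on exactly two lines of $\mathcal{L}$, and let $n_k=n_k(\mathcal{L})$ be the number of points lying on exactly $k$ lines of $\mathcal{L}$. Let $\mathcal{C}_n$ be the arrangement of the $n$ lines that extend the sides of the regular $n$-gon with vertices $(\cos\frac{2\pi k}{n}:\sin\frac{2\pi k}{n}:1)$, $0\le k<n$. (All regular $n$-gons are similar, so the choice is immaterial up to projective equivalence.) Put $$\mathcal{O}_{61}=\Lambda_{\{2\},3}(\mathcal{C}_{10}),\qquad \mathcal{O}_{49}=\Lambda_{\{2\},4}(\mathcal{C}_{12}).$$ A line arrangement of $d$ lines with defining polynomial $f\in S=\mathbb{C}[x,y,z]$ is *free* if, for some integers $1\le d_1\le d_2$ with $d_1+d_2=d-1$, its Milnor algebra $M(f)=S/\langle f_x,f_y,f_z\rangle$ has the minimal graded free resolution $$0\to S(1-d-d_1)\oplus S(1-d-d_2)\to S^3(1-d)\to S\to M(f)\to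 0 .$$ It is *rigid* if the moduli space of its complex realizations is zero-dimensional, i.e. if, up to the action of $\mathrm{PGL}_3(\mathbb{C})$, there are only finitely many families of lines, indexed by the lines of the arrangement, in which the same triples of lines are linearly independent. Then: 1. $\mathcal{O}_{61}$ consists of $61$ lines, is free and rigid, and has $$n_2=335,\quad n_3=140,\quad n_5=70,\quad n_{10}=1,\quad n_{12}=5,$$ with $n_k=0$ for every other $k\ge 2$. 2. $\mathcal{O}_{49}$ consists of $49$ lines, is free and rigid, and has $$n_2=204,\quad n_3=96,\quad n_4=6,\quad n_5=24,\quad n_6=6,\quad n_7=12,\quad n_{12}=1,$$ with $n_k=0$ for every other $k\ge 2$. 3. The lines of $\mathcal{C}_{10}$ are defined over a quadratic extension of $\mathbb{Q}(\sqrt5)$ inside $\mathbb{C}$, and there is a projective transformation that sends every line of $\mathcal{C}_{10}$ and every line of $\mathcal{O}_{61}$ to a line with an equation over $\mathbb{Q}(\sqrt5)$. 4. All lines of $\mathcal{C}_{12}$ and of $\mathcal{O}_{49}$ have equations over $\mathbb{Q}(\sqrt3)$. -/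

import Mathlib

open scoped LinearAlgebra.Projectivization MatrixGroups

noncomputable section

namespace PointLine

/-- The complex projective plane. It also serves as the dual plane: the line
`a x + b y + c z = 0` is the element `(a : b : c)`, and the point `p` lies on the line `ℓ` iff
`p.orthogonal ℓ`. A line arrangement is a (finite) set of lines. -/
abbrev Plane : Type := ℙ ℂ (Fin 3 → ℂ)

/-- The operator `𝒟_𝔫`: for a set `S` of elements of the plane, all elements `q` of the dual plane
that are incident with exactly `n` members of `S` for some `n ∈ 𝔫`. If `S` is an arrangement of
lines, these are the points of multiplicity in `𝔫`; if `S` is a set of points, these are the lines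
that are `n`-rich for some `n ∈ 𝔫`. -/
def dualOp (𝔫 : Set ℕ) (S : Set Plane) : Set Plane :=
  {q | {s ∈ S | s.orthogonal q}.ncard ∈ 𝔫}

/-- The point-line operator `Λ_{𝔫,𝔪}`: all lines whose number of points of multiplicity in `𝔫`
belongs to `𝔪`. -/
def pointLineOp (𝔫 𝔪 : Set ℕ) (L : Set Plane) : Set Plane :=
  dualOp 𝔪 (dualOp 𝔫 L)

/-- The number `n_k` of points that lie on exactly `k` lines of the arrangement. -/
def numPoints (L : Set Plane) (k : ℕ) : ℕ :=
  (dualOp {k} L).ncard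

/-- The `k`-th vertex `(cos (2πk/n), sin (2πk/n))` of the regular `n`-gon. -/
def vertex (n k : ℕ) : Plane :=
  Projectivization.mk ℂ
    ![((Real.cos (2 * Real.pi * k / n) : ℝ) : ℂ), ((Real.sin (2 * Real.pi * k / n) : ℝ) : ℂ), 1]
    (fun h => one_ne_zero (congrFun h 2))

/-- The arrangement `𝒞_n` of the lines that contain a side of the regular `n`-gon. -/
def polygon (n : ℕ) : Set Plane :=
  {ℓ | ∃ k < n, (vertex n k).orthogonal ℓ ∧ (vertex n (k + 1)).orthogonal ℓ}

/-- The arrangement `𝒪₆₁ = Λ_{{2},3}(𝒞₁₀)`; the lower index `3` stands for `{m | 3 ≤ m}`. -/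
def O61 : Set Plane := pointLineOp {2} (Set.Ici 3) (polygon 10)

/-- The arrangement `𝒪₄₉ = Λ_{{2},4}(𝒞₁₂)`; the lower index `4` stands for `{m | 4 ≤ m}`. -/
def O49 : Set Plane := pointLineOp {2} (Set.Ici 4) (polygon 12)

/-! ### Freeness -/

/-- The graded polynomial ring `S = ℂ[x, y, z]`. -/
abbrev S : Type := MvPolynomial (Fin 3) ℂ

/-- The Jacobian ideal of `f`. -/
def jacobianIdeal (f : S) : Ideal S :=
  Ideal.span (Set.range fun i => MvPolynomial.pderiv i f)

/-- The map `S³ → S`, `(a, b, c) ↦ a f_x + b f_y + c f_z`. -/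
def gradMap (f : S) : (Fin 3 → S) →ₗ[S] S :=
  Fintype.linearCombination S (fun i => MvPolynomial.pderiv i f)

/-- The curve `f = 0` of degree `d` is free with exponents `(d₁, d₂)`: the Milnor algebra
`M(f) = S / J_f` has the minimal graded free resolution
`0 → S(1-d-d₁) ⊕ S(1-d-d₂) → S³(1-d) → S → M(f) → 0` with `1 ≤ d₁ ≤ d₂` and `d₁ + d₂ = d - 1`.
The first map is a matrix `A` whose columns are homogeneous of degrees `d₁` and `d₂`. -/
def IsFreeWithExponents (d d₁ d₂ : ℕ) (f : S) : Prop :=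
  1 ≤ d₁ ∧ d₁ ≤ d₂ ∧ d₁ + d₂ + 1 = d ∧
  ∃ A : Matrix (Fin 3) (Fin 2) S,
    (∀ i, (A i 0).IsHomogeneous d₁ ∧ (A i 1).IsHomogeneous d₂) ∧
    Function.Injective A.mulVecLin ∧
    Function.Exact A.mulVecLin (gradMap f) ∧
    Function.Exact (gradMap f) (Ideal.Quotient.mk (jacobianIdeal f))

/-- A linear form that defines the line `ℓ`. -/
def lineForm (ℓ : Plane) : S :=
  ∑ i, MvPolynomial.C (ℓ.rep i) * MvPolynomial.X i

/-- The defining polynomial of a finite line arrangement (unique up to a nonzero constant). -/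
def definingPoly (L : Set Plane) : S :=
  ∏ᶠ ℓ ∈ L, lineForm ℓ

/-- The line arrangement `L` is free. -/
def IsFree (L : Set Plane) : Prop :=
  ∃ d₁ d₂ : ℕ, IsFreeWithExponents L.ncard d₁ d₂ (definingPoly L)

/-! ### Rigidity -/

/-- The realizations over `ℂ` of the rank-three matroid of the arrangement `L`: families of lines
indexed by `L` such that the same triples of members are bases, that is, linearly independent. -/
def Realization (L : Set Plane) : Type :=
  {ρ : L → Plane // ∀ a b c : L,
    Projectivization.Independent ![ρ a, ρ b, ρ c] ↔
      Projectivization.Independent ![(a : Plane), (b : Plane), (c : Plane)]}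

/-- Two realizations are equivalent if an element of `PGL₃(ℂ)` transforms one into the other. -/
def realizationSetoid (L : Set Plane) : Setoid (Realization L) :=
  (MulAction.orbitRel (Matrix.ProjGenLinGroup (Fin 3) ℂ) (L → Plane)).comap Subtype.val

/-- The set of closed points of the realization space (moduli space) of the matroid of `L`. -/
def Moduli (L : Set Plane) : Type :=
  Quotient (realizationSetoid L)

/-- The arrangement `L` is rigid: its moduli space has dimension zero. For a nonempty variety (or
scheme of finite type) over `ℂ` this says that there are only finitely many closed points, and the
moduli space of `L` contains the class of `L` itself. -/
def IsRigid (L : Set Plane) : Prop :=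
  Finite (Moduli L)

/-! ### Fields of definition -/

/-- Every line of `L` has an equation with coefficients in the field `K`. -/
def IsDefinedOver (K : Subfield ℂ) (L : Set Plane) : Prop :=
  ∀ ℓ ∈ L, ∃ (v : Fin 3 → ℂ) (hv : v ≠ 0), (∀ i, v i ∈ K) ∧ Projectivization.mk ℂ v hv = ℓ

/-- The field `ℚ(√m)` in `ℂ`. -/
abbrev QSqrt (m : ℕ) : IntermediateField ℚ ℂ :=
  IntermediateField.adjoin ℚ {((Real.sqrt m : ℝ) : ℂ)}

end PointLine

end

/-!
All four assertions are reduced to exact computations in `ℤ[√5]` and `ℤ[√3]`. In the coordinates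
`(x : y / τ : z)` with `τ = √(10 + 2 √5)` for the `10`-gon, and in the original ones for the
`12`-gon, all lines and points have coordinates in these rings (`polygon_ten`, `polygon_twelve`).
This gives the fields of definition: dividing the second coordinate by `τ` moves `𝒞₁₀` and `𝒪₆₁`
into the plane over `ℚ(√5)`, and `τ` is quadratic over `ℚ(√5)` since `80` is not the square of a
rational number (`finrank_adjoin_tau`).

*Points and lines.* The intersection points of a list of lines are enumerated by `meets`, each of
them once. The lists `lines61` and `lines49` are shown to be the images of the point-line operators:
their members contain enough double points of the polygon, and there are as many such lines as list
members (`pointLineOp_image`). To make the evaluation by the kernel feasible, `√D` is replaced by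
a huge integer `s`, modulo `s ^ 2 - D`; this does not change the vanishing of elements of `ℤ[√D]`
with small coordinates (`reduction_eq_zero_iff`).

*Freeness.* By Saito's criterion (`isFreeWithExponents_of_isTangent`) it suffices to find two
polynomial vector fields that are tangent to all lines, are independent together with the Euler
field, and have degrees `29 + 31 = 60` or `23 + 25 = 48`. They are found among the fields that are
invariant under the symmetry group of the polygon, `a E + b Φ` with invariant coefficients
(`dihedralField`). Each line other than the line at infinity has the form `X = α x + β y = -γ z`
with a direction fixed up to sign by a reflection in the symmetry group. There `X ^ 2 / m` is a
multiple of `z ^ 2` for `m = α ^ 2 + β ^ 2`, and tangency becomes the vanishing of a binary form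
over `ℤ[√D]` (`invariantField_tangent`). Only the direction class and the distance of the line from
the centre matter, which leaves five binary forms for each field on `𝒪₆₁` and three for each field
on `𝒪₄₉`.

*Rigidity.* The lines can be ordered such that the first four are in general position, the fifth
one passes through the meet of the first two, and each further line joins two points in which
earlier lines meet (`IsConstruction`). After a projective transformation a realization is therefore
determined by the parameter `t` of the fifth line `(1 : t : 0)`, and one more concurrence gives a
quadratic equation for `t` (`isRigid_O61`, `isRigid_O49`).
-/

/-! ### The projective plane with coordinates in a subring -/

namespace PointLine

/-- Homogeneous coordinates with entries in `R`. Triples are used instead of functions `Fin 3 → R`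
because the kernel evaluates them faster. -/
abbrev Vec (R : Type*) : Type _ := R × R × R

namespace Vec

variable {R : Type*} [CommRing R]

/-- The dot product of coordinate triples. -/
def dot (u v : Vec R) : R := u.1 * v.1 + u.2.1 * v.2.1 + u.2.2 * v.2.2

/-- The cross product of coordinate triples. -/
def cross (u v : Vec R) : Vec R :=
  (u.2.1 * v.2.2 - u.2.2 * v.2.1, u.2.2 * v.1 - u.1 * v.2.2, u.1 * v.2.1 - u.2.1 * v.1)

lemma dot_comm (u v : Vec R) : dot u v = dot v u := by simp only [dot]; ring

lemma cross_self (u : Vec R) : cross u u = 0 := by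
  ext <;> simp only [cross, Prod.fst_zero, Prod.snd_zero] <;> ring

lemma cross_comm_eq_zero {u v : Vec R} (h : cross u v = 0) : cross v u = 0 := by
  have h1 := congrArg Prod.fst h
  have h2 := congrArg (fun p => p.2.1) h
  have h3 := congrArg (fun p => p.2.2) h
  simp only [cross, Prod.fst_zero, Prod.snd_zero] at h1 h2 h3
  ext <;> simp only [cross, Prod.fst_zero, Prod.snd_zero]
  · linear_combination -h1
  · linear_combination -h2
  · linear_combination -h3

lemma dot_cross_left (u v : Vec R) : dot u (cross u v) = 0 := by simp only [dot, cross]; ring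

lemma dot_cross_right (u v : Vec R) : dot v (cross u v) = 0 := by simp only [dot, cross]; ring

end Vec

/-- The point with homogeneous coordinates `w`, with the junk value `(1 : 0 : 0)` for `w = 0`. -/
noncomputable def pt (w : Fin 3 → ℂ) : Plane :=
  open scoped Classical in
  if h : w ≠ 0 then Projectivization.mk ℂ w h
  else Projectivization.mk ℂ ![1, 0, 0] fun h => one_ne_zero (congrFun h 0)

lemma pt_eq_mk {w : Fin 3 → ℂ} (h : w ≠ 0) : pt w = Projectivization.mk ℂ w h := dif_pos h

lemma exists_pt_eq (q : Plane) : ∃ w, w ≠ 0 ∧ pt w = q :=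
  ⟨q.rep, q.rep_nonzero, by rw [pt_eq_mk q.rep_nonzero, q.mk_rep]⟩

lemma pt_orthogonal_pt {u v : Fin 3 → ℂ} (hu : u ≠ 0) (hv : v ≠ 0) :
    (pt u).orthogonal (pt v) ↔ u ⬝ᵥ v = 0 := by
  rw [pt_eq_mk hu, pt_eq_mk hv, Projectivization.orthogonal_mk]

lemma pt_eq_pt_iff {u v : Fin 3 → ℂ} (hu : u ≠ 0) (hv : v ≠ 0) :
    pt u = pt v ↔ crossProduct u v = 0 := by
  rw [pt_eq_mk hu, pt_eq_mk hv, Projectivization.mk_eq_mk_iff_crossProduct_eq_zero]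

/-- Two distinct lines have a unique common point, the cross product of their coordinates. -/
lemma eq_pt_crossProduct {u v : Fin 3 → ℂ} (hu : u ≠ 0) (hv : v ≠ 0)
    (huv : crossProduct u v ≠ 0) {q : Plane} (h1 : (pt u).orthogonal q)
    (h2 : (pt v).orthogonal q) : q = pt (crossProduct u v) := by
  obtain ⟨w, hw, rfl⟩ := exists_pt_eq q
  rw [pt_orthogonal_pt hu hw] at h1
  rw [pt_orthogonal_pt hv hw] at h2
  rw [pt_eq_pt_iff hw huv, cross_cross_eq_smul_sub_smul']
  rw [dotProduct_comm] at h2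
  simp [h1, h2]

section Embedding

variable {R : Type*} [CommRing R] (φ : R →+* ℂ) (τ : ℂ)

/-- The complex coordinates `(φ a, τ φ b, φ c)` of a triple over `R`. The scaling factor `τ` of the
second coordinate allows the `10`-gon to be described over `ℤ[√5]`. -/
def coords (v : Vec R) : Fin 3 → ℂ := ![φ v.1, τ * φ v.2.1, φ v.2.2]

/-- The element of the plane with coordinates `(φ a : τ φ b : φ c)`. -/
noncomputable def emb (v : Vec R) : Plane := pt (coords φ τ v)

variable {φ τ} (hφ : Function.Injective φ) (hτ : τ ≠ 0)
include hφ hτ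

lemma coords_ne_zero {v : Vec R} (hv : v ≠ 0) : coords φ τ v ≠ 0 := by
  intro h
  apply hv
  have h0 := congrFun h 0
  have h1 := congrFun h 1
  have h2 := congrFun h 2
  simp only [coords, Matrix.cons_val, Pi.zero_apply, mul_eq_zero, hτ, false_or,
    map_eq_zero_iff φ hφ] at h0 h1 h2
  ext <;> assumption

omit hφ in
lemma coords_dotProduct (u v : Vec R) :
    coords φ τ u ⬝ᵥ coords φ τ⁻¹ v = φ (Vec.dot u v) := by
  simp only [coords, Vec.dot, Matrix.vec3_dotProduct, Matrix.cons_val, map_add, map_mul]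
  field_simp

omit hφ in
lemma crossProduct_coords (u v : Vec R) :
    crossProduct (coords φ τ u) (coords φ τ v) = τ • coords φ τ⁻¹ (Vec.cross u v) := by
  rw [cross_apply]
  ext i
  fin_cases i <;> simp [coords, Vec.cross] <;> field_simp

lemma emb_orthogonal {u v : Vec R} (hu : u ≠ 0) (hv : v ≠ 0) :
    (emb φ τ u).orthogonal (emb φ τ⁻¹ v) ↔ Vec.dot u v = 0 := by
  rw [emb, emb, pt_orthogonal_pt (coords_ne_zero hφ hτ hu)
    (coords_ne_zero hφ (inv_ne_zero hτ) hv), coords_dotProduct hτ, map_eq_zero_iff φ hφ]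

lemma crossProduct_coords_eq_zero {u v : Vec R} :
    crossProduct (coords φ τ u) (coords φ τ v) = 0 ↔ Vec.cross u v = 0 := by
  rw [crossProduct_coords hτ, smul_eq_zero_iff_right hτ]
  constructor
  · intro h
    by_contra h0
    exact coords_ne_zero hφ (inv_ne_zero hτ) h0 h
  · intro h
    rw [h]
    ext i
    fin_cases i <;> simp [coords]

lemma emb_eq_emb_iff {u v : Vec R} (hu : u ≠ 0) (hv : v ≠ 0) :
    emb φ τ u = emb φ τ v ↔ Vec.cross u v = 0 := by
  rw [emb, emb, pt_eq_pt_iff (coords_ne_zero hφ hτ hu) (coords_ne_zero hφ hτ hv),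
    crossProduct_coords_eq_zero hφ hτ]

lemma eq_emb_cross {u v : Vec R} (hu : u ≠ 0) (hv : v ≠ 0) (huv : Vec.cross u v ≠ 0) {q : Plane}
    (h1 : (emb φ τ u).orthogonal q) (h2 : (emb φ τ v).orthogonal q) :
    q = emb φ τ⁻¹ (Vec.cross u v) := by
  have hc : crossProduct (coords φ τ u) (coords φ τ v) ≠ 0 :=
    mt (crossProduct_coords_eq_zero hφ hτ).1 huv
  rw [eq_pt_crossProduct (coords_ne_zero hφ hτ hu) (coords_ne_zero hφ hτ hv) hc h1 h2, emb,
    pt_eq_pt_iff hc (coords_ne_zero hφ (inv_ne_zero hτ) huv), crossProduct_coords hτ,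
    LinearMap.map_smul₂, _root_.cross_self, smul_zero]

end Embedding

/-! ### Intersection points of an arrangement -/

section Meets

variable {α β : Type*} (x : α → α → β) (inc : β → α → Bool)

/-- The intersection points of a list of lines, each listed once, where `x` is the meet of two lines
and `inc` the incidence relation: a new line `l` adds its meets with those earlier lines `m` for
which the point of intersection lies on no other earlier line. -/
def meets : List α → List β
  | [] => []
  | l :: L => ((L.map (x l)).filter fun c => Nat.beq (L.countP (inc c)) 1) ++ meets L

/-- The intersection points whose multiplicity satisfies `t`. -/
def meetsOf (t : ℕ → Bool) (L : List α) : List β :=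
  (meets x inc L).filter fun c => t (L.countP (inc c))

end Meets

section Incidence

variable {R : Type*} [CommRing R] [DecidableEq R]

/-- Incidence of a point and a line. -/
def Vec.inc (c l : Vec R) : Bool := decide (Vec.dot l c = 0)

/-- The triples of the list represent pairwise distinct elements of the projective plane. -/
def Distinct (L : List (Vec R)) : Prop :=
  (∀ v ∈ L, v ≠ 0) ∧ L.Pairwise fun u v => Vec.cross u v ≠ 0

variable {φ : R →+* ℂ} {τ : ℂ} (hφ : Function.Injective φ) (hτ : τ ≠ 0)

omit [DecidableEq R] in
lemma Distinct.sublist {L L' : List (Vec R)} (h : Distinct L) (hs : L'.Sublist L) : Distinct L' :=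
  ⟨fun v hv => h.1 v (hs.subset hv), h.2.sublist hs⟩

omit [DecidableEq R] in
lemma Distinct.nodup {L : List (Vec R)} (h : Distinct L) : L.Nodup :=
  h.2.imp fun huv => by rintro rfl; exact huv (Vec.cross_self _)

omit [DecidableEq R] in
lemma Distinct.cross_ne_zero {L : List (Vec R)} (h : Distinct L) {u v : Vec R} (hu : u ∈ L)
    (hv : v ∈ L) (huv : u ≠ v) : Vec.cross u v ≠ 0 :=
  haveI : Std.Symm fun u v : Vec R => Vec.cross u v ≠ 0 :=
    ⟨fun _ _ h1 h2 => h1 (Vec.cross_comm_eq_zero h2)⟩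
  h.2.forall hu hv huv

include hφ hτ

omit [DecidableEq R] in
lemma Distinct.injOn {L : List (Vec R)} (h : Distinct L) :
    Set.InjOn (emb φ τ) {v | v ∈ L} := by
  intro u hu v hv huv
  by_contra hne
  exact h.cross_ne_zero hu hv hne ((emb_eq_emb_iff hφ hτ (h.1 u hu) (h.1 v hv)).1 huv)

omit [DecidableEq R] in
lemma Distinct.ncard_image {L : List (Vec R)} (h : Distinct L) :
    (emb φ τ '' {v | v ∈ L}).ncard = L.length := by
  classical
  rw [(h.injOn hφ hτ).ncard_image, ← List.toFinset_card_of_nodup h.nodup,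
    ← Set.ncard_coe_finset]
  congr 1
  ext v
  simp

open scoped Classical in
omit [DecidableEq R] in
lemma Distinct.ncard_orthogonal {L : List (Vec R)} (h : Distinct L) (q : Plane) :
    {s ∈ emb φ τ '' {v | v ∈ L} | s.orthogonal q}.ncard =
      L.countP fun v => decide ((emb φ τ v).orthogonal q) := by
  have hs : Distinct (L.filter fun v => decide ((emb φ τ v).orthogonal q)) :=
    h.sublist List.filter_sublist
  rw [List.countP_eq_length_filter, ← hs.ncard_image hφ hτ]
  congr 1
  ext s
  simp only [Set.mem_ofPred_eq, Set.mem_image, List.mem_filter, decide_eq_true_eq]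
  grind

open scoped Classical in
lemma countP_orthogonal {L : List (Vec R)} (h : ∀ v ∈ L, v ≠ 0) {c : Vec R} (hc : c ≠ 0) :
    (L.countP fun v => decide ((emb φ τ v).orthogonal (emb φ τ⁻¹ c))) = L.countP c.inc := by
  apply List.countP_congr
  intro v hv
  simp [Vec.inc, emb_orthogonal hφ hτ (h v hv) hc]

open scoped Classical in
/-- Every point of multiplicity at least two is listed. -/
lemma exists_mem_meets {q : Plane} {L : List (Vec R)} (h : Distinct L)
    (hq : 2 ≤ L.countP fun v => decide ((emb φ τ v).orthogonal q)) :
    ∃ c ∈ meets Vec.cross Vec.inc L, c ≠ 0 ∧ emb φ τ⁻¹ c = q := by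
  induction L with
  | nil => simp at hq
  | cons l L ih =>
    have hL : Distinct L := h.sublist (List.sublist_cons_self l L)
    by_cases h2 : 2 ≤ L.countP fun v => decide ((emb φ τ v).orthogonal q)
    · obtain ⟨c, hc, hc'⟩ := ih hL h2
      exact ⟨c, List.mem_append_right _ hc, hc'⟩
    · rw [List.countP_cons] at hq
      split_ifs at hq with hl
      · have h1 : L.countP (fun v => decide ((emb φ τ v).orthogonal q)) = 1 := by omega
        obtain ⟨m, hm, hmq⟩ := List.countP_pos_iff.1 (h1 ▸ one_pos)
        simp only [decide_eq_true_eq] at hl hmq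
        have hlm : Vec.cross l m ≠ 0 := List.rel_of_pairwise_cons h.2 hm
        have hq' := eq_emb_cross hφ hτ (h.1 l List.mem_cons_self) (hL.1 m hm) hlm hl hmq
        refine ⟨Vec.cross l m, List.mem_append_left _ ?_, hlm, hq'.symm⟩
        rw [hq', countP_orthogonal hφ hτ hL.1 hlm] at h1
        simp only [List.mem_filter, List.mem_map]
        exact ⟨⟨m, hm, rfl⟩, by rw [h1]; rfl⟩
      · omega

omit hφ hτ in
lemma of_mem_meets {L : List (Vec R)} (h : Distinct L) {c : Vec R}
    (hc : c ∈ meets Vec.cross Vec.inc L) : c ≠ 0 ∧ 2 ≤ L.countP c.inc := by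
  induction L with
  | nil => simp [meets] at hc
  | cons l L ih =>
    rcases List.mem_append.1 hc with hc | hc
    · simp only [List.mem_filter, List.mem_map] at hc
      obtain ⟨⟨m, hm, rfl⟩, h1⟩ := hc
      refine ⟨List.rel_of_pairwise_cons h.2 hm, ?_⟩
      rw [List.countP_cons, Nat.eq_of_beq_eq_true h1]
      simp [Vec.inc, Vec.dot_cross_left]
    · have := ih (h.sublist (List.sublist_cons_self l L)) hc
      refine ⟨this.1, this.2.trans ?_⟩
      rw [List.countP_cons]
      omega

/-- No point is listed twice. -/
lemma distinct_meets {L : List (Vec R)} (h : Distinct L) :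
    Distinct (meets Vec.cross Vec.inc L) := by
  refine ⟨fun c hc => (of_mem_meets h hc).1, ?_⟩
  induction L with
  | nil => exact List.Pairwise.nil
  | cons l L ih =>
    have hL : Distinct L := h.sublist (List.sublist_cons_self l L)
    have hτ' := inv_ne_zero hτ
    -- proportional points lie on the same lines
    have key : ∀ c d : Vec R, c ≠ 0 → d ≠ 0 → Vec.cross c d = 0 →
        L.countP c.inc = L.countP d.inc := by
      intro c d hc hd hcd
      rw [← countP_orthogonal hφ hτ hL.1 hc, ← countP_orthogonal hφ hτ hL.1 hd,
        (emb_eq_emb_iff hφ hτ' hc hd).2 hcd]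
    refine List.pairwise_append.2 ⟨?_, ih hL, ?_⟩
    · rw [List.pairwise_filter, List.pairwise_map]
      refine hL.2.imp_of_mem ?_
      intro m m' hm hm' hmm h1 h1' h0
      have hc := List.rel_of_pairwise_cons h.2 hm
      have hc' := List.rel_of_pairwise_cons h.2 hm'
      have hne : m ≠ m' := by rintro rfl; exact hmm (Vec.cross_self _)
      have e := (emb_eq_emb_iff hφ hτ' hc hc').2 h0
      have hi : (Vec.cross l m).inc m' = true := by
        have := (emb_orthogonal hφ hτ (hL.1 m' hm') hc').2 (Vec.dot_cross_right l m')
        rw [← e, emb_orthogonal hφ hτ (hL.1 m' hm') hc] at this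
        simpa [Vec.inc] using this
      have hi' : (Vec.cross l m).inc m = true := by simp [Vec.inc, Vec.dot_cross_right]
      have h1 := Nat.eq_of_beq_eq_true h1
      rw [List.countP_eq_length_filter, List.length_eq_one_iff] at h1
      obtain ⟨a, ha⟩ := h1
      have ha1 : m ∈ [a] := ha ▸ List.mem_filter.2 ⟨hm, hi'⟩
      have ha2 : m' ∈ [a] := ha ▸ List.mem_filter.2 ⟨hm', hi⟩
      simp only [List.mem_singleton] at ha1 ha2
      exact hne (ha1.trans ha2.symm)
    · intro c hc d hd h0
      simp only [List.mem_filter, List.mem_map] at hc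
      obtain ⟨⟨m, hm, rfl⟩, h1⟩ := hc
      have hd' := of_mem_meets hL hd
      have := key _ _ (List.rel_of_pairwise_cons h.2 hm) hd'.1 h0
      have h1 := Nat.eq_of_beq_eq_true h1
      omega

lemma distinct_meetsOf (t : ℕ → Bool) {L : List (Vec R)} (h : Distinct L) :
    Distinct (meetsOf Vec.cross Vec.inc t L) :=
  (distinct_meets hφ hτ h).sublist List.filter_sublist

/-- The operator `𝒟_T` for multiplicities at least two is computed by listing the intersection
points. -/
theorem dualOp_image {T : Set ℕ} {t : ℕ → Bool} (hT : ∀ k, t k = true ↔ k ∈ T)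
    (hT2 : ∀ k ∈ T, 2 ≤ k) {L : List (Vec R)} (h : Distinct L) :
    dualOp T (emb φ τ '' {v | v ∈ L}) =
      emb φ τ⁻¹ '' {c | c ∈ meetsOf Vec.cross Vec.inc t L} := by
  classical
  ext q
  rw [dualOp, Set.mem_ofPred_eq, h.ncard_orthogonal hφ hτ]
  simp only [Set.mem_ofPred_eq, Set.mem_image, meetsOf, List.mem_filter, hT]
  constructor
  · intro hq
    obtain ⟨c, hc, hc0, rfl⟩ := exists_mem_meets hφ hτ h (hT2 _ hq)
    rw [countP_orthogonal hφ hτ h.1 hc0] at hq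
    exact ⟨c, ⟨hc, hq⟩, rfl⟩
  · rintro ⟨c, ⟨hc, hq⟩, rfl⟩
    rwa [countP_orthogonal hφ hτ h.1 (of_mem_meets h hc).1]

theorem numPoints_image {k : ℕ} (hk : 2 ≤ k) {L : List (Vec R)} (h : Distinct L) :
    numPoints (emb φ τ '' {v | v ∈ L}) k =
      ((meets Vec.cross Vec.inc L).map fun c => L.countP c.inc).count k := by
  rw [numPoints, dualOp_image hφ hτ (t := fun m => m == k) (by simp) (by simpa using hk) h,
    (distinct_meetsOf hφ hτ _ h).ncard_image hφ (inv_ne_zero hτ), meetsOf,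
    ← List.countP_eq_length_filter, List.count, List.countP_map]
  rfl

end Incidence

/-! ### Fast evaluation of incidences -/

section Transport

variable {α β α' β' : Type*} {x : α → α → β} {inc : β → α → Bool} {x' : α' → α' → β'}
  {inc' : β' → α' → Bool}

lemma exists_of_mem_meets {L : List α} {c : β} (hc : c ∈ meets x inc L) :
    ∃ l ∈ L, ∃ m ∈ L, x l m = c := by
  induction L with
  | nil => simp [meets] at hc
  | cons l L ih =>
    rcases List.mem_append.1 hc with hc | hc
    · obtain ⟨⟨m, hm, rfl⟩, -⟩ := by simpa only [List.mem_filter, List.mem_map] using hc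
      exact ⟨l, List.mem_cons_self, m, List.mem_cons_of_mem l hm, rfl⟩
    · obtain ⟨a, ha, b, hb, h⟩ := ih hc
      exact ⟨a, List.mem_cons_of_mem l ha, b, List.mem_cons_of_mem l hb, h⟩

lemma filter_map_of_eq {f : α → β} {p : α → Bool} {q : β → Bool} {l : List α}
    (h : ∀ a ∈ l, q (f a) = p a) : (l.map f).filter q = (l.filter p).map f := by
  rw [List.filter_map]
  exact congrArg _ (List.filter_congr h)

lemma countP_map_of_eq {f : α → β} {p : α → Bool} {q : β → Bool} {l : List α}
    (h : ∀ a ∈ l, q (f a) = p a) : (l.map f).countP q = l.countP p := by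
  rw [List.countP_map]
  exact List.countP_congr fun a ha => by simp [h a ha]

lemma meets_map {f : α → α'} {g : β → β'} (hx : ∀ l m, x' (f l) (f m) = g (x l m)) {L : List α}
    (hinc : ∀ l ∈ L, ∀ m ∈ L, ∀ k ∈ L, inc' (g (x l m)) (f k) = inc (x l m) k) :
    meets x' inc' (L.map f) = (meets x inc L).map g := by
  induction L with
  | nil => rfl
  | cons l L ih =>
    have ih' := ih fun a ha b hb c hc => hinc a (List.mem_cons_of_mem l ha) b
      (List.mem_cons_of_mem l hb) c (List.mem_cons_of_mem l hc)
    rw [List.map_cons, meets, meets, ih', List.map_append]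
    congr 1
    rw [List.map_map, show x' (f l) ∘ f = g ∘ x l from funext fun m => hx l m, ← List.map_map]
    apply filter_map_of_eq
    intro c hc
    obtain ⟨m, hm, rfl⟩ := List.mem_map.1 hc
    rw [countP_map_of_eq fun k hk => hinc l List.mem_cons_self m (List.mem_cons_of_mem l hm) k
      (List.mem_cons_of_mem l hk)]

lemma meetsOf_map {f : α → α'} {g : β → β'} (hx : ∀ l m, x' (f l) (f m) = g (x l m)) {L : List α}
    (hinc : ∀ l ∈ L, ∀ m ∈ L, ∀ k ∈ L, inc' (g (x l m)) (f k) = inc (x l m) k) (t : ℕ → Bool) :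
    meetsOf x' inc' t (L.map f) = (meetsOf x inc t L).map g := by
  rw [meetsOf, meets_map hx hinc]
  apply filter_map_of_eq
  intro c hc
  obtain ⟨l, hl, m, hm, rfl⟩ := exists_of_mem_meets hc
  rw [countP_map_of_eq fun k hk => hinc l hl m hm k hk]

end Transport

/-- Coordinates modulo a natural number `M`, represented by natural numbers, for which the kernel
has built-in arithmetic. -/
structure NVec where
  /-- The first coordinate. -/
  x : ℕ
  /-- The second coordinate. -/
  y : ℕ
  /-- The third coordinate. -/
  z : ℕ

namespace NVec

/-- The residue of `a * b - c * d` modulo `M`. -/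
def minor (M a b c d : ℕ) : ℕ :=
  Nat.mod (Nat.add (Nat.mul a b) (Nat.sub M (Nat.mod (Nat.mul c d) M))) M

/-- The cross product modulo `M`. -/
def cross (M : ℕ) (u v : NVec) : NVec :=
  ⟨minor M u.y v.z u.z v.y, minor M u.z v.x u.x v.z, minor M u.x v.y u.y v.x⟩

/-- Incidence modulo `M`. -/
def inc (M : ℕ) (c l : NVec) : Bool :=
  Nat.beq (Nat.mod (Nat.add (Nat.add (Nat.mul l.x c.x) (Nat.mul l.y c.y)) (Nat.mul l.z c.z)) M) 0

/-- The value `f n`. The recursor makes the kernel evaluate `n` to a numeral first. -/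
def force {β : Type*} (n : ℕ) (f : ℕ → β) : β :=
  Nat.rec (f 0) (fun k _ => f (Nat.succ k)) n

lemma force_eq {β : Type*} (n : ℕ) (f : ℕ → β) : force n f = f n := by cases n <;> rfl

/-- The value `f v`, with the coordinates of `v` evaluated first. -/
def forceVec {β : Type*} (v : NVec) (f : NVec → β) : β :=
  force v.x fun x => force v.y fun y => force v.z fun z => f ⟨x, y, z⟩

lemma forceVec_eq {β : Type*} (v : NVec) (f : NVec → β) : forceVec v f = f v := by
  simp only [forceVec, force_eq]

/-- The value `f L`, with the list `L` evaluated first. -/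
def forceList {β : Type*} : List NVec → (List NVec → β) → β
  | [], f => f []
  | v :: L, f => forceVec v fun v' => forceList L fun L' => f (v' :: L')

lemma forceList_eq {β : Type*} (L : List NVec) (f : List NVec → β) : forceList L f = f L := by
  induction L generalizing f with
  | nil => rfl
  | cons v L ih => rw [forceList, forceVec_eq, ih]

/-- The value `f l`, with the list `l` evaluated first. -/
def forceNats {β : Type*} : List ℕ → (List ℕ → β) → β
  | [], f => f []
  | n :: l, f => force n fun n' => forceNats l fun l' => f (n' :: l')

lemma forceNats_eq {β : Type*} (l : List ℕ) (f : List ℕ → β) : forceNats l f = f l := by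
  induction l generalizing f with
  | nil => rfl
  | cons n l ih => rw [forceNats, force_eq, ih]

/-- The number of lines of the list through `c`. -/
def mult (M : ℕ) (c : NVec) : List NVec → ℕ
  | [] => 0
  | l :: L => bif inc M c l then Nat.succ (mult M c L) else mult M c L

lemma mult_eq (M : ℕ) (c : NVec) (L : List NVec) : mult M c L = L.countP (inc M c) := by
  induction L with
  | nil => rfl
  | cons l L ih =>
    rw [mult, ih, List.countP_cons]
    cases inc M c l <;> simp

/-- The meets of `l` with lines of the second list through which no other line of `L` passes. -/
def meetsWith (M : ℕ) (l : NVec) (L : List NVec) : List NVec → List NVec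
  | [] => []
  | m :: L' => forceVec (cross M l m) fun c =>
      bif Nat.beq (mult M c L) 1 then c :: meetsWith M l L L' else meetsWith M l L L'

lemma meetsWith_eq (M : ℕ) (l : NVec) (L L' : List NVec) : meetsWith M l L L' =
    (L'.map (cross M l)).filter fun c => Nat.beq (L.countP (inc M c)) 1 := by
  induction L' with
  | nil => rfl
  | cons m L' ih =>
    rw [meetsWith, forceVec_eq, ih, List.map_cons, List.filter_cons, mult_eq]
    cases (L.countP (inc M (cross M l m))).beq 1 <;> rfl

/-- The list `meets` in a form suited to evaluation. -/
def meetsEval (M : ℕ) : List NVec → List NVec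
  | [] => []
  | l :: L => meetsWith M l L L ++ meetsEval M L

lemma meetsEval_eq (M : ℕ) (L : List NVec) : meetsEval M L = meets (cross M) (inc M) L := by
  induction L with
  | nil => rfl
  | cons l L ih => rw [meetsEval, meets, ih, meetsWith_eq]

/-- The list `meetsOf` in a form suited to evaluation. -/
def meetsOfEval (M : ℕ) (t : ℕ → Bool) (L : List NVec) : List NVec :=
  (meetsEval M L).filter fun c => t (mult M c L)

lemma meetsOfEval_eq (M : ℕ) (t : ℕ → Bool) (L : List NVec) :
    meetsOfEval M t L = meetsOf (cross M) (inc M) t L := by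
  simp only [meetsOfEval, meetsOf, meetsEval_eq, mult_eq]

end NVec

/-! ### Reduction modulo `s² - D` -/

section Shadow

/-- The large natural number `s` that plays the role of a square root of `D`. -/
def bigRoot : ℕ := 10 ^ 30

variable {D : ℕ}

/-- Reduction of `ℤ[√D]` modulo `s² - D`, where `√D` becomes `s`. -/
def reduction (hD : D < bigRoot) : ℤ√(D : ℤ) →+* ZMod (bigRoot ^ 2 - D) :=
  Zsqrtd.lift ⟨(bigRoot : ZMod (bigRoot ^ 2 - D)), by
    have := ZMod.natCast_self (bigRoot ^ 2 - D)
    rw [Nat.cast_sub (by nlinarith)] at this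
    push_cast at this ⊢
    linear_combination this⟩

/-- Both integral coordinates of an element of `ℤ[√D]` are bounded by `B`. -/
def Bounded (B : ℕ) (x : ℤ√(D : ℤ)) : Prop := |x.re| ≤ B ∧ |x.im| ≤ B

/-- All coordinates are bounded by `B`. -/
def BoundedVec (B : ℕ) (v : Vec (ℤ√(D : ℤ))) : Prop :=
  Bounded B v.1 ∧ Bounded B v.2.1 ∧ Bounded B v.2.2

instance (B : ℕ) (v : Vec (ℤ√(D : ℤ))) : Decidable (BoundedVec B v) := by
  unfold BoundedVec Bounded; infer_instance

/-- Reduction detects the vanishing of elements with small coordinates. -/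
lemma reduction_eq_zero_iff (hD : D < bigRoot) {B : ℕ} (hB : B + 2 ≤ bigRoot) {x : ℤ√(D : ℤ)}
    (hx : Bounded B x) : reduction hD x = 0 ↔ x = 0 := by
  refine ⟨fun h => ?_, fun h => by rw [h, map_zero]⟩
  obtain ⟨h1, h2⟩ := hx
  have h' : ((x.re + x.im * bigRoot : ℤ) : ZMod (bigRoot ^ 2 - D)) = 0 := by
    rw [← h, reduction, Zsqrtd.lift_apply_apply]
    push_cast
    rfl
  rw [ZMod.intCast_zmod_eq_zero_iff_dvd, Nat.cast_sub (by nlinarith)] at h'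
  zify at hB hD
  push_cast at h'
  have hs : (0 : ℤ) ≤ bigRoot := by positivity
  generalize (bigRoot : ℤ) = s at *
  have hlt : |x.re + x.im * s| < s ^ 2 - D := by
    calc |x.re + x.im * s| ≤ |x.re| + |x.im| * s := by
          refine (abs_add_le _ _).trans_eq ?_
          rw [abs_mul, abs_of_nonneg hs]
      _ ≤ B + B * s := by gcongr
      _ < s ^ 2 - D := by nlinarith
  have h0 := Int.eq_zero_of_abs_lt_dvd h' hlt
  have him : x.im = 0 := by
    by_contra hne
    have : 1 ≤ |x.im| := Int.one_le_abs hne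
    have h3 : |x.re| = |x.im| * s := by
      rw [eq_neg_of_add_eq_zero_left h0, abs_neg, abs_mul, abs_of_nonneg hs]
    nlinarith
  rw [him, zero_mul, add_zero] at h0
  exact Zsqrtd.ext h0 him

lemma Bounded.mul {B B' : ℕ} {x y : ℤ√(D : ℤ)} (hx : Bounded B x) (hy : Bounded B' y) :
    Bounded ((2 + D) * (B * B')) (x * y) := by
  obtain ⟨h1, h2⟩ := hx
  obtain ⟨h3, h4⟩ := hy
  have key : ∀ {a b : ℤ}, |a| ≤ B → |b| ≤ B' → |a * b| ≤ B * B' := fun ha hb => by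
    rw [abs_mul]
    exact mul_le_mul ha hb (abs_nonneg _) (by positivity)
  have k1 := key h1 h3
  have k2 := key h2 h4
  have k3 := key h1 h4
  have k4 := key h2 h3
  have hD : (0 : ℤ) ≤ D := by positivity
  constructor
  · rw [Zsqrtd.re_mul, mul_assoc]
    push_cast
    refine (abs_add_le _ _).trans ?_
    rw [abs_mul (D : ℤ), abs_of_nonneg hD]
    nlinarith [abs_nonneg (x.im * y.im)]
  · rw [Zsqrtd.im_mul]
    push_cast
    refine (abs_add_le _ _).trans ?_
    nlinarith [abs_nonneg (x.im * y.re)]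

lemma Bounded.add {B B' : ℕ} {x y : ℤ√(D : ℤ)} (hx : Bounded B x) (hy : Bounded B' y) :
    Bounded (B + B') (x + y) := by
  constructor
  · rw [Zsqrtd.re_add]
    push_cast
    exact (abs_add_le _ _).trans (add_le_add hx.1 hy.1)
  · rw [Zsqrtd.im_add]
    push_cast
    exact (abs_add_le _ _).trans (add_le_add hx.2 hy.2)

lemma Bounded.neg {B : ℕ} {x : ℤ√(D : ℤ)} (hx : Bounded B x) : Bounded B (-x) := by
  rw [Bounded, Zsqrtd.re_neg, Zsqrtd.im_neg, abs_neg, abs_neg]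
  exact hx

lemma Bounded.sub_mul {B : ℕ} {a b c d : ℤ√(D : ℤ)} (ha : Bounded B a) (hb : Bounded B b)
    (hc : Bounded B c) (hd : Bounded B d) :
    Bounded ((2 + D) * (B * B) + (2 + D) * (B * B)) (a * b - c * d) := by
  rw [sub_eq_add_neg]
  exact (ha.mul hb).add (hc.mul hd).neg

lemma BoundedVec.cross {B : ℕ} {u v : Vec (ℤ√(D : ℤ))} (hu : BoundedVec B u)
    (hv : BoundedVec B v) :
    BoundedVec ((2 + D) * (B * B) + (2 + D) * (B * B)) (Vec.cross u v) :=
  ⟨hu.2.1.sub_mul hv.2.2 hu.2.2 hv.2.1, hu.2.2.sub_mul hv.1 hu.1 hv.2.2,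
    hu.1.sub_mul hv.2.1 hu.2.1 hv.1⟩

lemma BoundedVec.dot {B B' : ℕ} {u v : Vec (ℤ√(D : ℤ))} (hu : BoundedVec B u)
    (hv : BoundedVec B' v) : Bounded (3 * ((2 + D) * (B * B'))) (Vec.dot u v) := by
  have := ((hu.1.mul hv.1).add (hu.2.1.mul hv.2.1)).add (hu.2.2.mul hv.2.2)
  rw [show 3 * ((2 + D) * (B * B')) = (2 + D) * (B * B') + (2 + D) * (B * B') +
    (2 + D) * (B * B') by ring]
  exact this

/-- The residues of the coordinates of a vector. -/
def shadow (hD : D < bigRoot) (v : Vec (ℤ√(D : ℤ))) : NVec :=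
  ⟨(reduction hD v.1).val, (reduction hD v.2.1).val, (reduction hD v.2.2).val⟩

lemma neZero_modulus (hD : D < bigRoot) : NeZero (bigRoot ^ 2 - D) :=
  ⟨by have : D < bigRoot ^ 2 := by nlinarith
      omega⟩

lemma cross_shadow (hD : D < bigRoot) (u v : Vec (ℤ√(D : ℤ))) :
    NVec.cross (bigRoot ^ 2 - D) (shadow hD u) (shadow hD v) = shadow hD (Vec.cross u v) := by
  have := neZero_modulus hD
  have key : ∀ a b c d : ℤ√(D : ℤ), NVec.minor (bigRoot ^ 2 - D) (reduction hD a).val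
      (reduction hD b).val (reduction hD c).val (reduction hD d).val =
      (reduction hD (a * b - c * d)).val := by
    intro a b c d
    rw [NVec.minor]
    change (_ * _ + (_ - (_ * _) % _) : ℕ) % _ = _
    rw [← ZMod.val_natCast]
    congr 1
    rw [Nat.cast_add, Nat.cast_sub (Nat.mod_lt _ (NeZero.pos _)).le]
    simp [sub_eq_add_neg]
  simp only [NVec.cross, shadow, key, Vec.cross]

lemma inc_shadow (hD : D < bigRoot) {B B' : ℕ} (hB : 3 * ((2 + D) * (B * B')) + 2 ≤ bigRoot)
    {c l : Vec (ℤ√(D : ℤ))} (hc : BoundedVec B' c) (hl : BoundedVec B l) :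
    NVec.inc (bigRoot ^ 2 - D) (shadow hD c) (shadow hD l) = Vec.inc c l := by
  have := neZero_modulus hD
  rw [Bool.eq_iff_iff, Vec.inc, decide_eq_true_iff, ← reduction_eq_zero_iff hD hB (hl.dot hc),
    NVec.inc]
  change Nat.beq ((_ * _ + _ * _ + _ * _) % _) 0 = true ↔ _
  rw [Nat.beq_eq, ← Nat.dvd_iff_mod_eq_zero, ← ZMod.natCast_eq_zero_iff]
  simp [shadow, Vec.dot]

/-- The residues of the coordinates of a vector, in a form suited to evaluation. -/
def NVec.ofVec (M : ℕ) (v : Vec (ℤ√(D : ℤ))) : NVec :=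
  ⟨((v.1.re + v.1.im * bigRoot) % M).toNat, ((v.2.1.re + v.2.1.im * bigRoot) % M).toNat,
    ((v.2.2.re + v.2.2.im * bigRoot) % M).toNat⟩

lemma ofVec_eq_shadow (hD : D < bigRoot) :
    (NVec.ofVec (bigRoot ^ 2 - D) : Vec (ℤ√(D : ℤ)) → NVec) = shadow hD := by
  have := neZero_modulus hD
  have key : ∀ a : ℤ√(D : ℤ), ((a.re + a.im * bigRoot) % (bigRoot ^ 2 - D : ℕ)).toNat =
      (reduction hD a).val := by
    intro a
    rw [← ZMod.val_intCast, Int.toNat_natCast, reduction, Zsqrtd.lift_apply_apply]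
    push_cast
    rfl
  funext v
  simp only [NVec.ofVec, shadow, key]

/-- For the double points `P` of `C`, every element of `L` is incident with a number of members of
`P` that satisfies `t`, and `L` has as many elements as there are such lines. -/
def checkRich (t : ℕ → Bool) (C L : List (Vec (ℤ√(D : ℤ)))) : Bool :=
  NVec.force (bigRoot ^ 2 - D) fun M =>
  NVec.forceList (C.map (NVec.ofVec M)) fun C =>
  NVec.forceList (L.map (NVec.ofVec M)) fun L =>
  NVec.forceList (NVec.meetsOfEval M (fun k => Nat.beq k 2) C) fun P =>
    L.all (fun l => t (NVec.mult M l P)) &&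
      Nat.beq (NVec.meetsOfEval M t P).length L.length

/-- The multiplicities of the points of `L` have the given frequencies. -/
def checkMultiplicities (L : List (Vec (ℤ√(D : ℤ)))) (freq : List (ℕ × ℕ)) : Bool :=
  NVec.force (bigRoot ^ 2 - D) fun M =>
  NVec.forceList (L.map (NVec.ofVec M)) fun L =>
  NVec.forceNats ((NVec.meetsEval M L).map fun c => NVec.mult M c L) fun ms =>
    freq.all (fun p => Nat.beq (ms.count p.1) p.2) &&
      ms.all fun m => freq.any fun p => Nat.beq p.1 m

variable {φ : ℤ√(D : ℤ) →+* ℂ} {τ : ℂ}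

lemma inc_shadow_cross (hD : D < bigRoot) {B : ℕ} {L : List (Vec (ℤ√(D : ℤ)))}
    (hL : ∀ v ∈ L, BoundedVec B v)
    (hB : 3 * ((2 + D) * (B * ((2 + D) * (B * B) + (2 + D) * (B * B)))) + 2 ≤ bigRoot) :
    ∀ l ∈ L, ∀ m ∈ L, ∀ k ∈ L, NVec.inc (bigRoot ^ 2 - D) (shadow hD (Vec.cross l m))
      (shadow hD k) = Vec.inc (Vec.cross l m) k := fun l hl m hm k hk =>
  inc_shadow hD hB ((hL l hl).cross (hL m hm)) (hL k hk)

/-- For lines with integral coordinates up to `1000`, the coordinates of their meets are at most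
`10 ^ 8`, and `bigRoot` is large enough for the incidences of such meets with their joins. -/
lemma bound_le_bigRoot (hD : D < 10) {B : ℕ} (hB : B ≤ 10 ^ 8) :
    3 * ((2 + D) * (B * ((2 + D) * (B * B) + (2 + D) * (B * B)))) + 2 ≤ bigRoot := by
  have hD12 : 2 + D ≤ 12 := by omega
  calc _ ≤ 3 * (12 * (10 ^ 8 * (12 * (10 ^ 8 * 10 ^ 8) + 12 * (10 ^ 8 * 10 ^ 8)))) + 2 := by gcongr
    _ ≤ bigRoot := by norm_num [bigRoot]

/-- The point-line operator `Λ_{{2},T}` by evaluation modulo `s² - D`. The lines of `L` are found to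
belong to the image of the operator, and equality follows by comparison of the cardinalities. -/
theorem pointLineOp_image (hφ : Function.Injective φ) (hτ : τ ≠ 0) (hD : D < 10) {T : Set ℕ}
    {t : ℕ → Bool} (hT : ∀ k, t k = true ↔ k ∈ T) (hT2 : ∀ k ∈ T, 2 ≤ k)
    {C L : List (Vec (ℤ√(D : ℤ)))} (hC : Distinct C) (hL : Distinct L)
    (hCB : ∀ v ∈ C, BoundedVec 1000 v) (hLB : ∀ v ∈ L, BoundedVec 1000 v)
    (h : checkRich t C L = true) :
    pointLineOp {2} T (emb φ τ '' {v | v ∈ C}) = emb φ τ '' {v | v ∈ L} := by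
  have hD' : D < bigRoot := hD.trans (by norm_num [bigRoot])
  simp only [checkRich, NVec.force_eq, NVec.forceList_eq, NVec.meetsOfEval_eq,
    ofVec_eq_shadow hD'] at h
  rw [meetsOf_map (cross_shadow hD')
    (inc_shadow_cross hD' hCB (bound_le_bigRoot hD (by norm_num)))] at h
  set P := meetsOf Vec.cross Vec.inc (fun k => Nat.beq k 2) C with hP
  have hτ' := inv_ne_zero hτ
  have hPd : Distinct P := distinct_meetsOf hφ hτ _ hC
  have hPB : ∀ v ∈ P, BoundedVec ((2 + D) * (1000 * 1000) + (2 + D) * (1000 * 1000)) v := by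
    intro v hv
    obtain ⟨l, hl, m, hm, rfl⟩ := exists_of_mem_meets (List.mem_filter.1 hv).1
    exact (hCB l hl).cross (hCB m hm)
  have hB : (2 + D) * (1000 * 1000) + (2 + D) * (1000 * 1000) ≤ 10 ^ 8 := by omega
  have hD12 : 2 + D ≤ 12 := by omega
  rw [meetsOf_map (cross_shadow hD')
    (inc_shadow_cross hD' hPB (bound_le_bigRoot hD hB))] at h
  simp only [Bool.and_eq_true, List.all_eq_true, List.length_map, List.mem_map,
    forall_exists_index, and_imp, forall_apply_eq_imp_iff₂, NVec.mult_eq, Nat.beq_eq] at h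
  obtain ⟨h1, h2⟩ := h
  have hO := dualOp_image hφ hτ' hT hT2 hPd
  rw [inv_inv] at hO
  have hdual : pointLineOp {2} T (emb φ τ '' {v | v ∈ C}) =
      dualOp T (emb φ τ⁻¹ '' {v | v ∈ P}) := by
    rw [pointLineOp, dualOp_image hφ hτ (t := fun k => Nat.beq k 2) (by simp) (by simp) hC]
  rw [hdual]
  have hfin : (dualOp T (emb φ τ⁻¹ '' {v | v ∈ P})).Finite := by
    rw [hO]
    exact Set.Finite.image _ (List.finite_toSet _)
  symm
  apply Set.eq_of_subset_of_ncard_le _ _ hfin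
  · rintro _ ⟨l, hl, rfl⟩
    have hl' := h1 l hl
    rw [dualOp, Set.mem_ofPred_eq, hPd.ncard_orthogonal hφ hτ', ← hT]
    have := countP_orthogonal hφ hτ' hPd.1 (hL.1 l hl)
    rw [inv_inv] at this
    rw [this]
    rwa [countP_map_of_eq (p := l.inc) fun a ha => inc_shadow hD' ?_ (hLB l hl) (hPB a ha)] at hl'
    calc _ ≤ 3 * (12 * (10 ^ 8 * 1000)) + 2 := by gcongr
      _ ≤ bigRoot := by norm_num [bigRoot]
  · rw [hO, (distinct_meetsOf hφ hτ' t hPd).ncard_image hφ hτ, h2, hL.ncard_image hφ hτ]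

theorem numPoints_of_check (hφ : Function.Injective φ) (hτ : τ ≠ 0) (hD : D < 10)
    {L : List (Vec (ℤ√(D : ℤ)))} (hL : Distinct L) (hLB : ∀ v ∈ L, BoundedVec 1000 v)
    {freq : List (ℕ × ℕ)} (h : checkMultiplicities L freq = true) :
    (∀ p ∈ freq, 2 ≤ p.1 → numPoints (emb φ τ '' {v | v ∈ L}) p.1 = p.2) ∧
      ∀ k, 2 ≤ k → k ∉ freq.map Prod.fst → numPoints (emb φ τ '' {v | v ∈ L}) k = 0 := by
  have hD' : D < bigRoot := hD.trans (by norm_num [bigRoot])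
  have hinc := inc_shadow_cross hD' hLB (bound_le_bigRoot hD (by norm_num))
  simp only [checkMultiplicities, NVec.force_eq, NVec.forceList_eq, NVec.forceNats_eq,
    NVec.meetsEval_eq, NVec.mult_eq, ofVec_eq_shadow hD'] at h
  rw [meets_map (cross_shadow hD') hinc, List.map_map] at h
  have hms : (meets Vec.cross Vec.inc L).map ((fun c => List.countP (NVec.inc (bigRoot ^ 2 - D) c)
      (L.map (shadow hD'))) ∘ shadow hD') =
      (meets Vec.cross Vec.inc L).map fun c => L.countP c.inc := by
    apply List.map_congr_left
    intro c hc
    obtain ⟨l, hl, m, hm, rfl⟩ := exists_of_mem_meets hc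
    exact countP_map_of_eq (hinc l hl m hm)
  rw [hms, Bool.and_eq_true, List.all_eq_true, List.all_eq_true] at h
  constructor
  · intro p hp hp2
    rw [numPoints_image hφ hτ hp2 hL]
    exact Nat.eq_of_beq_eq_true (h.1 p hp)
  · intro k hk hkf
    rw [numPoints_image hφ hτ hk hL, List.count_eq_zero]
    intro hmem
    obtain ⟨p, hp, hpk⟩ := List.any_eq_true.1 (h.2 k hmem)
    exact hkf (List.mem_map.2 ⟨p, hp, Nat.eq_of_beq_eq_true hpk⟩)

end Shadow

/-! ### Coordinates of the regular polygons and of the two arrangements -/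

/-- The ring `ℤ[√D]` for a natural number `D`. -/
abbrev Quad (D : ℕ) : Type := ℤ√(D : ℤ)

/-- The embedding of `ℤ[√D]` into `ℂ`. -/
noncomputable def toComplex (D : ℕ) : Quad D →+* ℂ :=
  Zsqrtd.lift ⟨((√(D : ℝ) : ℝ) : ℂ), by
    rw [← Complex.ofReal_mul, Real.mul_self_sqrt D.cast_nonneg]
    simp⟩

lemma toComplex_apply {D : ℕ} (x : Quad D) :
    toComplex D x = x.re + x.im * ((√(D : ℝ) : ℝ) : ℂ) := rfl

lemma toComplex_injective {D : ℕ} (hD : ∀ n : ℤ, (D : ℤ) ≠ n * n) :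
    Function.Injective (toComplex D) := Zsqrtd.lift_injective _ hD

lemma toComplex_five_injective : Function.Injective (toComplex 5) := by
  apply toComplex_injective
  intro n h
  have : n.natAbs * n.natAbs = 5 := by
    rw [← Int.natAbs_mul, ← h]; rfl
  have : n.natAbs ≤ 5 := by nlinarith
  interval_cases n.natAbs <;> omega

lemma toComplex_three_injective : Function.Injective (toComplex 3) := by
  apply toComplex_injective
  intro n h
  have : n.natAbs * n.natAbs = 3 := by
    rw [← Int.natAbs_mul, ← h]; rfl
  have : n.natAbs ≤ 3 := by nlinarith
  interval_cases n.natAbs <;> omega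

/-- The scaling factor `τ = 4 sin (2π/5) = √(10 + 2√5)` for the `10`-gon. -/
noncomputable def tau : ℝ := √(10 + 2 * √5)

lemma tau_pos : 0 < tau := Real.sqrt_pos.2 (by positivity)

lemma tau_sq : tau ^ 2 = 10 + 2 * √5 := Real.sq_sqrt (by positivity)

lemma tau_ne_zero : (tau : ℂ) ≠ 0 := Complex.ofReal_ne_zero.2 tau_pos.ne'

/-- Multiples of the vertices of the regular `10`-gon; the second coordinate is multiplied
by `τ`. -/
def vertices10 : List (Vec (Quad 5)) := [
  (⟨4, 0⟩, ⟨0, 0⟩, ⟨4, 0⟩), (⟨1, 1⟩, ⟨0, 4⟩, ⟨4, 0⟩), (⟨-1, 1⟩, ⟨10, 2⟩, ⟨4, 0⟩),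
  (⟨1, -1⟩, ⟨10, 2⟩, ⟨4, 0⟩), (⟨-1, -1⟩, ⟨0, 4⟩, ⟨4, 0⟩), (⟨-4, 0⟩, ⟨0, 0⟩, ⟨4, 0⟩),
  (⟨-1, -1⟩, ⟨0, -4⟩, ⟨4, 0⟩), (⟨1, -1⟩, ⟨-10, -2⟩, ⟨4, 0⟩), (⟨-1, 1⟩, ⟨-10, -2⟩, ⟨4, 0⟩),
  (⟨1, 1⟩, ⟨0, -4⟩, ⟨4, 0⟩), (⟨4, 0⟩, ⟨0, 0⟩, ⟨4, 0⟩)]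

/-- Multiples of the vertices of the regular `12`-gon. -/
def vertices12 : List (Vec (Quad 3)) := [
  (⟨2, 0⟩, ⟨0, 0⟩, ⟨2, 0⟩), (⟨0, 1⟩, ⟨1, 0⟩, ⟨2, 0⟩), (⟨1, 0⟩, ⟨0, 1⟩, ⟨2, 0⟩),
  (⟨0, 0⟩, ⟨2, 0⟩, ⟨2, 0⟩), (⟨-1, 0⟩, ⟨0, 1⟩, ⟨2, 0⟩), (⟨0, -1⟩, ⟨1, 0⟩, ⟨2, 0⟩),
  (⟨-2, 0⟩, ⟨0, 0⟩, ⟨2, 0⟩), (⟨0, -1⟩, ⟨-1, 0⟩, ⟨2, 0⟩), (⟨-1, 0⟩, ⟨0, -1⟩, ⟨2, 0⟩),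
  (⟨0, 0⟩, ⟨-2, 0⟩, ⟨2, 0⟩), (⟨1, 0⟩, ⟨0, -1⟩, ⟨2, 0⟩), (⟨0, 1⟩, ⟨-1, 0⟩, ⟨2, 0⟩),
  (⟨2, 0⟩, ⟨0, 0⟩, ⟨2, 0⟩)]

/-- The lines through consecutive members of a list of points. -/
def sides {R : Type*} [CommRing R] (V : List (Vec R)) : List (Vec R) :=
  List.zipWith Vec.cross V V.tail

/-- The lines of `𝒪₆₁`; the second coordinate is divided by `τ`. They are ordered as in a
construction with the ruler: the fifth line passes through the meet of the first two, and from the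
sixth line on, every line joins two points in which earlier lines meet. -/
def lines61 : List (Vec (Quad 5)) := [
  (⟨0, 4⟩, ⟨-3, 1⟩, ⟨0, 0⟩), (⟨0, 4⟩, ⟨-1, -1⟩, ⟨0, -4⟩), (⟨0, 0⟩, ⟨2, 0⟩, ⟨5, -1⟩),
  (⟨0, 4⟩, ⟨1, 1⟩, ⟨0, -4⟩), (⟨0, 0⟩, ⟨2, 0⟩, ⟨5, 1⟩), (⟨0, 0⟩, ⟨1, 0⟩, ⟨0, 0⟩),
  (⟨0, 4⟩, ⟨3, -1⟩, ⟨10, -6⟩), (⟨0, 4⟩, ⟨1, 1⟩, ⟨10, -2⟩), (⟨0, 4⟩, ⟨1, 1⟩, ⟨0, 0⟩),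
  (⟨0, 0⟩, ⟨1, 0⟩, ⟨0, -1⟩), (⟨0, 4⟩, ⟨-5, -1⟩, ⟨0, 0⟩), (⟨0, 4⟩, ⟨-5, 3⟩, ⟨0, 0⟩),
  (⟨0, 4⟩, ⟨-3, 1⟩, ⟨0, -4⟩), (⟨0, 4⟩, ⟨-3, 1⟩, ⟨-10, -2⟩), (⟨0, 0⟩, ⟨0, 0⟩, ⟨0, 1⟩),
  (⟨0, 0⟩, ⟨1, 0⟩, ⟨0, 1⟩), (⟨0, 0⟩, ⟨2, 0⟩, ⟨-5, -3⟩), (⟨0, 0⟩, ⟨2, 0⟩, ⟨-5, 1⟩),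
  (⟨0, 0⟩, ⟨2, 0⟩, ⟨5, 3⟩), (⟨0, 4⟩, ⟨-3, 1⟩, ⟨-10, -6⟩), (⟨0, 4⟩, ⟨-3, 1⟩, ⟨10, -6⟩),
  (⟨0, 4⟩, ⟨-3, 1⟩, ⟨10, -2⟩), (⟨0, 4⟩, ⟨-3, 1⟩, ⟨-10, 2⟩), (⟨0, 4⟩, ⟨-3, 1⟩, ⟨10, 2⟩),
  (⟨0, 4⟩, ⟨-3, 1⟩, ⟨0, 4⟩), (⟨0, 4⟩, ⟨-3, 1⟩, ⟨-10, 6⟩), (⟨0, 4⟩, ⟨-3, 1⟩, ⟨10, 6⟩),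
  (⟨0, 4⟩, ⟨-1, -1⟩, ⟨-10, -2⟩), (⟨0, 4⟩, ⟨-1, -1⟩, ⟨10, -2⟩), (⟨0, 4⟩, ⟨-1, -1⟩, ⟨10, 2⟩),
  (⟨0, 4⟩, ⟨1, 1⟩, ⟨-10, -6⟩), (⟨0, 4⟩, ⟨1, 1⟩, ⟨-10, -2⟩), (⟨0, 4⟩, ⟨1, 1⟩, ⟨10, 2⟩),
  (⟨0, 4⟩, ⟨1, 1⟩, ⟨0, 4⟩), (⟨0, 4⟩, ⟨1, 1⟩, ⟨20, 8⟩), (⟨0, 4⟩, ⟨3, -1⟩, ⟨0, -4⟩),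
  (⟨0, 4⟩, ⟨3, -1⟩, ⟨10, -2⟩), (⟨0, 4⟩, ⟨3, -1⟩, ⟨0, 0⟩), (⟨0, 4⟩, ⟨3, -1⟩, ⟨-10, 2⟩),
  (⟨0, 0⟩, ⟨1, 0⟩, ⟨-5, -2⟩), (⟨0, 0⟩, ⟨1, 0⟩, ⟨5, 2⟩), (⟨0, 0⟩, ⟨2, 0⟩, ⟨-5, -1⟩),
  (⟨0, 1⟩, ⟨0, 0⟩, ⟨0, 0⟩), (⟨0, 4⟩, ⟨-1, -1⟩, ⟨-20, -8⟩), (⟨0, 4⟩, ⟨-1, -1⟩, ⟨-10, -6⟩),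
  (⟨0, 4⟩, ⟨-1, -1⟩, ⟨0, 0⟩), (⟨0, 4⟩, ⟨-1, -1⟩, ⟨-10, 2⟩), (⟨0, 4⟩, ⟨-1, -1⟩, ⟨0, 4⟩),
  (⟨0, 4⟩, ⟨-1, -1⟩, ⟨10, 6⟩), (⟨0, 4⟩, ⟨-1, -1⟩, ⟨20, 8⟩), (⟨0, 4⟩, ⟨1, 1⟩, ⟨-20, -8⟩),
  (⟨0, 4⟩, ⟨1, 1⟩, ⟨-10, 2⟩), (⟨0, 4⟩, ⟨1, 1⟩, ⟨10, 6⟩), (⟨0, 4⟩, ⟨3, -1⟩, ⟨-10, -6⟩),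
  (⟨0, 4⟩, ⟨3, -1⟩, ⟨-10, -2⟩), (⟨0, 4⟩, ⟨3, -1⟩, ⟨10, 2⟩), (⟨0, 4⟩, ⟨3, -1⟩, ⟨0, 4⟩),
  (⟨0, 4⟩, ⟨3, -1⟩, ⟨-10, 6⟩), (⟨0, 4⟩, ⟨3, -1⟩, ⟨10, 6⟩), (⟨0, 4⟩, ⟨5, -3⟩, ⟨0, 0⟩),
  (⟨0, 4⟩, ⟨5, 1⟩, ⟨0, 0⟩)]

/-- The lines of `𝒪₄₉`, in the order of a construction with the ruler as for `lines61`. -/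
def lines49 : List (Vec (Quad 3)) := [
  (⟨1, 0⟩, ⟨-2, 1⟩, ⟨1, 0⟩), (⟨1, 0⟩, ⟨0, 0⟩, ⟨0, 0⟩), (⟨2, 0⟩, ⟨0, 0⟩, ⟨2, 1⟩),
  (⟨1, 0⟩, ⟨-2, -1⟩, ⟨0, 0⟩), (⟨3, 0⟩, ⟨0, -1⟩, ⟨3, 2⟩), (⟨2, 0⟩, ⟨2, 0⟩, ⟨1, 1⟩),
  (⟨3, 0⟩, ⟨0, -1⟩, ⟨0, 0⟩), (⟨0, 0⟩, ⟨0, 0⟩, ⟨1, 0⟩), (⟨2, 0⟩, ⟨-2, 0⟩, ⟨-1, -1⟩),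
  (⟨1, 0⟩, ⟨-2, 1⟩, ⟨0, 0⟩), (⟨2, 0⟩, ⟨0, 0⟩, ⟨-2, -1⟩), (⟨1, 0⟩, ⟨2, 1⟩, ⟨0, 0⟩),
  (⟨1, 0⟩, ⟨2, 1⟩, ⟨2, 1⟩), (⟨2, 0⟩, ⟨0, 0⟩, ⟨1, 0⟩), (⟨0, 0⟩, ⟨2, 0⟩, ⟨-1, 0⟩),
  (⟨1, 0⟩, ⟨-2, -1⟩, ⟨-2, -1⟩), (⟨1, 0⟩, ⟨-2, -1⟩, ⟨2, 1⟩), (⟨1, 0⟩, ⟨-1, 0⟩, ⟨0, 0⟩),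
  (⟨1, 0⟩, ⟨0, -1⟩, ⟨-1, 0⟩), (⟨1, 0⟩, ⟨0, -1⟩, ⟨0, 0⟩), (⟨1, 0⟩, ⟨0, 1⟩, ⟨2, 1⟩),
  (⟨1, 0⟩, ⟨1, 0⟩, ⟨0, 0⟩), (⟨1, 0⟩, ⟨2, -1⟩, ⟨-1, 0⟩), (⟨1, 0⟩, ⟨2, -1⟩, ⟨0, 0⟩),
  (⟨1, 0⟩, ⟨2, 1⟩, ⟨-2, -1⟩), (⟨2, 0⟩, ⟨-2, 0⟩, ⟨1, 1⟩), (⟨2, 0⟩, ⟨2, 0⟩, ⟨-1, -1⟩),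
  (⟨3, 0⟩, ⟨0, -1⟩, ⟨0, -1⟩), (⟨3, 0⟩, ⟨0, -1⟩, ⟨0, 1⟩), (⟨3, 0⟩, ⟨0, 1⟩, ⟨-3, -2⟩),
  (⟨3, 0⟩, ⟨0, 1⟩, ⟨0, 1⟩), (⟨0, 0⟩, ⟨1, 0⟩, ⟨0, 0⟩), (⟨0, 0⟩, ⟨2, 0⟩, ⟨-2, -1⟩),
  (⟨0, 0⟩, ⟨2, 0⟩, ⟨1, 0⟩), (⟨0, 0⟩, ⟨2, 0⟩, ⟨2, 1⟩), (⟨1, 0⟩, ⟨-2, 1⟩, ⟨-1, 0⟩),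
  (⟨1, 0⟩, ⟨0, -1⟩, ⟨-2, -1⟩), (⟨1, 0⟩, ⟨0, -1⟩, ⟨1, 0⟩), (⟨1, 0⟩, ⟨0, -1⟩, ⟨2, 1⟩),
  (⟨1, 0⟩, ⟨0, 1⟩, ⟨-2, -1⟩), (⟨1, 0⟩, ⟨0, 1⟩, ⟨-1, 0⟩), (⟨1, 0⟩, ⟨0, 1⟩, ⟨0, 0⟩),
  (⟨1, 0⟩, ⟨0, 1⟩, ⟨1, 0⟩), (⟨1, 0⟩, ⟨2, -1⟩, ⟨1, 0⟩), (⟨2, 0⟩, ⟨0, 0⟩, ⟨-1, 0⟩),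
  (⟨3, 0⟩, ⟨0, -1⟩, ⟨-3, -2⟩), (⟨3, 0⟩, ⟨0, 1⟩, ⟨0, -1⟩), (⟨3, 0⟩, ⟨0, 1⟩, ⟨0, 0⟩),
  (⟨3, 0⟩, ⟨0, 1⟩, ⟨3, 2⟩)]

section Polygon

variable {D : ℕ} {τ : ℂ}

lemma vertex_eq_emb (hφ : Function.Injective (toComplex D)) (hτ : τ ≠ 0) {n k : ℕ} {κ : ℂ}
    (hκ : κ ≠ 0) {v : Vec (Quad D)}
    (h1 : toComplex D v.1 = κ * (Real.cos (2 * Real.pi * k / n) : ℝ))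
    (h2 : toComplex D v.2.1 = κ * τ * (Real.sin (2 * Real.pi * k / n) : ℝ))
    (h3 : toComplex D v.2.2 = κ) :
    v ≠ 0 ∧ vertex n k = emb (toComplex D) τ⁻¹ v := by
  have hv : v ≠ 0 := by
    rintro rfl
    simp only [Prod.snd_zero, map_zero] at h3
    exact hκ h3.symm
  refine ⟨hv, ?_⟩
  rw [emb, pt_eq_mk (coords_ne_zero hφ (inv_ne_zero hτ) hv), vertex,
    Projectivization.mk_eq_mk_iff']
  refine ⟨κ⁻¹, ?_⟩
  ext i
  fin_cases i
  · simp [coords, h1, hκ]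
  · simp only [coords, h2, Fin.mk_one, Pi.smul_apply, Matrix.cons_val, smul_eq_mul]
    field_simp
  · simp [coords, h3, hκ]

/-- The list `V` runs once around the polygon and repeats the first vertex at the end. -/
lemma polygon_eq_image (hφ : Function.Injective (toComplex D)) (hτ : τ ≠ 0) {n : ℕ}
    {V : List (Vec (Quad D))} (hn : V.length = n + 1)
    (hV : ∀ k, (hk : k < V.length) → V[k] ≠ 0 ∧ vertex n k = emb (toComplex D) τ⁻¹ V[k])
    (hC : Distinct (sides V)) :
    polygon n = emb (toComplex D) τ '' {v | v ∈ sides V} := by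
  have hτ' := inv_ne_zero hτ
  have hlen : (sides V).length = n := by simp [sides, hn]
  have hget : ∀ k (hk : k < (sides V).length), (sides V)[k] =
      Vec.cross (V[k]'(by omega)) (V[k + 1]'(by omega)) := by
    intro k hk
    simp [sides]
  ext q
  simp only [polygon, Set.mem_ofPred_eq, Set.mem_image]
  constructor
  · rintro ⟨k, hk, h1, h2⟩
    have hk' : k < (sides V).length := by omega
    rw [(hV k (by omega)).2] at h1
    rw [(hV (k + 1) (by omega)).2] at h2
    refine ⟨(sides V)[k], List.getElem_mem hk', ?_⟩
    have hne := hC.1 _ (List.getElem_mem hk')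
    rw [hget k hk'] at hne ⊢
    have := eq_emb_cross hφ hτ' (hV k (by omega)).1 (hV (k + 1) (by omega)).1 hne h1 h2
    rw [this, inv_inv]
  · rintro ⟨v, hv, rfl⟩
    obtain ⟨k, hk, rfl⟩ := List.getElem_of_mem hv
    have hne := hC.1 _ hv
    refine ⟨k, by omega, ?_⟩
    rw [(hV k (by omega)).2, (hV (k + 1) (by omega)).2, Projectivization.orthogonal_comm,
      Projectivization.orthogonal_comm (v := emb _ _ (V[k + 1]'(by omega))),
      emb_orthogonal hφ hτ hne (hV k (by omega)).1,
      emb_orthogonal hφ hτ hne (hV (k + 1) (by omega)).1, hget k hk, Vec.dot_comm,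
      Vec.dot_cross_left, Vec.dot_comm, Vec.dot_cross_right]
    exact ⟨rfl, rfl⟩

end Polygon

instance {R : Type*} [CommRing R] [DecidableEq R] (L : List (Vec R)) : Decidable (Distinct L) := by
  unfold Distinct; infer_instance

lemma distinct_sides10 : Distinct (sides vertices10) := by decide +kernel

lemma distinct_sides12 : Distinct (sides vertices12) := by decide +kernel

lemma distinct_lines61 : Distinct lines61 := by decide +kernel

lemma distinct_lines49 : Distinct lines49 := by decide +kernel

lemma cos_pi_div_five_eq : Real.cos (2 * Real.pi / 10) = (1 + √5) / 4 := by
  rw [show 2 * Real.pi / 10 = Real.pi / 5 by ring, Real.cos_pi_div_five]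

lemma tau_mul_sin : tau * Real.sin (2 * Real.pi / 10) = √5 := by
  have h5 : √5 ^ 2 = (5 : ℝ) := Real.sq_sqrt (by norm_num)
  have hs : 0 ≤ Real.sin (2 * Real.pi / 10) := by
    apply Real.sin_nonneg_of_nonneg_of_le_pi <;> nlinarith [Real.pi_pos]
  have h := Real.sin_sq_add_cos_sq (2 * Real.pi / 10)
  rw [cos_pi_div_five_eq] at h
  refine (pow_left_inj₀ (mul_nonneg tau_pos.le hs) (Real.sqrt_nonneg 5) two_ne_zero).1 ?_
  rw [mul_pow, tau_sq, h5]
  linear_combination (10 + 2 * √5) * h + (-7 / 8 - √5 / 8) * h5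

/-- The recursion for the vertices comes from the addition theorems. -/
lemma vertices10_spec (k : ℕ) (hk : k < vertices10.length) :
    toComplex 5 vertices10[k].1 = 4 * (Real.cos (2 * Real.pi * k / (10 : ℕ)) : ℝ) ∧
    toComplex 5 vertices10[k].2.1 = 4 * tau * (Real.sin (2 * Real.pi * k / (10 : ℕ)) : ℝ) ∧
    toComplex 5 vertices10[k].2.2 = 4 := by
  have hrec : ∀ k : Fin 10, 8 * (vertices10[k.1 + 1]'(Nat.succ_lt_succ k.2)).1 =
      ⟨2, 2⟩ * vertices10[k.1].1 - ⟨-1, 1⟩ * vertices10[k.1].2.1 ∧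
      4 * (vertices10[k.1 + 1]'(Nat.succ_lt_succ k.2)).2.1 =
        ⟨1, 1⟩ * vertices10[k.1].2.1 + ⟨0, 4⟩ * vertices10[k.1].1 ∧
      (vertices10[k.1 + 1]'(Nat.succ_lt_succ k.2)).2.2 = 4 := by decide +kernel
  induction k with
  | zero => simp [vertices10, toComplex_apply]
  | succ k ih =>
    have hk' : k < 10 := Nat.lt_of_succ_lt_succ hk
    obtain ⟨h1, h2, -⟩ := ih (by omega)
    obtain ⟨r1, r2, r3⟩ := hrec ⟨k, hk'⟩
    have r1 := congrArg (toComplex 5) r1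
    have r2 := congrArg (toComplex 5) r2
    have r3 := congrArg (toComplex 5) r3
    simp only [map_mul, map_sub, map_add, map_ofNat, h1, h2] at r1 r2 r3
    have hang : 2 * Real.pi * ((k + 1 : ℕ) : ℝ) / ((10 : ℕ) : ℝ) =
        2 * Real.pi * k / (10 : ℕ) + 2 * Real.pi / 10 := by push_cast; ring
    have h5 : ((√5 : ℝ) : ℂ) ^ 2 = 5 := by
      rw [← Complex.ofReal_pow, Real.sq_sqrt (by norm_num)]; norm_num
    have ht : (tau : ℂ) ^ 2 = 10 + 2 * (√5 : ℝ) := by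
      rw [← Complex.ofReal_pow, tau_sq]; push_cast; ring
    have hs : (tau : ℂ) * (Real.sin (2 * Real.pi / 10) : ℝ) = (√5 : ℝ) := by
      rw [← Complex.ofReal_mul, tau_mul_sin]
    have hc : ((Real.cos (2 * Real.pi / 10) : ℝ) : ℂ) = (1 + (√5 : ℝ)) / 4 := by
      rw [cos_pi_div_five_eq]; push_cast; ring
    have e1 : toComplex 5 ⟨2, 2⟩ = 2 + 2 * (√5 : ℝ) := by simp [toComplex_apply]
    have e2 : toComplex 5 ⟨-1, 1⟩ = -1 + (√5 : ℝ) := by simp [toComplex_apply]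
    have e3 : toComplex 5 ⟨1, 1⟩ = 1 + (√5 : ℝ) := by simp [toComplex_apply]
    have e4 : toComplex 5 ⟨0, 4⟩ = 4 * (√5 : ℝ) := by simp [toComplex_apply]
    rw [e1, e2] at r1
    rw [e3, e4] at r2
    rw [hang, Real.cos_add, Real.sin_add]
    simp only [Complex.ofReal_sub, Complex.ofReal_mul, Complex.ofReal_add]
    rw [hc]
    generalize ((√5 : ℝ) : ℂ) = s at *
    generalize ((Real.sin (2 * Real.pi / 10) : ℝ) : ℂ) = σ at *
    generalize ((Real.sin (2 * Real.pi * k / (10 : ℕ)) : ℝ) : ℂ) = y at *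
    generalize ((Real.cos (2 * Real.pi * k / (10 : ℕ)) : ℝ) : ℂ) = x at *
    have ht0 := tau_ne_zero
    generalize (tau : ℂ) = t at *
    have hs2 : (s - 1) * t = 8 * σ := by
      apply mul_left_cancel₀ ht0
      linear_combination (s - 1) * ht - 8 * hs + 2 * h5
    refine ⟨?_, ?_, r3⟩
    · linear_combination r1 / 8 - y / 2 * hs2
    · linear_combination r2 / 4 - 4 * x * hs

/-- The recursion for the vertices comes from the addition theorems. -/
lemma vertices12_spec (k : ℕ) (hk : k < vertices12.length) :
    toComplex 3 vertices12[k].1 = 2 * (Real.cos (2 * Real.pi * k / (12 : ℕ)) : ℝ) ∧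
    toComplex 3 vertices12[k].2.1 = 2 * 1 * (Real.sin (2 * Real.pi * k / (12 : ℕ)) : ℝ) ∧
    toComplex 3 vertices12[k].2.2 = 2 := by
  have hrec : ∀ k : Fin 12, 2 * (vertices12[k.1 + 1]'(Nat.succ_lt_succ k.2)).1 =
      ⟨0, 1⟩ * vertices12[k.1].1 - vertices12[k.1].2.1 ∧
      2 * (vertices12[k.1 + 1]'(Nat.succ_lt_succ k.2)).2.1 =
        ⟨0, 1⟩ * vertices12[k.1].2.1 + vertices12[k.1].1 ∧
      (vertices12[k.1 + 1]'(Nat.succ_lt_succ k.2)).2.2 = 2 := by decide +kernel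
  induction k with
  | zero => simp [vertices12, toComplex_apply]
  | succ k ih =>
    have hk' : k < 12 := Nat.lt_of_succ_lt_succ hk
    obtain ⟨h1, h2, -⟩ := ih (by omega)
    obtain ⟨r1, r2, r3⟩ := hrec ⟨k, hk'⟩
    have r1 := congrArg (toComplex 3) r1
    have r2 := congrArg (toComplex 3) r2
    have r3 := congrArg (toComplex 3) r3
    simp only [map_mul, map_sub, map_add, map_ofNat, h1, h2] at r1 r2 r3
    have hang : 2 * Real.pi * ((k + 1 : ℕ) : ℝ) / ((12 : ℕ) : ℝ) =
        2 * Real.pi * k / (12 : ℕ) + Real.pi / 6 := by push_cast; ring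
    have e1 : toComplex 3 ⟨0, 1⟩ = (√3 : ℝ) := by simp [toComplex_apply]
    rw [e1] at r1 r2
    rw [hang, Real.cos_add, Real.sin_add, Real.cos_pi_div_six, Real.sin_pi_div_six]
    simp only [Complex.ofReal_sub, Complex.ofReal_mul, Complex.ofReal_add, Complex.ofReal_div,
      Complex.ofReal_one, Complex.ofReal_ofNat]
    refine ⟨?_, ?_, r3⟩
    · linear_combination r1 / 2
    · linear_combination r2 / 2

theorem polygon_ten :
    polygon 10 = emb (toComplex 5) tau '' {v | v ∈ sides vertices10} := by
  refine polygon_eq_image toComplex_five_injective tau_ne_zero rfl (fun k hk => ?_)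
    distinct_sides10
  obtain ⟨h1, h2, h3⟩ := vertices10_spec k hk
  exact vertex_eq_emb toComplex_five_injective tau_ne_zero (by norm_num) h1 h2 h3

theorem polygon_twelve :
    polygon 12 = emb (toComplex 3) 1 '' {v | v ∈ sides vertices12} := by
  refine polygon_eq_image toComplex_three_injective one_ne_zero rfl (fun k hk => ?_)
    distinct_sides12
  obtain ⟨h1, h2, h3⟩ := vertices12_spec k hk
  exact vertex_eq_emb toComplex_three_injective one_ne_zero (by norm_num) h1 h2 h3

/-! ### The lines and points of the two arrangements -/

theorem O61_eq : O61 = emb (toComplex 5) tau '' {v | v ∈ lines61} := by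
  rw [O61, polygon_ten]
  exact pointLineOp_image toComplex_five_injective tau_ne_zero (by norm_num)
    (t := fun k => Nat.ble 3 k) (by simp) (fun k hk => le_trans (by norm_num) (Set.mem_Ici.1 hk))
    distinct_sides10 distinct_lines61 (by decide +kernel) (by decide +kernel) (by decide +kernel)

theorem O49_eq : O49 = emb (toComplex 3) 1 '' {v | v ∈ lines49} := by
  rw [O49, polygon_twelve]
  exact pointLineOp_image toComplex_three_injective one_ne_zero (by norm_num)
    (t := fun k => Nat.ble 4 k) (by simp) (fun k hk => le_trans (by norm_num) (Set.mem_Ici.1 hk))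
    distinct_sides12 distinct_lines49 (by decide +kernel) (by decide +kernel) (by decide +kernel)

theorem ncard_O61 : O61.ncard = 61 := by
  rw [O61_eq, distinct_lines61.ncard_image toComplex_five_injective tau_ne_zero]
  rfl

theorem ncard_O49 : O49.ncard = 49 := by
  rw [O49_eq, distinct_lines49.ncard_image toComplex_three_injective one_ne_zero]
  rfl

theorem numPoints_O61 :
    (∀ p ∈ [(2, 335), (3, 140), (5, 70), (10, 1), (12, 5)], 2 ≤ p.1 → numPoints O61 p.1 = p.2) ∧
      ∀ k, 2 ≤ k → k ∉ [(2, 335), (3, 140), (5, 70), (10, 1), (12, 5)].map Prod.fst →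
        numPoints O61 k = 0 := by
  rw [O61_eq]
  exact numPoints_of_check toComplex_five_injective tau_ne_zero (by norm_num) distinct_lines61
    (by decide +kernel) (by decide +kernel)

theorem numPoints_O49 :
    (∀ p ∈ [(2, 204), (3, 96), (4, 6), (5, 24), (6, 6), (7, 12), (12, 1)],
        2 ≤ p.1 → numPoints O49 p.1 = p.2) ∧
      ∀ k, 2 ≤ k → k ∉ [(2, 204), (3, 96), (4, 6), (5, 24), (6, 6), (7, 12), (12, 1)].map Prod.fst →
        numPoints O49 k = 0 := by
  rw [O49_eq]
  exact numPoints_of_check toComplex_three_injective one_ne_zero (by norm_num) distinct_lines49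
    (by decide +kernel) (by decide +kernel)

/-! ### Saito's criterion -/

open MvPolynomial

lemma gradMap_apply (f : S) (θ : Fin 3 → S) : gradMap f θ = ∑ i, θ i * pderiv i f := by
  simp [gradMap, Fintype.linearCombination_apply]

lemma gradMap_mul (f g : S) (θ : Fin 3 → S) :
    gradMap (f * g) θ = gradMap f θ * g + f * gradMap g θ := by
  simp only [gradMap_apply, Derivation.leibniz, smul_eq_mul, Fin.sum_univ_three]
  ring

lemma gradMap_one (θ : Fin 3 → S) : gradMap 1 θ = 0 := by
  simp [gradMap_apply]

/-- The linear form with coefficients `v`. -/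
noncomputable def linForm (v : Fin 3 → ℂ) : S := ∑ i, C (v i) * X i

lemma lineForm_eq (ℓ : Plane) : lineForm ℓ = linForm ℓ.rep := rfl

lemma gradMap_linForm (v : Fin 3 → ℂ) (θ : Fin 3 → S) :
    gradMap (linForm v) θ = ∑ i, C (v i) * θ i := by
  simp only [gradMap_apply, linForm, Fin.sum_univ_three, map_add, pderiv_C_mul, pderiv_X]
  simp
  ring

lemma isHomogeneous_linForm (v : Fin 3 → ℂ) : (linForm v).IsHomogeneous 1 :=
  IsHomogeneous.sum _ _ _ fun i _ => isHomogeneous_C_mul_X _ i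

lemma eval_linForm (v p : Fin 3 → ℂ) : eval p (linForm v) = v ⬝ᵥ p := by
  simp [linForm, dotProduct]

lemma linForm_ne_zero {v : Fin 3 → ℂ} (hv : v ≠ 0) : linForm v ≠ 0 := by
  intro h
  apply hv
  ext i
  have := congrArg (eval (Pi.single i 1)) h
  simpa [eval_linForm] using this

lemma totalDegree_linForm {v : Fin 3 → ℂ} (hv : v ≠ 0) : (linForm v).totalDegree = 1 :=
  (isHomogeneous_linForm v).totalDegree (linForm_ne_zero hv)

lemma prime_linForm {v : Fin 3 → ℂ} (hv : v ≠ 0) : Prime (linForm v) := by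
  apply Irreducible.prime
  apply irreducible_of_totalDegree_eq_one (totalDegree_linForm hv)
  intro x hx
  rw [isUnit_iff_ne_zero]
  rintro rfl
  apply linForm_ne_zero hv
  ext d
  simpa using hx d

lemma dvd_of_totalDegree_eq {f g : S} (hg : g ≠ 0) (h : f ∣ g)
    (hd : f.totalDegree = g.totalDegree) : ∃ c : ℂ, c ≠ 0 ∧ g = C c * f := by
  obtain ⟨k, rfl⟩ := h
  have hf : f ≠ 0 := left_ne_zero_of_mul hg
  have hk : k ≠ 0 := right_ne_zero_of_mul hg
  rw [totalDegree_mul_of_isDomain hf hk] at hd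
  have h0 : k.totalDegree = 0 := by omega
  rw [totalDegree_eq_zero_iff_eq_C] at h0
  refine ⟨coeff 0 k, ?_, by rw [← h0, mul_comm]⟩
  intro h1
  rw [h1, C_0] at h0
  exact hk h0

lemma linForm_smul (c : ℂ) (v : Fin 3 → ℂ) : linForm (c • v) = C c * linForm v := by
  simp only [linForm, Fin.sum_univ_three, Pi.smul_apply, smul_eq_mul, C_mul]
  ring

lemma linForm_injective : Function.Injective linForm := by
  intro v w h
  ext i
  have := congrArg (eval (Pi.single i 1)) h
  simpa [eval_linForm] using this

lemma eq_of_lineForm_dvd {ℓ m : Plane} (h : lineForm ℓ ∣ lineForm m) : ℓ = m := by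
  obtain ⟨c, hc, h⟩ := dvd_of_totalDegree_eq (linForm_ne_zero m.rep_nonzero) h
    ((totalDegree_linForm ℓ.rep_nonzero).trans (totalDegree_linForm m.rep_nonzero).symm)
  rw [lineForm_eq, ← linForm_smul] at h
  have := linForm_injective h
  rw [← ℓ.mk_rep, ← m.mk_rep, eq_comm, Projectivization.mk_eq_mk_iff']
  exact ⟨c, this.symm⟩

lemma definingPoly_eq {L : Set Plane} (hL : L.Finite) :
    definingPoly L = ∏ ℓ ∈ hL.toFinset, lineForm ℓ :=
  finprod_mem_eq_finite_toFinset_prod _ hL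

lemma definingPoly_ne_zero {L : Set Plane} (hL : L.Finite) : definingPoly L ≠ 0 := by
  rw [definingPoly_eq hL]
  exact Finset.prod_ne_zero_iff.2 fun ℓ _ => linForm_ne_zero ℓ.rep_nonzero

lemma isHomogeneous_definingPoly {L : Set Plane} (hL : L.Finite) :
    (definingPoly L).IsHomogeneous L.ncard := by
  rw [definingPoly_eq hL, Set.ncard_eq_toFinset_card L hL]
  have := IsHomogeneous.prod hL.toFinset lineForm (fun _ => 1)
    fun ℓ _ => isHomogeneous_linForm ℓ.rep
  simpa using this

lemma definingPoly_dvd {L : Set Plane} (hL : L.Finite) {F : S} (h : ∀ ℓ ∈ L, lineForm ℓ ∣ F) :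
    definingPoly L ∣ F := by
  rw [definingPoly_eq hL]
  refine Finset.prod_dvd_of_isRelPrime (fun ℓ _ m _ hne => ?_) fun ℓ hℓ => h ℓ (by simpa using hℓ)
  refine ((prime_linForm ℓ.rep_nonzero).irreducible.isRelPrime_iff_not_dvd).2 fun hd => hne ?_
  exact eq_of_lineForm_dvd hd

/-- The polynomial vector field `θ` is tangent to all lines of `L`: the derivative of the equation
of a line along `θ` vanishes on the line. -/
def IsTangent (L : Set Plane) (θ : Fin 3 → S) : Prop :=
  ∀ ℓ ∈ L, lineForm ℓ ∣ gradMap (lineForm ℓ) θ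

/-- The determinant of three vector fields. -/
noncomputable def fieldDet (a b c : Fin 3 → S) : S :=
  a 0 * (b 1 * c 2 - b 2 * c 1) + a 1 * (b 2 * c 0 - b 0 * c 2) + a 2 * (b 0 * c 1 - b 1 * c 0)

lemma dvd_fieldDet {ℓ : Plane} {a b c : Fin 3 → S} (ha : lineForm ℓ ∣ gradMap (lineForm ℓ) a)
    (hb : lineForm ℓ ∣ gradMap (lineForm ℓ) b) (hc : lineForm ℓ ∣ gradMap (lineForm ℓ) c) :
    lineForm ℓ ∣ fieldDet a b c := by
  obtain ⟨i, hi⟩ := Function.ne_iff.1 ℓ.rep_nonzero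
  have hu : IsUnit (C (ℓ.rep i) : S) := (isUnit_iff_ne_zero.2 hi).map C
  rw [lineForm_eq, gradMap_linForm] at ha hb hc
  rw [lineForm_eq, ← hu.dvd_mul_left]
  simp only [Fin.sum_univ_three] at ha hb hc
  -- Cramer's rule for the matrix with rows `a`, `b`, `c` applied to the coefficients of the line
  obtain ⟨x, y, z, hxyz⟩ : ∃ x y z : S, C (ℓ.rep i) * fieldDet a b c =
      x * (C (ℓ.rep 0) * a 0 + C (ℓ.rep 1) * a 1 + C (ℓ.rep 2) * a 2) +
      y * (C (ℓ.rep 0) * b 0 + C (ℓ.rep 1) * b 1 + C (ℓ.rep 2) * b 2) +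
      z * (C (ℓ.rep 0) * c 0 + C (ℓ.rep 1) * c 1 + C (ℓ.rep 2) * c 2) := by
    fin_cases i
    · exact ⟨b 1 * c 2 - b 2 * c 1, c 1 * a 2 - c 2 * a 1, a 1 * b 2 - a 2 * b 1, by
        simp only [fieldDet, Fin.zero_eta]; ring⟩
    · exact ⟨b 2 * c 0 - b 0 * c 2, c 2 * a 0 - c 0 * a 2, a 2 * b 0 - a 0 * b 2, by
        simp only [fieldDet, Fin.mk_one]; ring⟩
    · exact ⟨b 0 * c 1 - b 1 * c 0, c 0 * a 1 - c 1 * a 0, a 0 * b 1 - a 1 * b 0, by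
        simp only [fieldDet, Fin.reduceFinMk]; ring⟩
  rw [hxyz]
  exact ((ha.mul_left x).add (hb.mul_left y)).add (hc.mul_left z)

lemma definingPoly_dvd_fieldDet {L : Set Plane} (hL : L.Finite) {a b c : Fin 3 → S}
    (ha : IsTangent L a) (hb : IsTangent L b) (hc : IsTangent L c) :
    definingPoly L ∣ fieldDet a b c :=
  definingPoly_dvd hL fun ℓ hℓ => dvd_fieldDet (ha ℓ hℓ) (hb ℓ hℓ) (hc ℓ hℓ)

lemma isTangent_X (L : Set Plane) : IsTangent L X := fun ℓ _ => by
  rw [lineForm_eq, gradMap_linForm, linForm]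

lemma IsTangent.definingPoly_dvd {L : Set Plane} (hL : L.Finite) {θ : Fin 3 → S}
    (h : IsTangent L θ) : definingPoly L ∣ gradMap (definingPoly L) θ := by
  classical
  rw [definingPoly_eq hL]
  have h' : ∀ ℓ ∈ hL.toFinset, lineForm ℓ ∣ gradMap (lineForm ℓ) θ := fun ℓ hℓ =>
    h ℓ (by simpa using hℓ)
  generalize hL.toFinset = s at h'
  induction s using Finset.induction_on with
  | empty => simp [gradMap_one]
  | insert ℓ s hℓ ih =>
    rw [Finset.prod_insert hℓ, gradMap_mul]
    exact (mul_dvd_mul_right (h' ℓ (Finset.mem_insert_self ℓ s)) _).add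
      (mul_dvd_mul_left _ (ih fun m hm => h' m (Finset.mem_insert_of_mem hm)))

/-- Vector fields that annihilate the defining polynomial are tangent to the lines. -/
lemma isTangent_of_gradMap_eq_zero {L : Set Plane} (hL : L.Finite) {θ : Fin 3 → S}
    (h : gradMap (definingPoly L) θ = 0) : IsTangent L θ := by
  classical
  intro ℓ hℓ
  have hp := prime_linForm ℓ.rep_nonzero
  have hmem : ℓ ∈ hL.toFinset := by simpa using hℓ
  rw [definingPoly_eq hL, ← Finset.mul_prod_erase _ _ hmem, gradMap_mul] at h
  have h1 : lineForm ℓ ∣ gradMap (lineForm ℓ) θ * ∏ m ∈ hL.toFinset.erase ℓ, lineForm m :=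
    ⟨-gradMap (∏ m ∈ hL.toFinset.erase ℓ, lineForm m) θ, by linear_combination h⟩
  rcases hp.dvd_or_dvd h1 with h2 | h2
  · exact h2
  · obtain ⟨m, hm, hd⟩ := (hp.dvd_finsetProd_iff _).1 h2
    exact absurd (eq_of_lineForm_dvd hd).symm (Finset.ne_of_mem_erase hm)

lemma isHomogeneous_of_mul {F k : S} {m n : ℕ} (hF : F.IsHomogeneous m) (hF0 : F ≠ 0)
    (h : (F * k).IsHomogeneous (m + n)) : k.IsHomogeneous n := by
  have h1 : F * k = F * homogeneousComponent n k := by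
    conv_lhs => rw [← homogeneousComponent_eq_self h]
    conv_lhs => rw [← sum_homogeneousComponent k, Finset.mul_sum, map_sum]
    have h2 : ∀ j, homogeneousComponent (m + n) (F * homogeneousComponent j k) =
        if j = n then F * homogeneousComponent n k else 0 := by
      intro j
      rw [homogeneousComponent_of_mem (hF.mul (homogeneousComponent_isHomogeneous j k))]
      split_ifs with h3 h4 h4
      · rw [h4]
      · omega
      · omega
      · rfl
    simp only [h2, Finset.sum_ite_eq', Finset.mem_range]
    split_ifs with h3
    · rfl
    · rw [homogeneousComponent_eq_zero _ _ (by omega), mul_zero]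
  rw [mul_left_cancel₀ hF0 h1]
  exact homogeneousComponent_isHomogeneous n k

/-- Subtracting a multiple of the Euler field `X` from a tangent field yields a field that
annihilates the defining polynomial. -/
lemma IsTangent.exists_sub_smul_X {L : Set Plane} (hL : L.Finite) (hL0 : L.ncard ≠ 0)
    {θ : Fin 3 → S} (h : IsTangent L θ) {d : ℕ} (hd : 1 ≤ d) (hθ : ∀ i, (θ i).IsHomogeneous d) :
    ∃ k : S, gradMap (definingPoly L) (θ - k • X) = 0 ∧
      ∀ i, ((θ - k • X : Fin 3 → S) i).IsHomogeneous d := by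
  obtain ⟨k, hk⟩ := h.definingPoly_dvd hL
  have hQ := isHomogeneous_definingPoly hL
  have hE : gradMap (definingPoly L) X = (L.ncard : S) * definingPoly L := by
    rw [gradMap_apply, hQ.sum_X_mul_pderiv, nsmul_eq_mul]
  have hk' : k.IsHomogeneous (d - 1) := by
    apply isHomogeneous_of_mul hQ (definingPoly_ne_zero hL)
    rw [← hk, gradMap_apply]
    apply IsHomogeneous.sum
    intro i _
    have := (hθ i).mul (hQ.pderiv (i := i))
    rwa [show d + (L.ncard - 1) = L.ncard + (d - 1) by omega] at this
  have hc : (C ((L.ncard : ℂ)⁻¹) : S) * (L.ncard : S) = 1 := by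
    rw [← map_natCast (C : ℂ →+* S), ← C_mul, inv_mul_cancel₀ (Nat.cast_ne_zero.2 hL0), C_1]
  refine ⟨C ((L.ncard : ℂ)⁻¹) * k, ?_, fun i => ?_⟩
  · rw [map_sub, map_smul, hk, hE, smul_eq_mul]
    linear_combination -definingPoly L * k * hc
  · have := (hk'.C_mul ((L.ncard : ℂ)⁻¹)).mul (isHomogeneous_X ℂ i)
    rw [Nat.sub_add_cancel hd] at this
    exact (hθ i).sub this

/-- **Saito's criterion**: two tangent fields that are independent together with the Euler field,
and whose degrees add up to the number of lines minus one, show that the arrangement is free. -/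
theorem isFreeWithExponents_of_isTangent {L : Set Plane} (hL : L.Finite) {d₁ d₂ : ℕ} (h1 : 1 ≤ d₁)
    (h12 : d₁ ≤ d₂) (hd : d₁ + d₂ + 1 = L.ncard) {θ₁ θ₂ : Fin 3 → S}
    (hom1 : ∀ i, (θ₁ i).IsHomogeneous d₁) (hom2 : ∀ i, (θ₂ i).IsHomogeneous d₂)
    (ht1 : IsTangent L θ₁) (ht2 : IsTangent L θ₂) (hdet : fieldDet X θ₁ θ₂ ≠ 0) :
    IsFreeWithExponents L.ncard d₁ d₂ (definingPoly L) := by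
  have hL0 : L.ncard ≠ 0 := by omega
  obtain ⟨k₁, hk1, hom1'⟩ := ht1.exists_sub_smul_X hL hL0 h1 hom1
  obtain ⟨k₂, hk2, hom2'⟩ := ht2.exists_sub_smul_X hL hL0 (h1.trans h12) hom2
  have hdet' : fieldDet X (θ₁ - k₁ • X) (θ₂ - k₂ • X) = fieldDet X θ₁ θ₂ := by
    simp only [fieldDet, Pi.sub_apply, Pi.smul_apply, smul_eq_mul]
    ring
  rw [← hdet'] at hdet
  generalize θ₁ - k₁ • (X : Fin 3 → S) = η₁ at *
  generalize θ₂ - k₂ • (X : Fin 3 → S) = η₂ at *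
  have ht1' := isTangent_of_gradMap_eq_zero hL hk1
  have ht2' := isTangent_of_gradMap_eq_zero hL hk2
  have hQ := isHomogeneous_definingPoly hL
  have hQ0 := definingPoly_ne_zero hL
  -- by degree, the determinant is a constant multiple of the defining polynomial
  obtain ⟨c, hc, hcQ⟩ : ∃ c : ℂ, c ≠ 0 ∧ fieldDet X η₁ η₂ = C c * definingPoly L := by
    apply dvd_of_totalDegree_eq hdet (definingPoly_dvd_fieldDet hL (isTangent_X L) ht1' ht2')
    have hhom : (fieldDet X η₁ η₂).IsHomogeneous L.ncard := by
      have hX := fun i : Fin 3 => isHomogeneous_X ℂ i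
      rw [← hd, show d₁ + d₂ + 1 = 1 + (d₁ + d₂) by ring]
      have key : ∀ i j k : Fin 3, (X i * (η₁ j * η₂ k - η₁ k * η₂ j)).IsHomogeneous
          (1 + (d₁ + d₂)) := fun i j k =>
        (hX i).mul (((hom1' j).mul (hom2' k)).sub ((hom1' k).mul (hom2' j)))
      exact ((key 0 1 2).add (key 1 2 0)).add (key 2 0 1)
    rw [hQ.totalDegree hQ0, hhom.totalDegree hdet]
  have hmul : ∀ g : Fin 2 → S, (Matrix.of fun i j => ![η₁ i, η₂ i] j).mulVecLin g =
      g 0 • η₁ + g 1 • η₂ := by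
    intro g
    ext1 i
    simp only [Matrix.mulVecLin_apply, Matrix.mulVec, dotProduct, Fin.sum_univ_two, Matrix.of_apply,
      Matrix.cons_val_zero, Matrix.cons_val_one, Pi.add_apply, Pi.smul_apply, smul_eq_mul]
    ring
  refine ⟨h1, h12, hd, Matrix.of fun i j => ![η₁ i, η₂ i] j, fun i => ⟨hom1' i, hom2' i⟩,
    ?_, ?_, ?_⟩
  · rw [← LinearMap.ker_eq_bot, LinearMap.ker_eq_bot']
    intro g hg
    rw [hmul] at hg
    have e0 := congrFun hg 0
    have e1 := congrFun hg 1
    have e2 := congrFun hg 2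
    simp only [Pi.add_apply, Pi.smul_apply, smul_eq_mul, Pi.zero_apply] at e0 e1 e2
    have hg0 : g 0 * fieldDet X η₁ η₂ = 0 := by
      simp only [fieldDet]
      linear_combination (X 1 * η₂ 2 - X 2 * η₂ 1) * (-e0) + (X 2 * η₂ 0 - X 0 * η₂ 2) * (-e1) +
        (X 0 * η₂ 1 - X 1 * η₂ 0) * (-e2)
    have hg1 : g 1 * fieldDet X η₁ η₂ = 0 := by
      simp only [fieldDet]
      linear_combination (X 1 * η₁ 2 - X 2 * η₁ 1) * e0 + (X 2 * η₁ 0 - X 0 * η₁ 2) * e1 +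
        (X 0 * η₁ 1 - X 1 * η₁ 0) * e2
    ext1 j
    fin_cases j
    · exact (mul_eq_zero.1 hg0).resolve_right hdet
    · exact (mul_eq_zero.1 hg1).resolve_right hdet
  · intro η
    constructor
    · intro hη
      have htη := isTangent_of_gradMap_eq_zero hL hη
      obtain ⟨(q₀ : S), hq0⟩ := definingPoly_dvd_fieldDet hL htη ht1' ht2'
      obtain ⟨(q₁ : S), hq1⟩ := definingPoly_dvd_fieldDet hL (isTangent_X L) htη ht2'
      obtain ⟨(q₂ : S), hq2⟩ := definingPoly_dvd_fieldDet hL (isTangent_X L) ht1' htη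
      -- Cramer's rule
      have hcr : (C c : S) • η = q₀ • (X : Fin 3 → S) + q₁ • η₁ + q₂ • η₂ := by
        ext1 i
        apply mul_left_cancel₀ hQ0
        simp only [Pi.add_apply, Pi.smul_apply, smul_eq_mul]
        have hsplit : fieldDet X η₁ η₂ * η i = fieldDet η η₁ η₂ * X i + fieldDet X η η₂ * η₁ i +
            fieldDet X η₁ η * η₂ i := by
          fin_cases i <;> simp only [fieldDet, Fin.zero_eta, Fin.mk_one, Fin.reduceFinMk] <;> ring
        rw [hcQ, hq0, hq1, hq2] at hsplit
        linear_combination hsplit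
      have hq0' : q₀ = 0 := by
        have := congrArg (gradMap (definingPoly L)) hcr
        rw [map_smul, map_add, map_add, map_smul, map_smul, map_smul, hη, hk1, hk2, gradMap_apply,
          hQ.sum_X_mul_pderiv] at this
        simp only [mul_zero, add_zero, nsmul_eq_mul, smul_eq_mul] at this
        have hn : ((L.ncard : ℕ) : S) ≠ 0 := Nat.cast_ne_zero.2 hL0
        exact (mul_eq_zero.1 this.symm).resolve_right (mul_ne_zero hn hQ0)
      have hcc : (C c⁻¹ : S) * C c = 1 := by rw [← C_mul, inv_mul_cancel₀ hc, C_1]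
      refine ⟨![C c⁻¹ * q₁, C c⁻¹ * q₂], ?_⟩
      rw [hmul]
      ext1 i
      have := congrFun hcr i
      simp only [hq0', Pi.add_apply, Pi.smul_apply, smul_eq_mul, zero_mul, zero_add] at this
      simp only [Matrix.cons_val_zero, Matrix.cons_val_one, Pi.add_apply, Pi.smul_apply,
        smul_eq_mul]
      linear_combination η i * hcc - C c⁻¹ * this
    · rintro ⟨g, rfl⟩
      rw [hmul, map_add, map_smul, map_smul, hk1, hk2, smul_zero, smul_zero, add_zero]
  · intro f
    rw [Ideal.Quotient.eq_zero_iff_mem, jacobianIdeal, Ideal.span, Set.mem_range,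
      Submodule.mem_span_range_iff_exists_fun]
    simp only [gradMap_apply, smul_eq_mul]

/-! ### Homogeneous polynomials in two variables as coefficient lists -/

/-- The list `[c₀, …, c_k]` stands for the binary form `∑ cⱼ Z ^ (k - j) * Y ^ j`, whose value for
elements `Z`, `Y` of an algebra over the ring of coefficients is computed here. -/
def formEval {R A : Type*} [CommRing R] [CommRing A] (f : R →+* A) (Z Y : A) : List R → A
  | [] => 0
  | c :: l => f c * Z ^ l.length + Y * formEval f Z Y l

namespace BinaryForm

variable {R : Type*} [CommRing R]

/-- The sum of two forms of the same degree. -/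
def add (l m : List R) : List R := List.zipWith (· + ·) l m

/-- The product of two forms. -/
def mul : List R → List R → List R
  | [], m => List.replicate (m.length - 1) 0
  | c :: l, m => add (m.map (c * ·) ++ List.replicate l.length 0) (0 :: mul l m)

/-- The substitution of `H * Z` for `Z`. -/
def scale (H : R) : List R → List R
  | [] => []
  | c :: l => c * H ^ l.length :: scale H l

/-- The substitution of `H * Z + Y` for `Y`. -/
def shift (H : R) : List R → List R
  | [] => []
  | c :: l => add (c :: List.replicate l.length 0)
      (add ((shift H l).map (H * ·) ++ [0]) (0 :: shift H l))

/-- For forms `p₀, …, p_k` in `Z`, `r` and a form `w` in `Z`, `Y`, this is the form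
`∑ w ^ j * p_j (Z, H Z + Y)`. -/
def subst (H : R) (w : List R) : List (List R) → List R
  | [] => []
  | [p] => shift H p
  | p :: q :: ps => add (shift H p) (mul w (subst H w (q :: ps)))

/-- The forms `p₀, …, p_k` have degrees that decrease by `h` in each step. -/
def Graded (h : ℕ) (ps : List (List R)) : Prop :=
  ps.IsChain fun p q => p.length = h + q.length

instance (h : ℕ) (ps : List (List R)) : Decidable (Graded h ps) := by
  unfold Graded; infer_instance

variable {A : Type*} [CommRing A] (f : R →+* A) (Z Y : A)

@[simp] lemma formEval_nil : formEval f Z Y [] = 0 := rfl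

@[simp] lemma formEval_cons (c : R) (l : List R) :
    formEval f Z Y (c :: l) = f c * Z ^ l.length + Y * formEval f Z Y l := rfl

@[simp] lemma length_add (l m : List R) : (add l m).length = min l.length m.length := by
  simp [add]

lemma formEval_add {l m : List R} (h : l.length = m.length) :
    formEval f Z Y (add l m) = formEval f Z Y l + formEval f Z Y m := by
  induction l generalizing m with
  | nil => cases m <;> simp_all [add]
  | cons c l ih =>
    cases m with
    | nil => simp at h
    | cons d m =>
      have h' : l.length = m.length := by simpa using h
      have e : add (c :: l) (d :: m) = (c + d) :: add l m := rfl
      simp only [e, formEval_cons, length_add, ih h', map_add, h', min_self]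
      ring

lemma formEval_map_mul (c : R) (l : List R) :
    formEval f Z Y (l.map (c * ·)) = f c * formEval f Z Y l := by
  induction l with
  | nil => simp
  | cons d l ih => simp only [List.map_cons, formEval_cons, List.length_map, ih, map_mul]; ring

lemma formEval_replicate_zero (k : ℕ) : formEval f Z Y (List.replicate k 0) = 0 := by
  induction k with
  | zero => rfl
  | succ k ih => simp [List.replicate_succ, ih]

lemma formEval_append_replicate_zero (l : List R) (k : ℕ) :
    formEval f Z Y (l ++ List.replicate k 0) = Z ^ k * formEval f Z Y l := by
  induction l with
  | nil => simp [formEval_replicate_zero]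
  | cons c l ih =>
    simp only [List.cons_append, formEval_cons, ih, List.length_append, List.length_replicate,
      pow_add]
    ring

lemma length_mul (l : List R) {m : List R} (hm : m ≠ []) :
    (mul l m).length = l.length + m.length - 1 := by
  have := List.length_pos_of_ne_nil hm
  induction l with
  | nil => simp [mul]
  | cons c l ih =>
    simp only [mul, length_add, List.length_append, List.length_map, List.length_replicate,
      List.length_cons, ih]
    omega

lemma formEval_mul (l : List R) {m : List R} (hm : m ≠ []) :
    formEval f Z Y (mul l m) = formEval f Z Y l * formEval f Z Y m := by
  have := List.length_pos_of_ne_nil hm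
  induction l with
  | nil => simp [mul, formEval_replicate_zero]
  | cons c l ih =>
    rw [mul, formEval_add, formEval_append_replicate_zero, formEval_map_mul]
    · simp only [formEval_cons, map_zero, ih]
      ring
    · simp only [List.length_append, List.length_map, List.length_replicate, List.length_cons,
        length_mul l hm]
      omega

@[simp] lemma length_scale (H : R) (l : List R) : (scale H l).length = l.length := by
  induction l with
  | nil => rfl
  | cons c l ih => simp [scale, ih]

lemma formEval_scale (H : R) (l : List R) :
    formEval f Z Y (scale H l) = formEval f (f H * Z) Y l := by
  induction l with
  | nil => rfl
  | cons c l ih => simp only [scale, formEval_cons, ih, length_scale, map_mul, map_pow]; ring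

@[simp] lemma length_shift (H : R) (l : List R) : (shift H l).length = l.length := by
  induction l with
  | nil => rfl
  | cons c l ih => simp [shift, ih]

lemma formEval_shift (H : R) (l : List R) :
    formEval f Z Y (shift H l) = formEval f Z (f H * Z + Y) l := by
  induction l with
  | nil => rfl
  | cons c l ih =>
    have e := formEval_append_replicate_zero f Z Y ((shift H l).map (H * ·)) 1
    rw [List.replicate_one] at e
    rw [shift, formEval_add _ _ _ (by simp), formEval_add _ _ _ (by simp), e, formEval_map_mul]
    simp only [formEval_cons, formEval_replicate_zero, ih, List.length_replicate, map_zero]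
    ring

lemma formEval_smul (t : A) {k : ℕ} {l : List R} (hl : l.length = k + 1) :
    formEval f (t * Z) (t * Y) l = t ^ k * formEval f Z Y l := by
  induction k generalizing l with
  | zero =>
    obtain ⟨c, rfl⟩ := List.length_eq_one_iff.1 hl
    simp
  | succ k ih =>
    obtain ⟨c, l, rfl⟩ := List.exists_cons_of_length_eq_add_one hl
    have hl' : l.length = k + 1 := by simpa using hl
    simp only [formEval_cons, ih hl', hl']
    ring

/-- The value of `∑ w ^ j * p_j (Z, r)` for forms `p₀, …, p_k`. -/
def sumEval (r w : A) : List (List R) → A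
  | [] => 0
  | p :: ps => formEval f Z r p + w * sumEval r w ps

lemma length_subst {H : R} {w : List R} {h : ℕ} (hw : w.length = h + 1) {p : List R}
    {ps : List (List R)} (hp : Graded h (p :: ps)) (hne : ∀ q ∈ p :: ps, q ≠ []) :
    (subst H w (p :: ps)).length = p.length := by
  induction ps generalizing p with
  | nil => simp [subst]
  | cons q ps ih =>
    have h1 : p.length = h + q.length := (List.isChain_cons_cons.1 hp).1
    have h2 := ih (List.IsChain.tail hp) (fun x hx => hne x (List.mem_cons_of_mem _ hx))
    have h3 : 0 < q.length := List.length_pos_of_ne_nil (hne q (by simp))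
    have h4 : subst H w (q :: ps) ≠ [] := List.ne_nil_of_length_pos (by omega)
    simp only [subst, length_add, length_shift, length_mul w h4, h2, hw]
    omega

lemma formEval_subst {H : R} {w : List R} {h : ℕ} (hw : w.length = h + 1)
    {ps : List (List R)} (hp : Graded h ps) (hne : ∀ q ∈ ps, q ≠ []) :
    formEval f Z Y (subst H w ps) =
      sumEval f Z (f H * Z + Y) (formEval f Z Y w) ps := by
  induction ps with
  | nil => rfl
  | cons p ps ih =>
    cases ps with
    | nil => simp [subst, sumEval, formEval_shift]
    | cons q ps =>
      have hne' : ∀ x ∈ q :: ps, x ≠ [] := fun x hx => hne x (List.mem_cons_of_mem _ hx)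
      have h1 : p.length = h + q.length := (List.isChain_cons_cons.1 hp).1
      have h2 := length_subst (H := H) hw (List.IsChain.tail hp) hne'
      have h3 : 0 < q.length := List.length_pos_of_ne_nil (hne q (by simp))
      have h4 : subst H w (q :: ps) ≠ [] := List.ne_nil_of_length_pos (by omega)
      rw [subst, formEval_add, formEval_shift, formEval_mul _ _ _ _ h4,
        ih (List.IsChain.tail hp) hne']
      · rfl
      · simp only [length_shift, length_mul w h4, hw]
        omega

lemma map_sumEval {B : Type*} [CommRing B] (g : A →+* B) (r w : A) (ps : List (List R)) :
    g (sumEval f Z r w ps) = sumEval (g.comp f) (g Z) (g r) (g w) ps := by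
  have key : ∀ l : List R, g (formEval f Z r l) = formEval (g.comp f) (g Z) (g r) l := by
    intro l
    induction l with
    | nil => simp
    | cons c l ih => simp [ih]
  induction ps with
  | nil => simp [sumEval]
  | cons p ps ih => simp [sumEval, ih, key]

lemma isHomogeneous_formEval {f : R →+* S} (hf : ∀ c, (f c).IsHomogeneous 0) {Z Y : S} {e k : ℕ}
    (hZ : Z.IsHomogeneous e) (hY : Y.IsHomogeneous e) {l : List R} (hl : l.length = k + 1) :
    (formEval f Z Y l).IsHomogeneous (e * k) := by
  induction k generalizing l with
  | zero =>
    obtain ⟨c, rfl⟩ := List.length_eq_one_iff.1 hl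
    simpa using hf c
  | succ k ih =>
    obtain ⟨c, l, rfl⟩ := List.exists_cons_of_length_eq_add_one hl
    have hl' : l.length = k + 1 := by simpa using hl
    rw [formEval_cons, hl']
    refine IsHomogeneous.add ?_ ?_
    · simpa using (hf c).mul (hZ.pow (k + 1))
    · have := hY.mul (ih hl')
      rwa [show e + e * k = e * (k + 1) by ring] at this

lemma isHomogeneous_sumEval {f : R →+* S} (hf : ∀ c, (f c).IsHomogeneous 0) {Z r w : S}
    {e h k : ℕ} (hZ : Z.IsHomogeneous e) (hr : r.IsHomogeneous e) (hw : w.IsHomogeneous (e * h))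
    {p : List R} {ps : List (List R)} (hp : Graded h (p :: ps)) (hne : ∀ q ∈ p :: ps, q ≠ [])
    (hk : p.length = k + 1) : (sumEval f Z r w (p :: ps)).IsHomogeneous (e * k) := by
  induction ps generalizing p k with
  | nil => simpa [sumEval] using isHomogeneous_formEval hf hZ hr hk
  | cons q ps ih =>
    have h1 : p.length = h + q.length := (List.isChain_cons_cons.1 hp).1
    have h3 : 0 < q.length := List.length_pos_of_ne_nil (hne q (by simp))
    obtain ⟨j, hj⟩ := Nat.exists_eq_add_one.2 h3
    refine (isHomogeneous_formEval hf hZ hr hk).add ?_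
    have := hw.mul (ih (List.IsChain.tail hp) (fun x hx => hne x (List.mem_cons_of_mem _ hx)) hj)
    rwa [← mul_add, show h + j = k by omega] at this

end BinaryForm

/-! ### Vector fields with dihedral symmetry -/

open BinaryForm

section DihedralField

/-- The vector field `a E + b Φ` at `(x, y)`, where `E` is the Euler field of the plane and
`Φ = v ^ (n - 1) ∂_u + u ^ (n - 1) ∂_v` in the coordinates `u = x + i y` and `v = x - i y`. Both
fields are invariant under the dihedral group of order `2 n`; the third component vanishes. -/
noncomputable def dihedralField {A : Type*} [CommRing A] [Algebra ℂ A] (n : ℕ) (x y a b : A) :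
    Fin 3 → A :=
  let i := algebraMap ℂ A Complex.I
  let t := algebraMap ℂ A (1 / 2)
  ![x * a + b * (t * ((x + i * y) ^ (n - 1) + (x - i * y) ^ (n - 1))),
    y * a + b * (t * i * ((x + i * y) ^ (n - 1) - (x - i * y) ^ (n - 1))), 0]

/-- For `P = X + i Y` and `N = X - i Y`, the forms `W` and `G` express `P ^ (2 h) + N ^ (2 h)`
and `(P ^ (2 h - 1) + N ^ (2 h - 1)) / (2 X)` by `X ^ 2` and `Y ^ 2`. -/
structure PowerSums {R : Type*} [CommRing R] (h : ℕ) (W G : List R) : Prop where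
  even : ∀ {A : Type} [CommRing A] (f : R →+* A) (i X Y : A), i ^ 2 = -1 →
    (X + i * Y) ^ (2 * h) + (X - i * Y) ^ (2 * h) = formEval f (X ^ 2) (Y ^ 2) W
  odd : ∀ {A : Type} [CommRing A] (f : R →+* A) (i X Y : A), i ^ 2 = -1 →
    (X + i * Y) ^ (2 * h - 1) + (X - i * Y) ^ (2 * h - 1) = 2 * X * formEval f (X ^ 2) (Y ^ 2) G
  pos : 1 ≤ h
  length_even : W.length = h + 1
  length_odd : G.length = h

/-- The forms for the dihedral group of order `20`. -/
lemma powerSums_five {R : Type*} [CommRing R] :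
    PowerSums (R := R) 5 [2, -90, 420, -420, 90, -2] [1, -36, 126, -84, 9] where
  even f i X Y hi := by
    have : (X + i * Y) ^ (2 * 5) + (X - i * Y) ^ (2 * 5) = 2 * X ^ 10 +
      90 * X ^ 8 * (i ^ 2 * Y ^ 2) + 420 * X ^ 6 * ((i ^ 2) ^ 2 * Y ^ 4) +
      420 * X ^ 4 * ((i ^ 2) ^ 3 * Y ^ 6) +
      90 * X ^ 2 * ((i ^ 2) ^ 4 * Y ^ 8) + 2 * ((i ^ 2) ^ 5 * Y ^ 10) := by ring
    rw [this, hi]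
    simp only [formEval, List.length_cons, List.length_nil, map_neg, map_ofNat]
    ring
  odd f i X Y hi := by
    have : (X + i * Y) ^ (2 * 5 - 1) + (X - i * Y) ^ (2 * 5 - 1) = 2 * X * (X ^ 8 +
      36 * X ^ 6 * (i ^ 2 * Y ^ 2) + 126 * X ^ 4 * ((i ^ 2) ^ 2 * Y ^ 4) +
      84 * X ^ 2 * ((i ^ 2) ^ 3 * Y ^ 6) + 9 * ((i ^ 2) ^ 4 * Y ^ 8)) := by ring
    rw [this, hi]
    simp only [formEval, List.length_cons, List.length_nil, map_neg, map_ofNat, map_one]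
    ring
  pos := by norm_num
  length_even := rfl
  length_odd := rfl

/-- The forms for the dihedral group of order `24`. -/
lemma powerSums_six {R : Type*} [CommRing R] : PowerSums (R := R) 6
    [2, -132, 990, -1848, 990, -132, 2] [1, -55, 330, -462, 165, -11] where
  even f i X Y hi := by
    have : (X + i * Y) ^ (2 * 6) + (X - i * Y) ^ (2 * 6) = 2 * X ^ 12 +
      132 * X ^ 10 * (i ^ 2 * Y ^ 2) + 990 * X ^ 8 * ((i ^ 2) ^ 2 * Y ^ 4) +
      1848 * X ^ 6 * ((i ^ 2) ^ 3 * Y ^ 6) + 990 * X ^ 4 * ((i ^ 2) ^ 4 * Y ^ 8) +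
      132 * X ^ 2 * ((i ^ 2) ^ 5 * Y ^ 10) + 2 * ((i ^ 2) ^ 6 * Y ^ 12) := by ring
    rw [this, hi]
    simp only [formEval, List.length_cons, List.length_nil, map_neg, map_ofNat]
    ring
  odd f i X Y hi := by
    have : (X + i * Y) ^ (2 * 6 - 1) + (X - i * Y) ^ (2 * 6 - 1) = 2 * X * (X ^ 10 +
      55 * X ^ 8 * (i ^ 2 * Y ^ 2) + 330 * X ^ 6 * ((i ^ 2) ^ 2 * Y ^ 4) +
      462 * X ^ 4 * ((i ^ 2) ^ 3 * Y ^ 6) + 165 * X ^ 2 * ((i ^ 2) ^ 4 * Y ^ 8) +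
      11 * ((i ^ 2) ^ 5 * Y ^ 10)) := by ring
    rw [this, hi]
    simp only [formEval, List.length_cons, List.length_nil, map_neg, map_ofNat, map_one]
    ring
  pos := by norm_num
  length_even := rfl
  length_odd := rfl

variable {R : Type*} [CommRing R] {h : ℕ} {W G : List R}

section Reflection

variable {A : Type} [CommRing A] (f : R →+* A) {i x y α β m m' ε X Y : A}

/-- The invariant `u ^ n + v ^ n` in coordinates adapted to the linear form `X = α x + β y` whose
kernel is a mirror of the dihedral group. -/
lemma PowerSums.invariant_eq (hWG : PowerSums h W G) (hi : i ^ 2 = -1)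
    (hm' : m * m' = 1) (hε : ε ^ 2 = 1) (hX : X = α * x + β * y) (hY : Y = β * x - α * y)
    (h1 : (α + i * β) ^ (2 * h) = ε * m ^ h) (h2 : (α - i * β) ^ (2 * h) = ε * m ^ h) :
    (x + i * y) ^ (2 * h) + (x - i * y) ^ (2 * h) =
      ε * formEval f (m' * X ^ 2) (m' * Y ^ 2) W := by
  have hP : X + i * Y = (α + i * β) * (x - i * y) := by
    rw [hX, hY]; linear_combination (β * y) * hi
  have hN : X - i * Y = (α - i * β) * (x + i * y) := by
    rw [hX, hY]; linear_combination (β * y) * hi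
  rw [formEval_smul f _ _ m' hWG.length_even, ← hWG.even f i X Y hi, hP, hN, mul_pow, mul_pow, h1,
    h2]
  have e : m ^ h * m' ^ h = 1 := by rw [← mul_pow, hm', one_pow]
  linear_combination (-((x + i * y) ^ (2 * h) + (x - i * y) ^ (2 * h))) *
    (hε + ε ^ 2 * e)

/-- The derivative of `X = α x + β y` along the field `Φ` is a multiple of `X`. -/
lemma PowerSums.derivative_eq (hWG : PowerSums h W G) (hi : i ^ 2 = -1) (hm : m = α ^ 2 + β ^ 2)
    (hm' : m * m' = 1) (hε : ε ^ 2 = 1) (hX : X = α * x + β * y) (hY : Y = β * x - α * y)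
    (h1 : (α + i * β) ^ (2 * h) = ε * m ^ h) (h2 : (α - i * β) ^ (2 * h) = ε * m ^ h) :
    α * ((x + i * y) ^ (2 * h - 1) + (x - i * y) ^ (2 * h - 1)) +
      β * (i * ((x + i * y) ^ (2 * h - 1) - (x - i * y) ^ (2 * h - 1))) =
      2 * (ε * X * formEval f (m' * X ^ 2) (m' * Y ^ 2) G) := by
  have hP : X + i * Y = (α + i * β) * (x - i * y) := by
    rw [hX, hY]; linear_combination (β * y) * hi
  have hN : X - i * Y = (α - i * β) * (x + i * y) := by
    rw [hX, hY]; linear_combination (β * y) * hi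
  obtain ⟨k, rfl⟩ : ∃ k, h = k + 1 := Nat.exists_eq_add_one.2 hWG.pos
  have hO := hWG.odd f i X Y hi
  have hmu : (α + i * β) * (α - i * β) = m := by rw [hm]; linear_combination -β ^ 2 * hi
  have e : m ^ k * m' ^ k = 1 := by rw [← mul_pow, hm', one_pow]
  -- `m ^ k * μ = ε * conj μ ^ (2 k + 1)` for `μ = α + i β`, and the conjugate equation
  have g1 : ε * m' ^ k * (α - i * β) ^ (2 * k + 1) = α + i * β := by
    have : (α - i * β) ^ (2 * k + 1) * m = ε * m ^ (k + 1) * (α + i * β) := by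
      rw [← h2, ← hmu]; ring
    linear_combination ε * m' ^ (k + 1) * this - ε * m' ^ k * (α - i * β) ^ (2 * k + 1) * hm' +
      (α + i * β) * (hε + ε ^ 2 * (m * m' * e + hm'))
  have g2 : ε * m' ^ k * (α + i * β) ^ (2 * k + 1) = α - i * β := by
    have : (α + i * β) ^ (2 * k + 1) * m = ε * m ^ (k + 1) * (α - i * β) := by
      rw [← h1, ← hmu]; ring
    linear_combination ε * m' ^ (k + 1) * this - ε * m' ^ k * (α + i * β) ^ (2 * k + 1) * hm' +
      (α - i * β) * (hε + ε ^ 2 * (m * m' * e + hm'))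
  rw [show 2 * (k + 1) - 1 = 2 * k + 1 by omega] at hO ⊢
  rw [formEval_smul f _ _ m' hWG.length_odd]
  rw [hP, hN, mul_pow, mul_pow] at hO
  linear_combination ε * m' ^ k * hO - (x - i * y) ^ (2 * k + 1) * g2 -
    (x + i * y) ^ (2 * k + 1) * g1

end Reflection

end DihedralField

section TangencyForm

variable {R : Type*} [CommRing R]

/-- The factor that remains when `X` is split off from the derivative of a linear form `X` along an
invariant field, restricted to a line on which `X ^ 2 / m = H Z`; see
`invariantField_tangent`. The sign `e` distinguishes the two orbits of mirrors. -/
def tangencyForm (W G : List R) (as bs : List (List R)) (H e : R) : List R :=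
  let w := (scale H W).map (e * ·)
  add (subst H w as) (mul ((scale H G).map (e * ·)) (subst H w bs))

/-- The forms define an invariant field `a E + b Φ` of degree `2 k + 1`. -/
def IsInvariantField (h k : ℕ) (as bs : List (List R)) : Prop :=
  (Graded h as ∧ ∀ q ∈ as, q ≠ []) ∧ (Graded h bs ∧ ∀ q ∈ bs, q ≠ []) ∧ bs ≠ [] ∧
    (as.headD []).length = k + 1 ∧ (bs.headD []).length + h = k + 2

instance [DecidableEq R] (h k : ℕ) (as bs : List (List R)) :
    Decidable (IsInvariantField h k as bs) := by
  unfold IsInvariantField; infer_instance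

lemma formEval_eq_zero {A : Type*} [CommRing A] (f : R →+* A) (Z Y : A) {l : List R}
    (hl : ∀ c ∈ l, c = 0) : formEval f Z Y l = 0 := by
  rw [List.eq_replicate_of_mem hl, formEval_replicate_zero]

lemma formEval_tangencyForm {A : Type*} [CommRing A] (f : R →+* A) (Z Y : A) {h k : ℕ}
    {W G : List R} (hWG : PowerSums h W G) {as bs : List (List R)}
    (hab : IsInvariantField h k as bs) (H e : R) :
    formEval f Z Y (tangencyForm W G as bs H e) =
      sumEval f Z (f H * Z + Y) (f e * formEval f (f H * Z) Y W) as +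
        f e * formEval f (f H * Z) Y G *
          sumEval f Z (f H * Z + Y) (f e * formEval f (f H * Z) Y W) bs := by
  obtain ⟨⟨ha, ha'⟩, ⟨hb, hb'⟩, hb0, hak, hbk⟩ := hab
  have hw : ((scale H W).map (e * ·)).length = h + 1 := by simp [hWG.length_even]
  have hwe : formEval f Z Y ((scale H W).map (e * ·)) = f e * formEval f (f H * Z) Y W := by
    rw [formEval_map_mul, formEval_scale]
  cases as with
  | nil => simp at hak
  | cons p ps =>
    cases bs with
    | nil => exact absurd rfl hb0
    | cons q qs =>
      have hq : 0 < q.length := List.length_pos_of_ne_nil (hb' q (by simp))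
      have l1 := length_subst (H := H) hw ha ha'
      have l2 := length_subst (H := H) hw hb hb'
      have l3 : subst H ((scale H W).map (e * ·)) (q :: qs) ≠ [] :=
        List.ne_nil_of_length_pos (by omega)
      simp only [List.headD_cons] at hak hbk
      rw [tangencyForm, formEval_add, formEval_mul _ _ _ _ l3, formEval_map_mul, formEval_scale,
        formEval_subst f Z Y hw ha ha', formEval_subst f Z Y hw hb hb', hwe]
      rw [l1, length_mul _ l3, l2]
      simp only [List.length_map, length_scale, hWG.length_odd]
      omega

end TangencyForm

section InvariantField

variable {D : ℕ}

/-- The embedding of `ℤ[√D]` into a complex algebra. -/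
noncomputable def toAlgebra (D : ℕ) (A : Type*) [CommRing A] [Algebra ℂ A] : Quad D →+* A :=
  (algebraMap ℂ A).comp (toComplex D)

/-- The invariant field `a E + b Φ` for `n = 2 h`, where `a` and `b` are given by forms in `ζ z ^ 2`
and `x ^ 2 + y ^ 2`, the coefficients of the powers of `u ^ n + v ^ n`. -/
noncomputable def invariantField (h : ℕ) (ζ : ℂ) (as bs : List (List (Quad D))) {A : Type}
    [CommRing A] [Algebra ℂ A] (x y z : A) : Fin 3 → A :=
  let i := algebraMap ℂ A Complex.I
  let coeff := sumEval (toAlgebra D A) (algebraMap ℂ A ζ * z ^ 2) (x ^ 2 + y ^ 2)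
    ((x + i * y) ^ (2 * h) + (x - i * y) ^ (2 * h))
  dihedralField (2 * h) x y (coeff as) (coeff bs)

lemma map_invariantField (h : ℕ) (ζ : ℂ) (as bs : List (List (Quad D))) {A B : Type}
    [CommRing A] [Algebra ℂ A] [CommRing B] [Algebra ℂ B] (g : A →ₐ[ℂ] B) (x y z : A) (j : Fin 3) :
    g (invariantField h ζ as bs x y z j) = invariantField h ζ as bs (g x) (g y) (g z) j := by
  have e : (g : A →+* B).comp (toAlgebra D A) = toAlgebra D B := by
    ext; simp [toAlgebra]
  have key := fun ps : List (List (Quad D)) => map_sumEval (toAlgebra D A)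
    (algebraMap ℂ A ζ * z ^ 2) (g : A →+* B) (x ^ 2 + y ^ 2)
    ((x + algebraMap ℂ A Complex.I * y) ^ (2 * h) + (x - algebraMap ℂ A Complex.I * y) ^ (2 * h)) ps
  simp only [RingHom.coe_coe, e, map_add, map_mul, map_pow, map_sub, AlgHom.commutes] at key
  fin_cases j <;> simp [invariantField, dihedralField, key]

lemma isHomogeneous_invariantField {h k : ℕ} (hh : 1 ≤ h) (ζ : ℂ) {as bs : List (List (Quad D))}
    (hab : IsInvariantField h k as bs) (j : Fin 3) :
    (invariantField h ζ as bs (X 0 : S) (X 1) (X 2) j).IsHomogeneous (2 * k + 1) := by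
  have hc : ∀ c : ℂ, (algebraMap ℂ S c).IsHomogeneous 0 := fun c => isHomogeneous_C _ c
  have hx : ∀ j, (X j : S).IsHomogeneous 1 := fun j => isHomogeneous_X ℂ j
  have hiy : (algebraMap ℂ S Complex.I * X 1).IsHomogeneous 1 := by simpa using (hc _).mul (hx 1)
  have hu := (hx 0).add hiy
  have hv := (hx 0).sub hiy
  have hun := fun n => hu.pow n
  have hvn := fun n => hv.pow n
  simp only [one_mul] at hun hvn
  have hZ : (algebraMap ℂ S ζ * X 2 ^ 2).IsHomogeneous 2 := by simpa using (hc ζ).mul ((hx 2).pow 2)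
  have hr : (X 0 ^ 2 + X 1 ^ 2 : S).IsHomogeneous 2 := by
    simpa using ((hx 0).pow 2).add ((hx 1).pow 2)
  have hw := (hun (2 * h)).add (hvn (2 * h))
  obtain ⟨⟨ha, ha'⟩, ⟨hb, hb'⟩, hb0, hak, hbk⟩ := hab
  cases as with
  | nil => simp at hak
  | cons p ps =>
    cases bs with
    | nil => exact absurd rfl hb0
    | cons q qs =>
      have hq : 0 < q.length := List.length_pos_of_ne_nil (hb' q (by simp))
      obtain ⟨l, hl⟩ := Nat.exists_eq_add_one.2 hq
      simp only [List.headD_cons] at hak hbk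
      have hA := isHomogeneous_sumEval (f := toAlgebra D S) (fun c => hc _) hZ hr hw ha ha' hak
      have hB := isHomogeneous_sumEval (f := toAlgebra D S) (fun c => hc _) hZ hr hw hb hb' hl
      have e1 : 1 + 2 * k = 2 * k + 1 := by ring
      have e2 : 2 * l + (0 + (2 * h - 1)) = 2 * k + 1 := by omega
      have e3 : 2 * l + (0 + 0 + (2 * h - 1)) = 2 * k + 1 := by omega
      fin_cases j
      · exact (e1 ▸ (hx 0).mul hA).add
          (e2 ▸ hB.mul ((hc _).mul ((hun _).add (hvn _))))
      · exact (e1 ▸ (hx 1).mul hA).add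
          (e3 ▸ hB.mul (((hc _).mul (hc _)).mul ((hun _).sub (hvn _))))
      · exact isHomogeneous_zero _ _ _

/-- Let `n = 2 h` and `(α + i β) ^ n = e m ^ h`. An invariant field is tangent to the line
`α x + β y + γ z = 0` if `γ = 0`, or if `γ ^ 2 = m H ζ` and the tangency form for `H` and `e`
vanishes. -/
lemma invariantField_tangent {h k : ℕ} {ζ : ℂ} {as bs : List (List (Quad D))}
    {W G : List (Quad D)} (hWG : PowerSums h W G) (hab : IsInvariantField h k as bs)
    {A : Type} [CommRing A] [Algebra ℂ A] {x y z : A} {α β γ m : ℂ} {e : Quad D} (he : e ^ 2 = 1)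
    (hm0 : m ≠ 0) (hm : m = α ^ 2 + β ^ 2)
    (h1 : (α + Complex.I * β) ^ (2 * h) = toComplex D e * m ^ h)
    (h2 : (α - Complex.I * β) ^ (2 * h) = toComplex D e * m ^ h)
    (hline : algebraMap ℂ A α * x + algebraMap ℂ A β * y + algebraMap ℂ A γ * z = 0)
    (hH : γ = 0 ∨ ∃ H : Quad D, γ ^ 2 = m * toComplex D H * ζ ∧
      ∀ c ∈ tangencyForm W G as bs H e, c = 0) :
    algebraMap ℂ A α * invariantField h ζ as bs x y z 0 +
      algebraMap ℂ A β * invariantField h ζ as bs x y z 1 = 0 := by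
  have hi : (algebraMap ℂ A Complex.I) ^ 2 = -1 := by rw [← map_pow]; simp
  have am := congrArg (algebraMap ℂ A) hm
  have am' : algebraMap ℂ A m * algebraMap ℂ A m⁻¹ = 1 := by
    rw [← map_mul, mul_inv_cancel₀ hm0, map_one]
  have ae := congrArg (toAlgebra D A) he
  have a1 := congrArg (algebraMap ℂ A) h1
  have a2 := congrArg (algebraMap ℂ A) h2
  have at2 : 2 * algebraMap ℂ A (1 / 2) = 1 := by
    rw [← map_ofNat (algebraMap ℂ A) 2, ← map_mul]; norm_num
  have hte : algebraMap ℂ A (toComplex D e) = toAlgebra D A e := rfl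
  simp only [map_add, map_sub, map_mul, map_pow, map_one, hte] at am ae a1 a2
  have hinv := hWG.invariant_eq (toAlgebra D A) (x := x) (y := y) hi am' ae rfl rfl a1 a2
  have hder := hWG.derivative_eq (toAlgebra D A) (x := x) (y := y) hi am am' ae rfl rfl a1 a2
  simp only [invariantField, dihedralField, Matrix.cons_val]
  set i := algebraMap ℂ A Complex.I
  set t := algebraMap ℂ A (1 / 2)
  set ζ' := algebraMap ℂ A ζ
  set X := algebraMap ℂ A α * x + algebraMap ℂ A β * y with hX
  set Y := algebraMap ℂ A β * x - algebraMap ℂ A α * y with hY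
  set m' := algebraMap ℂ A m⁻¹
  set a := sumEval (toAlgebra D A) (ζ' * z ^ 2) (x ^ 2 + y ^ 2)
    ((x + i * y) ^ (2 * h) + (x - i * y) ^ (2 * h)) as with ha
  set b := sumEval (toAlgebra D A) (ζ' * z ^ 2) (x ^ 2 + y ^ 2)
    ((x + i * y) ^ (2 * h) + (x - i * y) ^ (2 * h)) bs with hb
  have split : ∀ g, g = formEval (toAlgebra D A) (m' * X ^ 2) (m' * Y ^ 2) G →
      X * (a + toAlgebra D A e * g * b) = 0 →
      algebraMap ℂ A α *
        (x * a + b * (t * ((x + i * y) ^ (2 * h - 1) + (x - i * y) ^ (2 * h - 1)))) +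
      algebraMap ℂ A β * (y * a + b * (t * i * ((x + i * y) ^ (2 * h - 1) -
        (x - i * y) ^ (2 * h - 1)))) = 0 := by
    rintro g rfl h0
    linear_combination h0 + a * hX + b * t * hder +
      b * toAlgebra D A e * X * formEval (toAlgebra D A) (m' * X ^ 2) (m' * Y ^ 2) G * at2
  refine split _ rfl ?_
  rcases hH with rfl | ⟨H, hH, hK⟩
  · have : X = 0 := by simpa using hline
    rw [this, zero_mul]
  · have aH := congrArg (algebraMap ℂ A) hH
    have htH : algebraMap ℂ A (toComplex D H) = toAlgebra D A H := rfl
    simp only [map_mul, map_pow, htH] at aH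
    -- on the line, `X ^ 2 / m` agrees with `H ζ z ^ 2`
    have hXZ : m' * X ^ 2 = toAlgebra D A H * (ζ' * z ^ 2) := by
      linear_combination m' * (X - algebraMap ℂ A γ * z) * hline + m' * z ^ 2 * aH +
        toAlgebra D A H * ζ' * z ^ 2 * am'
    have hr : x ^ 2 + y ^ 2 = toAlgebra D A H * (ζ' * z ^ 2) + m' * Y ^ 2 := by
      rw [← hXZ]
      linear_combination (-(x ^ 2 + y ^ 2)) * am' + (x ^ 2 + y ^ 2) * m' * am
    have key := formEval_tangencyForm (toAlgebra D A) (ζ' * z ^ 2) (m' * Y ^ 2) hWG hab H e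
    rw [formEval_eq_zero _ _ _ hK, ← hXZ, ← hinv, hXZ, ← hr, ← hXZ, ← ha, ← hb] at key
    rw [← key, mul_zero]

end InvariantField

/-! ### Freeness -/

section Mirror

variable {D : ℕ}

/-- The coordinates of `(a + b √-q) ^ n`. -/
def quadPow (q a b : Quad D) : ℕ → Quad D × Quad D
  | 0 => (1, 0)
  | n + 1 => ((fun p => (a * p.1 - q * b * p.2, a * p.2 + b * p.1)) : Quad D × Quad D → _)
      (quadPow q a b n)

lemma add_mul_pow_eq {q : Quad D} {τ j : ℂ} (hτ : τ ^ 2 = toComplex D q) (hj : j ^ 2 = -1)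
    (a b : Quad D) (n : ℕ) :
    (toComplex D a + j * (τ * toComplex D b)) ^ n =
      toComplex D (quadPow q a b n).1 + j * (τ * toComplex D (quadPow q a b n).2) := by
  induction n with
  | zero => simp [quadPow]
  | succ n ih =>
    rw [pow_succ, ih, quadPow]
    simp only [map_add, map_sub, map_mul, ← hτ]
    linear_combination τ ^ 2 * toComplex D b * toComplex D (quadPow q a b n).2 * hj

/-- The line `v` is the line at infinity, or it is perpendicular to a mirror of the dihedral group
of order `4 h`, and the square of its distance from the centre, if not zero, is `H ζ` for a pair
`(H, e)` in `cases`. Here `ζ = s / N`, the second coordinate is scaled by `τ` with `τ ^ 2 = q`, and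
the sign `e` tells to which orbit of mirrors the direction belongs. -/
def IsMirrorNormal (h : ℕ) (q s : Quad D) (N : ℕ) (cases : List (Quad D × Quad D))
    (v : Vec (Quad D)) : Prop :=
  (v.1 = 0 ∧ v.2.1 = 0) ∨
    (v.1 ^ 2 + q * v.2.1 ^ 2 ≠ 0 ∧ ∃ e ∈ [(1 : Quad D), -1],
      quadPow q v.1 v.2.1 (2 * h) = (e * (v.1 ^ 2 + q * v.2.1 ^ 2) ^ h, 0) ∧
      (v.2.2 = 0 ∨ ∃ H ∈ cases, H.2 = e ∧
        N * v.2.2 ^ 2 = (v.1 ^ 2 + q * v.2.1 ^ 2) * H.1 * s))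

instance (h : ℕ) (q s : Quad D) (N : ℕ) (cases : List (Quad D × Quad D)) (v : Vec (Quad D)) :
    Decidable (IsMirrorNormal h q s N cases v) := by
  unfold IsMirrorNormal; infer_instance

lemma invariantField_tangent_coords {h k : ℕ} {as bs : List (List (Quad D))}
    {W G : List (Quad D)} (hWG : PowerSums h W G) (hab : IsInvariantField h k as bs)
    (hD : Function.Injective (toComplex D)) {τ : ℂ} {q s : Quad D} (hτ : τ ^ 2 = toComplex D q)
    {N : ℕ} (hN : N ≠ 0) {cases : List (Quad D × Quad D)}
    (hcases : ∀ H ∈ cases, ∀ c ∈ tangencyForm W G as bs H.1 H.2, c = 0)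
    {v : Vec (Quad D)} (hv : IsMirrorNormal h q s N cases v) :
    linForm (coords (toComplex D) τ v) ∣ gradMap (linForm (coords (toComplex D) τ v))
      (invariantField h (toComplex D s / N) as bs (X 0 : S) (X 1) (X 2)) := by
  set ℓ := linForm (coords (toComplex D) τ v) with hℓ
  set ζ := toComplex D s / N with hζ
  have hN' : (N : ℂ) ≠ 0 := Nat.cast_ne_zero.2 hN
  -- compute modulo the linear form
  obtain ⟨A, _, _, g, hg⟩ : ∃ (A : Type) (_ : CommRing A) (_ : Algebra ℂ A) (g : S →ₐ[ℂ] A),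
      ∀ F, g F = 0 ↔ ℓ ∣ F :=
    ⟨_, _, _, Ideal.Quotient.mkₐ ℂ (Ideal.span {ℓ}), fun F => by
      rw [Ideal.Quotient.mkₐ_eq_mk, Ideal.Quotient.eq_zero_iff_mem, Ideal.mem_span_singleton]⟩
  have hgC : ∀ c, g (C c) = algebraMap ℂ _ c := fun c => g.commutes c
  have hgℓ := (hg ℓ).2 dvd_rfl
  rw [← hg, hℓ, gradMap_linForm]
  rw [hℓ] at hgℓ
  simp only [linForm, Fin.sum_univ_three, map_add, map_mul, map_invariantField, hgC, coords,
    Matrix.cons_val] at hgℓ ⊢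
  have h2 : invariantField h ζ as bs (g (X 0)) (g (X 1)) (g (X 2)) 2 = 0 := rfl
  rw [h2, mul_zero, add_zero]
  rw [← map_mul (algebraMap ℂ A) τ] at hgℓ ⊢
  rcases hv with ⟨ha, hb⟩ | ⟨hm, e, he, hpow, hc⟩
  · simp [ha, hb]
  have he2 : e ^ 2 = 1 := by
    simp only [List.mem_cons, List.not_mem_nil, or_false] at he
    rcases he with rfl | rfl <;> ring
  have pow : ∀ j : ℂ, j ^ 2 = -1 → (toComplex D v.1 + j * (τ * toComplex D v.2.1)) ^ (2 * h) =
      toComplex D e * toComplex D (v.1 ^ 2 + q * v.2.1 ^ 2) ^ h := fun j hj => by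
    rw [add_mul_pow_eq hτ hj, hpow]
    simp
  refine invariantField_tangent hWG hab he2 ((map_ne_zero_iff _ hD).2 hm) ?_
    (pow _ Complex.I_sq) ?_ hgℓ ?_
  · simp only [map_add, map_mul, map_pow, ← hτ]; ring
  · have := pow (-Complex.I) (by simp)
    rwa [neg_mul, ← sub_eq_add_neg] at this
  · refine hc.imp (fun hc => by rw [hc, map_zero]) ?_
    rintro ⟨H, hH, rfl, hN2⟩
    refine ⟨H.1, ?_, hcases H hH⟩
    have := congrArg (toComplex D) hN2
    simp only [map_mul, map_pow, map_natCast] at this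
    rw [hζ]
    field_simp
    linear_combination this

lemma isTangent_image {L : List (Vec (Quad D))} (hD : Function.Injective (toComplex D)) {τ : ℂ}
    (hτ : τ ≠ 0) (hL : ∀ v ∈ L, v ≠ 0) {θ : Fin 3 → S}
    (h : ∀ v ∈ L, linForm (coords (toComplex D) τ v) ∣
      gradMap (linForm (coords (toComplex D) τ v)) θ) :
    IsTangent (emb (toComplex D) τ '' {v | v ∈ L}) θ := by
  rintro _ ⟨v, hv, rfl⟩
  have hw := coords_ne_zero hD hτ (hL v hv)
  have hrep := (Projectivization.mk_eq_mk_iff' ℂ _ _ (emb (toComplex D) τ v).rep_nonzero hw).1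
    ((Projectivization.mk_rep _).trans (pt_eq_mk hw))
  obtain ⟨c, hc⟩ := hrep
  have hc0 : c ≠ 0 := by
    rintro rfl
    exact (emb (toComplex D) τ v).rep_nonzero (by rw [← hc, zero_smul])
  have hu : IsUnit (C c : S) := (isUnit_iff_ne_zero.2 hc0).map C
  obtain ⟨k, hk⟩ := h v hv
  rw [lineForm_eq, ← hc, linForm_smul, hu.mul_left_dvd]
  refine ⟨C c * k, ?_⟩
  rw [gradMap_mul, hk]
  have : gradMap (C c) θ = 0 := by simp [gradMap_apply]
  rw [this]
  ring

/-- The value at `Z = w = 1` and `r = 0` of the coefficient given by a list of forms. -/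
def leadSum (ps : List (List (Quad D))) : Quad D := (ps.map fun p => p.headD 0).sum

lemma sumEval_one_zero_one {A : Type*} [CommRing A] (f : Quad D →+* A)
    (ps : List (List (Quad D))) : sumEval f 1 0 1 ps = f (leadSum ps) := by
  induction ps with
  | nil => simp [sumEval, leadSum]
  | cons p ps ih =>
    rw [sumEval, ih]
    cases p <;> simp [leadSum]

/-- The determinant of two invariant fields and the Euler field is evaluated at a point
with `u = 1`, `v = 0` and `ζ z ^ 2 = 1`. -/
lemma fieldDet_invariantField_ne_zero {h : ℕ} (hh : 1 ≤ h) {ζ : ℂ} (hζ : ζ ≠ 0)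
    (hD : Function.Injective (toComplex D)) {as bs as' bs' : List (List (Quad D))}
    (hdet : leadSum as * leadSum bs' - leadSum as' * leadSum bs ≠ 0) :
    fieldDet X (invariantField h ζ as bs (X 0 : S) (X 1) (X 2))
      (invariantField h ζ as' bs' (X 0 : S) (X 1) (X 2)) ≠ 0 := by
  obtain ⟨z, hz⟩ := IsAlgClosed.exists_pow_nat_eq ζ⁻¹ (n := 2) (by norm_num)
  have hz0 : z ≠ 0 := by
    rintro rfl
    exact inv_ne_zero hζ (by rw [← hz]; norm_num)
  intro h0
  have h1 := congrArg (aeval ![1 / 2, -Complex.I / 2, z]) h0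
  have hu : (1 / 2 : ℂ) + Complex.I * (-Complex.I / 2) = 1 := by
    linear_combination -Complex.I_sq / 2
  have hv : (1 / 2 : ℂ) - Complex.I * (-Complex.I / 2) = 0 := by
    linear_combination Complex.I_sq / 2
  have hr : (1 / 2 : ℂ) ^ 2 + (-Complex.I / 2) ^ 2 = 0 := by
    linear_combination Complex.I_sq / 4
  have hZ : ζ * z ^ 2 = 1 := by rw [hz, mul_inv_cancel₀ hζ]
  have e1 : 2 * h - 1 ≠ 0 := by omega
  have e2 : 2 * h ≠ 0 := by omega
  simp only [fieldDet, map_add, map_mul, map_sub, map_invariantField, aeval_X, map_zero] at h1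
  simp only [Matrix.cons_val, invariantField, dihedralField, Algebra.algebraMap_self,
    RingHom.id_apply, hu, hv, hr, hZ, one_pow, zero_pow e1, zero_pow e2, add_zero, sub_zero,
    sumEval_one_zero_one] at h1
  have h2 := (map_ne_zero_iff _ hD).2 hdet
  have e3 : ∀ x : Quad D, toAlgebra D ℂ x = toComplex D x := fun _ => rfl
  simp only [e3] at h1
  rw [map_sub, map_mul, map_mul] at h2
  have h3 : z * Complex.I * (toComplex D (leadSum as) * toComplex D (leadSum bs') -
      toComplex D (leadSum as') * toComplex D (leadSum bs)) = 0 := by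
    linear_combination 2 * h1
  simp only [mul_eq_zero, hz0, Complex.I_ne_zero, h2, or_self] at h3

/-- Two independent invariant fields of complementary degrees show that the arrangement is free. -/
theorem isFree_of_invariantFields {h k k' : ℕ} {as bs as' bs' : List (List (Quad D))}
    {W G : List (Quad D)} (hWG : PowerSums h W G) (hab : IsInvariantField h k as bs)
    (hab' : IsInvariantField h k' as' bs') (hkk : k ≤ k')
    (hD : Function.Injective (toComplex D)) {τ : ℂ} {q s : Quad D} (hτ : τ ^ 2 = toComplex D q)
    (hτ0 : τ ≠ 0) (hs : s ≠ 0) {N : ℕ} (hN : N ≠ 0) {cases : List (Quad D × Quad D)}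
    (hcases : ∀ H ∈ cases, ∀ c ∈ tangencyForm W G as bs H.1 H.2, c = 0)
    (hcases' : ∀ H ∈ cases, ∀ c ∈ tangencyForm W G as' bs' H.1 H.2, c = 0)
    (hdet : leadSum as * leadSum bs' - leadSum as' * leadSum bs ≠ 0)
    {L : List (Vec (Quad D))} (hL : Distinct L) (hlen : 2 * k + 2 * k' + 3 = L.length)
    (hmir : ∀ v ∈ L, IsMirrorNormal h q s N cases v) :
    IsFree (emb (toComplex D) τ '' {v | v ∈ L}) := by
  have hζ : toComplex D s / N ≠ 0 :=
    div_ne_zero ((map_ne_zero_iff _ hD).2 hs) (Nat.cast_ne_zero.2 hN)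
  refine ⟨2 * k + 1, 2 * k' + 1, isFreeWithExponents_of_isTangent
    (L.finite_toSet.image _) (by omega) (by omega) ?_
    (isHomogeneous_invariantField hWG.pos (toComplex D s / N) hab)
    (isHomogeneous_invariantField hWG.pos (toComplex D s / N) hab')
    (isTangent_image hD hτ0 hL.1 fun v hv =>
      invariantField_tangent_coords hWG hab hD hτ hN hcases (hmir v hv))
    (isTangent_image hD hτ0 hL.1 fun v hv =>
      invariantField_tangent_coords hWG hab' hD hτ hN hcases' (hmir v hv))
    (fieldDet_invariantField_ne_zero hWG.pos hζ hD hdet)⟩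
  rw [hL.ncard_image hD hτ0]
  omega

end Mirror

/-- The coefficient of `E` in a field of degree `29` that is tangent to `𝒪₆₁`. As for the
similar lists below, the numbers solve the homogeneous linear system that says that all tangency
forms vanish. -/
def radial61a : List (List (Quad 5)) :=
  [[96757023244288, -892803441754112, 3168655072296960, -5659736103976960, 5724909011468288,
  -3514720719994880, 1365282694103040, -343446850109440, 56496065085440, -6076894412800,
  423389294592, -18644871168, 492433920, -6966960, 39237], [-27830045900800, 40952009850880,
  -23099059732480, 6481083105280, -1010186649600, 92674920448, -5088172032, 162919680, -2777040,
  19263], [322736128, -60936192, 4231680, -132240, 1653]]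

/-- The coefficient of `Φ` in the field of degree `29` that is tangent to `𝒪₆₁`. -/
def harmonic61a : List (List (Quad 5)) :=
  [[84603339538432, -154563793387520, 108157678387200, -37901408665600, 7456784384000,
  -881092198400, 64423096320, -2905753600, 77580800, -1102000, 6213], [-6794444800, 1679011840,
  -161843200, 7609600, -174000, 1537], [22]]

/-- The coefficient of `E` in a field of degree `31` that is tangent to `𝒪₆₁`. -/
def radial61b : List (List (Quad 5)) :=
  [[0, 0, 89060441849856, -828756889436160, 2920723790168064, -5057648261070848, 4834433307770880,
  -2736462579630080, 959506116771840, -214430297620480, 30912604897280, -2859182120960,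
  165125097984, -5603495040, 98346336, -648252], [51709258760192, -193909720350720,
  238536611594240, -137483853496320, 42106967818240, -7354371112960, 756769136640, -45683203584,
  1528074240, -24246336, 112215], [-74956963840, 37478481920, -6479752704, 470336640, -14038416,
  134349], [6897]]

/-- The coefficient of `Φ` in the field of degree `31` that is tangent to `𝒪₆₁`. -/
def harmonic61b : List (List (Quad 5)) :=
  [[-59244778881024, 267947977211904, -346295831101440, 180549687705600, -33506407219200,
  -2735868477440, 1978507100160, -307575234560, 22644595200, -851382400, 15438944, -102524],
  [599655710720, -388413358080, 87358177280, -8664537600, 388691200, -7298944, 42399], [-385264,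
  9119]]

/-- The coefficient of `E` in a field of degree `23` that is tangent to `𝒪₄₉`. -/
def radial49a : List (List (Quad 3)) :=
  [[54525952, -602931200, 2556428288, -5289213952, 5728600064, -3345702912, 1067329536, -189446400,
  18734144, -999856, 26312, -286], [13165568, -10557184, 2882176, -344080, 17204, -253]]

/-- The coefficient of `Φ` in the field of degree `23` that is tangent to `𝒪₄₉`. -/
def harmonic49a : List (List (Quad 3)) :=
  [[-52662272, 55111680, -17840640, 2590720, -182160, 5520, -46], [-13]]

/-- The coefficient of `E` in a field of degree `25` that is tangent to `𝒪₄₉`. -/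
def radial49b : List (List (Quad 3)) :=
  [[0, 0, 703594496, -7736131584, 32456245248, -65833467904, 68698079232, -37484928000,
  10578650368, -1523039232, 105987024, -3143712, 31746], [-28381184, 85143552, 80050432, -78372800,
  17168448, -1303896, 24365], [1859]]

/-- The coefficient of `Φ` in the field of degree `25` that is tangent to `𝒪₄₉`. -/
def harmonic49b : List (List (Quad 3)) :=
  [[30457856, -120074240, -522762240, 554662400, -142057280, 13411920, -467432, 4430], [-27716,
  1781]]

/-- The values of `H` and `e` for the lines of `𝒪₆₁`; the squares of the nonzero distances
from the centre are `H (5 + √5) / 16`. -/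
def distances61 : List (Quad 5 × Quad 5) :=
  [(⟨7, -3⟩, -1), (⟨3, -1⟩, -1), (2, -1), (⟨3, 1⟩, -1), (⟨7, 3⟩, -1)]

/-- The values of `H` and `e` for the lines of `𝒪₄₉`; the squares of the nonzero distances
from the centre are `H (2 + √3) / 4`. -/
def distances49 : List (Quad 3 × Quad 3) :=
  [(⟨2, -1⟩, 1), (⟨2, 1⟩, 1), (1, -1)]

theorem isFree_O61 : IsFree O61 := by
  rw [O61_eq]
  refine isFree_of_invariantFields (k := 14) (k' := 15) (as := radial61a) (bs := harmonic61a)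
    (as' := radial61b) (bs' := harmonic61b) (q := ⟨10, 2⟩) (s := ⟨5, 1⟩) (N := 16)
    (cases := distances61) powerSums_five ?_ ?_ (by norm_num) toComplex_five_injective ?_
    tau_ne_zero ?_ (by norm_num) ?_ ?_ ?_ distinct_lines61 rfl ?_
  case refine_3 => rw [toComplex_apply, ← Complex.ofReal_pow, tau_sq]; push_cast; ring
  all_goals decide +kernel

theorem isFree_O49 : IsFree O49 := by
  rw [O49_eq]
  refine isFree_of_invariantFields (k := 11) (k' := 12) (as := radial49a) (bs := harmonic49a)
    (as' := radial49b) (bs' := harmonic49b) (q := 1) (s := ⟨2, 1⟩) (N := 4)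
    (cases := distances49) powerSums_six ?_ ?_ (by norm_num) toComplex_three_injective (by simp)
    one_ne_zero ?_ (by norm_num) ?_ ?_ ?_ distinct_lines49 rfl ?_
  all_goals decide +kernel

/-! ### Rigidity -/

open Projectivization

section Independence

lemma independent_pt_iff {u v w : Fin 3 → ℂ} (hu : u ≠ 0) (hv : v ≠ 0) (hw : w ≠ 0) :
    Independent ![pt u, pt v, pt w] ↔ u ⬝ᵥ crossProduct v w ≠ 0 := by
  have hne : ∀ i, (![u, v, w] : Fin 3 → Fin 3 → ℂ) i ≠ 0 := by
    intro i; fin_cases i <;> assumption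
  have e : ![pt u, pt v, pt w] = fun i => Projectivization.mk ℂ (![u, v, w] i) (hne i) := by
    funext i
    fin_cases i
    exacts [pt_eq_mk hu, pt_eq_mk hv, pt_eq_mk hw]
  rw [e, independent_iff_iSupIndep]
  simp only [submodule_mk]
  rw [iSupIndep_iff_linearIndependent_of_ne_zero hne, triple_product_eq_det, ← isUnit_iff_ne_zero]
  exact (Matrix.linearIndependent_rows_iff_isUnit (A := Matrix.of ![u, v, w])).trans
    (Matrix.isUnit_iff_isUnit_det _)

lemma mulVec_ne_zero (g : GL (Fin 3) ℂ) {u : Fin 3 → ℂ} (hu : u ≠ 0) : g.1.mulVec u ≠ 0 :=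
  fun h0 => hu <|
    Matrix.eq_zero_of_mulVec_eq_zero ((Matrix.isUnit_iff_isUnit_det _).1 g.isUnit).ne_zero h0

lemma smul_pt (g : GL (Fin 3) ℂ) {u : Fin 3 → ℂ} (hu : u ≠ 0) :
    (Matrix.ProjGenLinGroup.mk g : PGL(3, ℂ)) • pt u = pt (g.1.mulVec u) := by
  rw [pt_eq_mk hu, pt_eq_mk (mulVec_ne_zero g hu)]
  rfl

lemma independent_smul_iff (g : PGL(3, ℂ)) (a b c : Plane) :
    Independent ![g • a, g • b, g • c] ↔ Independent ![a, b, c] := by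
  obtain ⟨g, rfl⟩ := Matrix.ProjGenLinGroup.mk_surjective g
  obtain ⟨u, hu, rfl⟩ := exists_pt_eq a
  obtain ⟨v, hv, rfl⟩ := exists_pt_eq b
  obtain ⟨w, hw, rfl⟩ := exists_pt_eq c
  rw [smul_pt g hu, smul_pt g hv, smul_pt g hw, independent_pt_iff (mulVec_ne_zero g hu)
    (mulVec_ne_zero g hv) (mulVec_ne_zero g hw), independent_pt_iff hu hv hw,
    triple_product_eq_det, triple_product_eq_det]
  have e : Matrix.of ![g.1.mulVec u, g.1.mulVec v, g.1.mulVec w] =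
      Matrix.of ![u, v, w] * g.1.transpose := by
    ext i j
    fin_cases i <;> simp [Matrix.mul_apply, Matrix.mulVec, dotProduct, Fin.sum_univ_three, mul_comm]
  have e' := congrArg Matrix.det e
  rw [Matrix.det_mul, Matrix.det_transpose] at e'
  refine (not_congr ((Eq.congr_left e').trans mul_eq_zero)).trans ?_
  rw [or_iff_left ((Matrix.isUnit_iff_isUnit_det _).1 g.isUnit).ne_zero]
  rfl

/-- The line that joins the meets of two pairs of lines. -/
lemma eq_pt_of_not_independent {a b c d w : Fin 3 → ℂ} {q : Plane} (ha : a ≠ 0) (hb : b ≠ 0)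
    (hc : c ≠ 0) (hd : d ≠ 0) (h1 : ¬ Independent ![pt a, pt b, q])
    (h2 : ¬ Independent ![pt c, pt d, q])
    (hw : crossProduct (crossProduct a b) (crossProduct c d) = w) (hw0 : w ≠ 0) : q = pt w := by
  obtain ⟨x, hx, rfl⟩ := exists_pt_eq q
  rw [independent_pt_iff ha hb hx, not_not, triple_product_permutation, triple_product_permutation,
    dotProduct_comm] at h1
  rw [independent_pt_iff hc hd hx, not_not, triple_product_permutation, triple_product_permutation,
    dotProduct_comm] at h2
  subst hw
  have n1 : crossProduct a b ≠ 0 := fun h => hw0 (by rw [h, map_zero, LinearMap.zero_apply])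
  have n2 : crossProduct c d ≠ 0 := fun h => hw0 (by rw [h, map_zero])
  exact eq_pt_crossProduct n1 n2 hw0 ((pt_orthogonal_pt n1 hx).2 h1) ((pt_orthogonal_pt n2 hx).2 h2)

lemma eq_of_not_independent {a b c d q q' : Plane} (hq : ¬ Independent ![a, b, q])
    (hq2 : ¬ Independent ![c, d, q]) (hq' : ¬ Independent ![a, b, q'])
    (hq2' : ¬ Independent ![c, d, q']) (h1 : Independent ![a, b, c])
    (h2 : Independent ![a, c, d]) : q = q' := by
  obtain ⟨a, ha, rfl⟩ := exists_pt_eq a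
  obtain ⟨b, hb, rfl⟩ := exists_pt_eq b
  obtain ⟨c, hc, rfl⟩ := exists_pt_eq c
  obtain ⟨d, hd, rfl⟩ := exists_pt_eq d
  rw [independent_pt_iff ha hb hc] at h1
  rw [independent_pt_iff ha hc hd] at h2
  have hw : crossProduct (crossProduct a b) (crossProduct c d) ≠ 0 := by
    intro h
    have e : crossProduct (crossProduct a b) (crossProduct c d) ⬝ᵥ crossProduct a c =
        -((a ⬝ᵥ crossProduct b c) * (a ⬝ᵥ crossProduct c d)) := by
      simp only [cross_apply, Matrix.vec3_dotProduct, Matrix.cons_val]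
      ring
    rw [h, zero_dotProduct, eq_comm, neg_eq_zero] at e
    exact mul_ne_zero h1 h2 e
  rw [eq_pt_of_not_independent ha hb hc hd hq hq2 rfl hw,
    eq_pt_of_not_independent ha hb hc hd hq' hq2' rfl hw]

/-- Four lines in general position are the coordinate lines and the unit line in suitable
coordinates. -/
lemma exists_smul_eq_frame {P : ℕ → Plane} (h012 : Independent ![P 0, P 1, P 2])
    (h312 : Independent ![P 3, P 1, P 2]) (h032 : Independent ![P 0, P 3, P 2])
    (h013 : Independent ![P 0, P 1, P 3]) : ∃ g : PGL(3, ℂ), g • P 0 = pt ![1, 0, 0] ∧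
      g • P 1 = pt ![0, 1, 0] ∧ g • P 2 = pt ![0, 0, 1] ∧ g • P 3 = pt ![1, 1, 1] := by
  obtain ⟨a, ha, ea⟩ := exists_pt_eq (P 0)
  obtain ⟨b, hb, eb⟩ := exists_pt_eq (P 1)
  obtain ⟨c, hc, ec⟩ := exists_pt_eq (P 2)
  obtain ⟨d, hd, ed⟩ := exists_pt_eq (P 3)
  rw [← ea, ← eb, ← ec, independent_pt_iff ha hb hc] at h012
  rw [← ed, ← eb, ← ec, independent_pt_iff hd hb hc] at h312
  rw [← ea, ← ed, ← ec, independent_pt_iff ha hd hc] at h032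
  rw [← ea, ← eb, ← ed, independent_pt_iff ha hb hd] at h013
  rw [← ea, ← eb, ← ec, ← ed]
  -- Cramer's rule: `d` is a combination of `a`, `b`, `c` with nonzero coefficients
  set Δ := a ⬝ᵥ crossProduct b c with hΔ
  set x := d ⬝ᵥ crossProduct b c with hx
  set y := a ⬝ᵥ crossProduct d c with hy
  set z := a ⬝ᵥ crossProduct b d with hz
  have hd' : Δ • d = x • a + y • b + z • c := by
    ext i
    simp only [hΔ, hx, hy, hz, cross_apply, Matrix.vec3_dotProduct, Matrix.cons_val, Pi.smul_apply,
      Pi.add_apply, smul_eq_mul]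
    fin_cases i <;> simp only [Fin.zero_eta, Fin.mk_one, Fin.reduceFinMk] <;> ring
  let M : Matrix (Fin 3) (Fin 3) ℂ := (Matrix.of ![x • a, y • b, z • c]).transpose
  have hM : M.det ≠ 0 := by
    have : M.det = x * y * z * Δ := by
      simp only [M, Matrix.det_transpose, Matrix.det_fin_three, hΔ, cross_apply,
        Matrix.vec3_dotProduct, Matrix.of_apply, Matrix.cons_val, Pi.smul_apply, smul_eq_mul]
      ring
    rw [this]
    exact mul_ne_zero (mul_ne_zero (mul_ne_zero h312 h032) h013) h012
  have hcol : ∀ v, M.mulVec v = v 0 • x • a + v 1 • y • b + v 2 • z • c := by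
    intro v
    ext i
    simp only [M, Matrix.mulVec, dotProduct, Fin.sum_univ_three, Matrix.transpose_apply,
      Matrix.of_apply, Matrix.cons_val, Pi.smul_apply, Pi.add_apply, smul_eq_mul]
    ring
  let g := Matrix.GeneralLinearGroup.mkOfDetNeZero M hM
  have key : ∀ {u v : Fin 3 → ℂ} {s : ℂ}, u ≠ 0 → v ≠ 0 → s ≠ 0 → M.mulVec v = s • u →
      (Matrix.ProjGenLinGroup.mk g : PGL(3, ℂ))⁻¹ • pt u = pt v := by
    intro u v s hu hv hs h
    rw [inv_smul_eq_iff, smul_pt g hv]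
    change pt u = pt (M.mulVec v)
    rw [h, pt_eq_pt_iff hu (smul_ne_zero hs hu)]
    simp
  refine ⟨(Matrix.ProjGenLinGroup.mk g)⁻¹, key ha ?_ h312 ?_, key hb ?_ h032 ?_, key hc ?_ h013 ?_,
    key hd ?_ h012 ?_⟩
  all_goals simp [hcol, hd']

end Independence

section Construction

variable {R : Type*} [CommRing R]

/-- The determinant of three coordinate triples. -/
def Vec.det (u v w : Vec R) : R := Vec.dot u (Vec.cross v w)

variable (L : List (Vec R))

/-- The lines with the indices `i`, `j`, `k` in the list are concurrent. -/
def Concurrent (i j k : ℕ) : Prop := Vec.det (L.getD i 0) (L.getD j 0) (L.getD k 0) = 0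

instance [DecidableEq R] (i j k : ℕ) : Decidable (Concurrent L i j k) := by
  unfold Concurrent; infer_instance

/-- The first four lines of the list are in general position, the fifth one passes through the meet
of the first two, and every further line joins two points in which earlier lines meet; the indices
of these lines are listed in `steps`. -/
def IsConstruction (steps : List (ℕ × ℕ × ℕ × ℕ)) : Prop :=
  L.length = steps.length + 5 ∧
    (¬ Concurrent L 0 1 2 ∧ ¬ Concurrent L 3 1 2 ∧ ¬ Concurrent L 0 3 2 ∧ ¬ Concurrent L 0 1 3) ∧
    (Concurrent L 0 1 4 ∧ ¬ Concurrent L 4 1 2) ∧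
    ∀ n < steps.length, (fun s : ℕ × ℕ × ℕ × ℕ =>
      (s.1 < n + 5 ∧ s.2.1 < n + 5 ∧ s.2.2.1 < n + 5 ∧ s.2.2.2 < n + 5) ∧
      Concurrent L s.1 s.2.1 (n + 5) ∧ Concurrent L s.2.2.1 s.2.2.2 (n + 5) ∧
      ¬ Concurrent L s.1 s.2.1 s.2.2.1 ∧ ¬ Concurrent L s.1 s.2.2.1 s.2.2.2)
        (steps.getD n (0, 0, 0, 0))

instance [DecidableEq R] (steps : List (ℕ × ℕ × ℕ × ℕ)) : Decidable (IsConstruction L steps) := by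
  unfold IsConstruction; infer_instance

/-- A family of lines with the same concurrent triples as the list. -/
def IsRealization (P : ℕ → Plane) : Prop :=
  ∀ i < L.length, ∀ j < L.length, ∀ k < L.length,
    (Independent ![P i, P j, P k] ↔ ¬ Concurrent L i j k)

/-- The family starts with the coordinate lines and the unit line. -/
def IsNormalized (P : ℕ → Plane) : Prop :=
  P 0 = pt ![1, 0, 0] ∧ P 1 = pt ![0, 1, 0] ∧ P 2 = pt ![0, 0, 1] ∧ P 3 = pt ![1, 1, 1]

variable {L}

lemma IsConstruction.exists_parameter {steps : List (ℕ × ℕ × ℕ × ℕ)} (hL : IsConstruction L steps)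
    {P : ℕ → Plane} (hP : IsRealization L P) (hn : IsNormalized P) :
    ∃ t : ℂ, P 4 = pt ![1, t, 0] := by
  obtain ⟨hlen, -, ⟨h1, h2⟩, -⟩ := hL
  have c1 := hP 0 (by omega) 1 (by omega) 4 (by omega)
  have c2 := hP 4 (by omega) 1 (by omega) 2 (by omega)
  obtain ⟨x, hx, ex⟩ := exists_pt_eq (P 4)
  rw [hn.1, hn.2.1, ← ex, independent_pt_iff (by simp) (by simp) hx] at c1
  rw [hn.2.1, hn.2.2.1, ← ex, independent_pt_iff hx (by simp) (by simp)] at c2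
  have d1 : x 2 = 0 := by simpa [cross_apply, h1] using c1
  have d2 : x 0 ≠ 0 := by simpa [cross_apply, h2, Matrix.vecHead] using c2
  refine ⟨x 1 / x 0, ?_⟩
  rw [← ex, pt_eq_pt_iff hx (by simp)]
  ext i
  fin_cases i <;> simp [cross_apply, d1]
  field_simp
  ring

/-- A normalized realization is determined by its fifth line. -/
lemma IsConstruction.eq_of_eq_four {steps : List (ℕ × ℕ × ℕ × ℕ)} (hL : IsConstruction L steps)
    {P P' : ℕ → Plane} (hP : IsRealization L P) (hP' : IsRealization L P') (hn : IsNormalized P)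
    (hn' : IsNormalized P') (h4 : P 4 = P' 4) {n : ℕ} (hnL : n < L.length) : P n = P' n := by
  obtain ⟨hlen, -, -, hstep⟩ := hL
  induction n using Nat.strong_induction_on with
  | _ n ih =>
    rcases lt_or_ge n 5 with hn5 | hn5
    · obtain ⟨a0, a1, a2, a3⟩ := hn
      obtain ⟨b0, b1, b2, b3⟩ := hn'
      interval_cases n
      exacts [a0.trans b0.symm, a1.trans b1.symm, a2.trans b2.symm, a3.trans b3.symm, h4]
    · obtain ⟨m, rfl⟩ := Nat.exists_eq_add_of_le' hn5
      obtain ⟨⟨ha, hb, hc, hd⟩, k1, k2, k3, k4⟩ := hstep m (by omega)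
      generalize steps.getD m (0, 0, 0, 0) = s at *
      have la := ha.trans hnL
      have lb := hb.trans hnL
      have lc := hc.trans hnL
      have ld := hd.trans hnL
      refine eq_of_not_independent (mt (hP _ la _ lb _ hnL).1 (not_not_intro k1))
        (mt (hP _ lc _ ld _ hnL).1 (not_not_intro k2)) ?_ ?_ ((hP _ la _ lb _ lc).2 k3)
        ((hP _ la _ lc _ ld).2 k4)
      · rw [ih _ ha la, ih _ hb lb]
        exact mt (hP' _ la _ lb _ hnL).1 (not_not_intro k1)
      · rw [ih _ hc lc, ih _ hd ld]
        exact mt (hP' _ lc _ ld _ hnL).1 (not_not_intro k2)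

/-- The equation of a line that joins the meets of two pairs of lines of a realization. -/
lemma IsRealization.eq_pt {P : ℕ → Plane} (hP : IsRealization L P) {i j k l n : ℕ}
    {a b c d w : Fin 3 → ℂ} (hi : P i = pt a) (hj : P j = pt b) (hk : P k = pt c) (hl : P l = pt d)
    (h : (i < L.length ∧ j < L.length ∧ k < L.length ∧ l < L.length ∧ n < L.length) ∧
      Concurrent L i j n ∧ Concurrent L k l n) (s : ℂ) (hs : s ≠ 0 := by simp)
    (hw : crossProduct (crossProduct a b) (crossProduct c d) = s • w := by
      ext i; fin_cases i <;> simp [cross_apply]) (hw0 : w ≠ 0 := by simp) (ha : a ≠ 0 := by simp)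
    (hb : b ≠ 0 := by simp) (hc : c ≠ 0 := by simp) (hd : d ≠ 0 := by simp) : P n = pt w := by
  obtain ⟨⟨li, lj, lk, ll, ln⟩, h1, h2⟩ := h
  have c1 := mt (hP i li j lj n ln).1 (not_not_intro h1)
  have c2 := mt (hP k lk l ll n ln).1 (not_not_intro h2)
  rw [hi, hj] at c1
  rw [hk, hl] at c2
  rw [eq_pt_of_not_independent ha hb hc hd c1 c2 hw (smul_ne_zero hs hw0),
    pt_eq_pt_iff (smul_ne_zero hs hw0) hw0]
  simp

lemma IsRealization.not_independent {P : ℕ → Plane} (hP : IsRealization L P) {i j k : ℕ}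
    (h : (i < L.length ∧ j < L.length ∧ k < L.length) ∧ Concurrent L i j k) :
    ¬ Independent ![P i, P j, P k] :=
  mt (hP i h.1.1 j h.1.2.1 k h.1.2.2).1 (not_not_intro h.2)

variable {φ : R →+* ℂ} {τ : ℂ}

/-- A constructible arrangement is rigid if the parameter of its fifth line is restricted to
finitely many values. -/
theorem isRigid_of_isConstruction (hφ : Function.Injective φ) (hτ : τ ≠ 0) (hL : ∀ v ∈ L, v ≠ 0)
    {steps : List (ℕ × ℕ × ℕ × ℕ)} (hsteps : IsConstruction L steps) {T : Set ℂ} (hT : T.Finite)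
    (hrel : ∀ P, IsRealization L P → IsNormalized P → ∀ t, P 4 = pt ![1, t, 0] → t ∈ T) :
    IsRigid (emb φ τ '' {v | v ∈ L}) := by
  set M := emb φ τ '' {v | v ∈ L} with hM
  have hmem : ∀ i (hi : i < L.length), emb φ τ L[i] ∈ M := fun i hi =>
    ⟨_, List.getElem_mem hi, rfl⟩
  -- the realization as a family indexed by natural numbers, with a junk value beyond the list
  let fam : Realization M → ℕ → Plane := fun ρ i =>
    if hi : i < L.length then ρ.1 ⟨_, hmem i hi⟩ else pt 0
  have hfam : ∀ ρ, IsRealization L (fam ρ) := by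
    intro ρ i hi j hj k hk
    have ni := coords_ne_zero hφ hτ (hL _ (List.getElem_mem hi))
    have nj := coords_ne_zero hφ hτ (hL _ (List.getElem_mem hj))
    have nk := coords_ne_zero hφ hτ (hL _ (List.getElem_mem hk))
    simp only [fam, hi, hj, hk, dite_true]
    rw [ρ.2]
    simp only [emb]
    rw [independent_pt_iff ni nj nk, crossProduct_coords hτ, dotProduct_smul, coords_dotProduct hτ,
      smul_ne_zero_iff_right hτ, map_ne_zero_iff φ hφ, Concurrent, Vec.det,
      List.getD_eq_getElem _ _ hi, List.getD_eq_getElem _ _ hj, List.getD_eq_getElem _ _ hk]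
  have hlen := hsteps.1
  have hsmul : ∀ (g : PGL(3, ℂ)) (P : ℕ → Plane), IsRealization L P →
      IsRealization L fun i => g • P i := fun g P hP i hi j hj k hk =>
    (independent_smul_iff g _ _ _).trans (hP i hi j hj k hk)
  have hex : ∀ ρ : Realization M, ∃ (g : PGL(3, ℂ)) (t : ℂ), IsNormalized (fun i => g • fam ρ i) ∧
      g • fam ρ 4 = pt ![1, t, 0] := by
    intro ρ
    have h := hfam ρ
    obtain ⟨f1, f2, f3, f4⟩ := hsteps.2.1
    obtain ⟨g, hg⟩ := exists_smul_eq_frame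
      ((h 0 (by omega) 1 (by omega) 2 (by omega)).2 f1)
      ((h 3 (by omega) 1 (by omega) 2 (by omega)).2 f2)
      ((h 0 (by omega) 3 (by omega) 2 (by omega)).2 f3)
      ((h 0 (by omega) 1 (by omega) 3 (by omega)).2 f4)
    obtain ⟨t, ht⟩ := hsteps.exists_parameter (hsmul g _ h) hg
    exact ⟨g, t, hg, ht⟩
  choose g t hg ht using hex
  have htT : ∀ ρ, t ρ ∈ T := fun ρ => hrel _ (hsmul _ _ (hfam ρ)) (hg ρ) _ (ht ρ)
  have := hT.to_subtype
  refine Finite.of_injective (β := T) (fun x : Moduli M => ⟨t (Quotient.out x), htT _⟩) ?_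
  intro x y hxy
  rw [Subtype.mk.injEq] at hxy
  generalize hx : Quotient.out x = ρ at *
  generalize hy : Quotient.out y = σ at *
  rw [← Quotient.out_eq x, ← Quotient.out_eq y, hx, hy]
  apply Quotient.sound
  refine ⟨(g ρ)⁻¹ * g σ, ?_⟩
  funext ⟨ℓ, hℓ⟩
  obtain ⟨v, hv, rfl⟩ := hℓ
  obtain ⟨i, hi, rfl⟩ := List.mem_iff_getElem.1 hv
  have key := hsteps.eq_of_eq_four (hsmul _ _ (hfam ρ)) (hsmul _ _ (hfam σ)) (hg ρ) (hg σ)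
    ((ht ρ).trans ((congrArg (fun t => pt ![1, t, 0]) hxy).trans (ht σ).symm)) hi
  simp only [fam, hi, dite_true] at key
  change ((g ρ)⁻¹ * g σ) • σ.1 _ = ρ.1 _
  rw [mul_smul, ← key, inv_smul_smul]

end Construction

/-- Line `k + 5` of `lines61` joins the meet of the first two given lines to the meet of the last
two. -/
def steps61 : List (ℕ × ℕ × ℕ × ℕ) := [
  (2, 4, 1, 3), (0, 3, 1, 2), (0, 2, 4, 6), (0, 5, 1, 2), (2, 4, 0, 3), (1, 9, 0, 5), (0, 5, 4, 6),
  (1, 3, 4, 6), (1, 9, 2, 3), (2, 4, 0, 12), (2, 4, 1, 7), (2, 4, 3, 11), (2, 4, 10, 12),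
  (2, 4, 11, 13), (0, 12, 3, 4), (0, 12, 5, 6), (0, 12, 9, 11), (0, 12, 1, 2), (0, 12, 9, 7),
  (0, 12, 9, 8), (0, 12, 10, 7), (0, 12, 4, 10), (5, 13, 12, 8), (0, 3, 5, 7), (9, 8, 4, 10),
  (3, 7, 1, 9), (3, 7, 5, 13), (3, 7, 2, 10), (3, 7, 11, 13), (3, 7, 4, 10), (1, 3, 4, 13),
  (9, 8, 5, 7), (0, 5, 1, 7), (12, 8, 11, 13), (2, 4, 11, 26), (2, 4, 11, 19), (2, 4, 10, 19),
  (0, 5, 20, 27), (1, 14, 15, 30), (1, 14, 5, 19), (1, 14, 9, 22), (1, 14, 5, 22), (1, 14, 9, 25),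
  (1, 14, 9, 33), (1, 14, 23, 30), (3, 7, 13, 16), (3, 7, 9, 25), (3, 7, 5, 26), (6, 14, 12, 29),
  (6, 14, 5, 13), (6, 14, 9, 33), (6, 14, 11, 26), (6, 14, 5, 25), (6, 14, 5, 26), (12, 29, 9, 38),
  (9, 33, 0, 5)]

/-- Line `k + 5` of `lines49` joins the meet of the first two given lines to the meet of the last
two. -/
def steps49 : List (ℕ × ℕ × ℕ × ℕ) := [
  (2, 4, 0, 3), (1, 3, 0, 2), (1, 2, 4, 6), (0, 2, 1, 5), (0, 7, 1, 3), (1, 2, 3, 8), (1, 3, 2, 4),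
  (2, 3, 5, 6), (1, 2, 5, 6), (3, 8, 2, 4), (3, 7, 1, 12), (3, 7, 2, 4), (7, 8, 1, 3),
  (3, 8, 5, 6), (1, 3, 0, 12), (8, 13, 3, 4), (5, 7, 1, 3), (0, 1, 11, 8), (1, 3, 0, 13),
  (11, 7, 3, 8), (7, 8, 2, 3), (5, 7, 0, 13), (4, 6, 8, 13), (4, 6, 11, 13), (3, 8, 0, 1),
  (1, 12, 3, 13), (7, 14, 15, 24), (7, 14, 8, 16), (7, 14, 11, 15), (7, 14, 4, 15), (0, 7, 18, 22),
  (7, 18, 15, 24), (7, 18, 14, 23), (7, 18, 12, 16), (7, 20, 15, 24), (7, 20, 18, 22),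
  (7, 20, 1, 3), (7, 20, 2, 4), (7, 22, 5, 19), (1, 2, 9, 22), (4, 6, 8, 16), (7, 29, 0, 13),
  (7, 29, 1, 3), (7, 29, 5, 24)]

lemma isConstruction_lines61 : IsConstruction lines61 steps61 := by decide +kernel

lemma isConstruction_lines49 : IsConstruction lines49 steps49 := by decide +kernel

lemma finite_setOf_quadratic_eq_zero {a : ℂ} (ha : a ≠ 0) (b c : ℂ) :
    {t : ℂ | a * t ^ 2 + b * t + c = 0}.Finite := by
  have h : (Polynomial.C a * .X ^ 2 + Polynomial.C b * .X + Polynomial.C c : Polynomial ℂ) ≠ 0 :=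
    fun h => by simpa [ha] using congrArg (fun p => p.coeff 2) h
  refine (Polynomial.finite_setOfPred_isRoot h).subset fun t ht => ?_
  simpa [Polynomial.IsRoot] using ht

/-- The parameter of `𝒪₆₁` satisfies `t ^ 2 + t - 1 = 0`, because the lines `3`, `7`, `8` are
concurrent. -/
theorem isRigid_O61 : IsRigid O61 := by
  rw [O61_eq]
  refine isRigid_of_isConstruction toComplex_five_injective tau_ne_zero distinct_lines61.1
    isConstruction_lines61 (finite_setOf_quadratic_eq_zero one_ne_zero 1 (-1)) ?_
  intro P hP ⟨e0, e1, e2, e3⟩ t e4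
  have e5 : P 5 = pt ![1, t, 1] := hP.eq_pt e2 e4 e1 e3 (by decide +kernel) (-1)
  have e6 : P 6 = pt ![0, 1, 1] := hP.eq_pt e0 e3 e1 e2 (by decide +kernel) (1)
  have e7 : P 7 = pt ![1, 0, -t] := hP.eq_pt e0 e2 e4 e6 (by decide +kernel) (-1)
  have e8 : P 8 = pt ![0, t, 1] := hP.eq_pt e0 e5 e1 e2 (by decide +kernel) (1)
  have h := hP.not_independent (i := 3) (j := 7) (k := 8) (by decide +kernel)
  rw [e3, e7, e8, independent_pt_iff (by simp) (by simp) (by simp), not_not] at h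
  simp only [cross_apply, Matrix.vec3_dotProduct, Matrix.cons_val] at h
  rw [Set.mem_ofPred_eq]
  linear_combination h

/-- The parameter of `𝒪₄₉` satisfies `2 t ^ 2 - 2 t - 1 = 0`, because the lines `4`, `9`, `10` are
concurrent. -/
theorem isRigid_O49 : IsRigid O49 := by
  rw [O49_eq]
  refine isRigid_of_isConstruction toComplex_three_injective one_ne_zero distinct_lines49.1
    isConstruction_lines49 (finite_setOf_quadratic_eq_zero two_ne_zero (-2) (-1)) ?_
  intro P hP ⟨e0, e1, e2, e3⟩ t e4
  have e5 : P 5 = pt ![1, t, t] := hP.eq_pt e2 e4 e0 e3 (by decide +kernel) (1)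
  have e6 : P 6 = pt ![1, 0, 1] := hP.eq_pt e1 e3 e0 e2 (by decide +kernel) (-1)
  have e7 : P 7 = pt ![0, t, -1] := hP.eq_pt e1 e2 e4 e6 (by decide +kernel) (1)
  have e8 : P 8 = pt ![1, 0, t] := hP.eq_pt e0 e2 e1 e5 (by decide +kernel) (1)
  have e9 : P 9 = pt ![1, -t, 1] := hP.eq_pt e0 e7 e1 e3 (by decide +kernel) (-1)
  have e10 : P 10 = pt ![0, 1, 1 - t] := hP.eq_pt e1 e2 e3 e8 (by decide +kernel) (1)
  have h := hP.not_independent (i := 4) (j := 9) (k := 10) (by decide +kernel)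
  rw [e4, e9, e10, independent_pt_iff (by simp) (by simp) (by simp), not_not] at h
  simp only [cross_apply, Matrix.vec3_dotProduct, Matrix.cons_val] at h
  rw [Set.mem_ofPred_eq]
  linear_combination h

/-! ### Fields of definition -/

lemma toComplex_mem_QSqrt {D : ℕ} (x : Quad D) : toComplex D x ∈ QSqrt D := by
  rw [toComplex_apply]
  exact add_mem (intCast_mem _ _)
    (mul_mem (intCast_mem _ _) (IntermediateField.mem_adjoin_simple_self ℚ _))

lemma isDefinedOver_emb {D : ℕ} (hD : Function.Injective (toComplex D)) {τ : ℂ} (hτ : τ ≠ 0)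
    {L : List (Vec (Quad D))} (hL : ∀ v ∈ L, v ≠ 0) {K : Subfield ℂ}
    (hK : ∀ x, toComplex D x ∈ K) (hτK : τ ∈ K) :
    IsDefinedOver K (emb (toComplex D) τ '' {v | v ∈ L}) := by
  rintro _ ⟨v, hv, rfl⟩
  have hw := coords_ne_zero hD hτ (hL v hv)
  refine ⟨_, hw, fun i => ?_, (pt_eq_mk hw).symm⟩
  fin_cases i
  exacts [hK _, mul_mem hτK (hK _), hK _]

/-- The diagonal projective transformation that divides the second coordinate by `τ`. -/
lemma exists_smul_emb_eq {D : ℕ} (hD : Function.Injective (toComplex D)) {τ : ℂ} (hτ : τ ≠ 0) :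
    ∃ g : PGL(3, ℂ), ∀ v : Vec (Quad D), v ≠ 0 →
      g • emb (toComplex D) τ v = emb (toComplex D) 1 v := by
  have hdet : (Matrix.diagonal ![1, τ⁻¹, 1] : Matrix (Fin 3) (Fin 3) ℂ).det ≠ 0 := by
    simpa [Matrix.det_diagonal, Fin.prod_univ_three] using hτ
  refine ⟨Matrix.ProjGenLinGroup.mk (Matrix.GeneralLinearGroup.mkOfDetNeZero _ hdet),
    fun v hv => ?_⟩
  rw [emb, smul_pt _ (coords_ne_zero hD hτ hv), emb]
  congr 1
  change (Matrix.diagonal ![1, τ⁻¹, 1]).mulVec _ = _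
  ext i
  rw [Matrix.mulVec_diagonal]
  fin_cases i <;> simp [coords, hτ]

lemma exists_eq_add_mul_sqrt_of_mem_QSqrt {m : ℕ} {x : ℂ} (hx : x ∈ QSqrt m) :
    ∃ p q : ℚ, x = p + q * ((√(m : ℝ) : ℝ) : ℂ) := by
  have hs : (((√(m : ℝ) : ℝ) : ℂ)) ^ 2 = m := by
    rw [← Complex.ofReal_pow, Real.sq_sqrt m.cast_nonneg]
    simp
  have hint : IsIntegral ℚ ((√(m : ℝ) : ℝ) : ℂ) :=
    .of_pow (n := 2) (by norm_num) (by rw [hs]; exact isIntegral_algebraMap (x := (m : ℚ)))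
  rw [← IntermediateField.mem_toSubalgebra,
    IntermediateField.adjoin_simple_toSubalgebra_of_isAlgebraic hint.isAlgebraic] at hx
  induction hx using Algebra.adjoin_induction with
  | mem x hx =>
    rw [Set.mem_singleton_iff] at hx
    exact ⟨0, 1, by simp [hx]⟩
  | algebraMap r => exact ⟨r, 0, by simp⟩
  | add x y _ _ hx hy =>
    obtain ⟨p, q, rfl⟩ := hx
    obtain ⟨p', q', rfl⟩ := hy
    exact ⟨p + p', q + q', by push_cast; ring⟩
  | mul x y _ _ hx hy =>
    obtain ⟨p, q, rfl⟩ := hx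
    obtain ⟨p', q', rfl⟩ := hy
    exact ⟨p * p' + q * q' * m, p * q' + q * p', by
      push_cast; linear_combination (q : ℂ) * q' * hs⟩

/-- If `(p + q √5) ^ 2 = 10 + 2 √5`, then `(p ^ 2 - 5 q ^ 2) ^ 2 = 80`, which is not a square
of a rational number. -/
lemma sq_ne_of_mem_QSqrt_five {x : ℂ} (hx : x ∈ QSqrt 5) : x ^ 2 ≠ (tau : ℂ) ^ 2 := by
  obtain ⟨p, q, rfl⟩ := exists_eq_add_mul_sqrt_of_mem_QSqrt hx
  intro h
  have h' : ((p : ℝ) + q * √((5 : ℕ) : ℝ)) ^ 2 = tau ^ 2 := by exact_mod_cast h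
  rw [tau_sq, Nat.cast_ofNat] at h'
  have h5 : √(5 : ℝ) ^ 2 = 5 := Real.sq_sqrt (by norm_num)
  have hpq : p * q = 1 := by
    by_contra hne
    have hne' : (1 - p * q : ℚ) ≠ 0 := sub_ne_zero.2 (Ne.symm hne)
    have hirr : Irrational √((5 : ℕ) : ℝ) := Nat.Prime.irrational_sqrt (by norm_num)
    refine hirr ⟨(p ^ 2 + 5 * q ^ 2 - 10) / (2 * (1 - p * q)), ?_⟩
    have hne'' : ((1 : ℝ) - p * q) ≠ 0 := by exact_mod_cast hne'
    push_cast
    field_simp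
    linear_combination h' - (q : ℝ) ^ 2 * h5
  have hpq' : (p : ℝ) * q = 1 := by exact_mod_cast hpq
  have hsum : p ^ 2 + 5 * q ^ 2 = 10 := by
    have : (p : ℝ) ^ 2 + 5 * q ^ 2 = 10 := by
      linear_combination h' - (q : ℝ) ^ 2 * h5 - 2 * √5 * hpq'
    exact_mod_cast this
  have h80 : IsSquare (80 : ℚ) := ⟨p ^ 2 - 5 * q ^ 2, by
    linear_combination (-(p ^ 2 + 5 * q ^ 2) - 10) * hsum + 20 * (p * q + 1) * hpq⟩
  norm_num at h80

lemma tau_sq_eq : (tau : ℂ) ^ 2 = toComplex 5 ⟨10, 2⟩ := by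
  rw [toComplex_apply, ← Complex.ofReal_pow, tau_sq]
  push_cast
  ring

lemma finrank_adjoin_tau :
    Module.finrank (QSqrt 5) (IntermediateField.adjoin (QSqrt 5) {(tau : ℂ)}) = 2 := by
  let c : QSqrt 5 := ⟨toComplex 5 ⟨10, 2⟩, toComplex_mem_QSqrt _⟩
  have hirr : Irreducible (Polynomial.X ^ 2 - Polynomial.C c) := by
    refine X_pow_sub_C_irreducible_of_prime Nat.prime_two fun b hb => ?_
    refine sq_ne_of_mem_QSqrt_five b.2 ?_
    rw [tau_sq_eq]
    exact congrArg Subtype.val hb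
  have hmonic : (Polynomial.X ^ 2 - Polynomial.C c).Monic :=
    Polynomial.monic_X_pow_sub_C c two_ne_zero
  have hroot : Polynomial.aeval (tau : ℂ) (Polynomial.X ^ 2 - Polynomial.C c) = 0 := by
    rw [map_sub, map_pow, Polynomial.aeval_X, Polynomial.aeval_C, tau_sq_eq]
    exact sub_self _
  rw [IntermediateField.adjoin.finrank ⟨_, hmonic, hroot⟩,
    ← minpoly.eq_of_irreducible_of_monic hirr hroot hmonic, Polynomial.natDegree_X_pow_sub_C]

end PointLine

open PointLine in
theorem mainTheorem4 :
    -- `O61`: number of lines, freeness, intersection points, rigidity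
    (O61.ncard = 61 ∧ IsFree O61 ∧
      numPoints O61 2 = 335 ∧ numPoints O61 3 = 140 ∧ numPoints O61 5 = 70 ∧
      numPoints O61 10 = 1 ∧ numPoints O61 12 = 5 ∧
      (∀ k, 2 ≤ k → k ∉ ({2, 3, 5, 10, 12} : Set ℕ) → numPoints O61 k = 0) ∧
      IsRigid O61) ∧
    -- `O49`: number of lines, freeness, intersection points, rigidity
    (O49.ncard = 49 ∧ IsFree O49 ∧
      numPoints O49 2 = 204 ∧ numPoints O49 3 = 96 ∧ numPoints O49 4 = 6 ∧
      numPoints O49 5 = 24 ∧ numPoints O49 6 = 6 ∧ numPoints O49 7 = 12 ∧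
      numPoints O49 12 = 1 ∧
      (∀ k, 2 ≤ k → k ∉ ({2, 3, 4, 5, 6, 7, 12} : Set ℕ) → numPoints O49 k = 0) ∧
      IsRigid O49) ∧
    -- the regular 10-gon lives over a quadratic extension of `ℚ(√5)`, and one projective
    -- transformation brings it, and `O61` with it, to an arrangement over `ℚ(√5)`
    ((∃ K : IntermediateField (QSqrt 5) ℂ, Module.finrank (QSqrt 5) K = 2 ∧
        IsDefinedOver K.toSubfield (polygon 10)) ∧
      ∃ g : Matrix.ProjGenLinGroup (Fin 3) ℂ,
        IsDefinedOver (QSqrt 5).toSubfield ((fun ℓ => g • ℓ) '' polygon 10) ∧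
        IsDefinedOver (QSqrt 5).toSubfield ((fun ℓ => g • ℓ) '' O61)) ∧
    -- the regular 12-gon and `O49` are defined over `ℚ(√3)`
    (IsDefinedOver (QSqrt 3).toSubfield (polygon 12) ∧
      IsDefinedOver (QSqrt 3).toSubfield O49) := by

  obtain ⟨n61, z61⟩ := numPoints_O61
  obtain ⟨n49, z49⟩ := numPoints_O49
  have h5 : ∀ x, toComplex 5 x ∈ (QSqrt 5).toSubfield := fun x => toComplex_mem_QSqrt x
  have h3 : ∀ x, toComplex 3 x ∈ (QSqrt 3).toSubfield := fun x => toComplex_mem_QSqrt x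
  refine ⟨⟨ncard_O61, isFree_O61, n61 (2, 335) (by simp) (by simp),
    n61 (3, 140) (by simp) (by simp), n61 (5, 70) (by simp) (by simp),
    n61 (10, 1) (by simp) (by simp),
    n61 (12, 5) (by simp) (by simp), fun k hk hk' => z61 k hk (by simpa using hk'), isRigid_O61⟩,
    ⟨ncard_O49, isFree_O49, n49 (2, 204) (by simp) (by simp), n49 (3, 96) (by simp) (by simp),
    n49 (4, 6) (by simp) (by simp), n49 (5, 24) (by simp) (by simp),
    n49 (6, 6) (by simp) (by simp), n49 (7, 12) (by simp) (by simp),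
    n49 (12, 1) (by simp) (by simp), fun k hk hk' => z49 k hk (by simpa using hk'), isRigid_O49⟩,
    ⟨⟨IntermediateField.adjoin (QSqrt 5) {(tau : ℂ)}, finrank_adjoin_tau, ?_⟩, ?_⟩, ?_, ?_⟩
  · rw [polygon_ten]
    exact isDefinedOver_emb toComplex_five_injective tau_ne_zero distinct_sides10.1
      (fun x => (IntermediateField.adjoin (QSqrt 5) {(tau : ℂ)}).algebraMap_mem ⟨_, h5 x⟩)
      (IntermediateField.mem_adjoin_simple_self _ _)
  · obtain ⟨g, hg⟩ := exists_smul_emb_eq toComplex_five_injective tau_ne_zero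
    have himage : ∀ L : List (Vec (Quad 5)), (∀ v ∈ L, v ≠ 0) →
        IsDefinedOver (QSqrt 5).toSubfield
          ((fun ℓ => g • ℓ) '' (emb (toComplex 5) tau '' {v | v ∈ L})) := fun L hL => by
      rw [Set.image_image, Set.image_congr (s := {v | v ∈ L}) fun v hv => hg v (hL v hv)]
      exact isDefinedOver_emb toComplex_five_injective one_ne_zero hL h5 (one_mem _)
    rw [O61_eq, polygon_ten]
    exact ⟨g, himage _ distinct_sides10.1, himage _ distinct_lines61.1⟩
  · rw [polygon_twelve]
    exact isDefinedOver_emb toComplex_three_injective one_ne_zero distinct_sides12.1 h3 (one_mem _)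
  · rw [O49_eq]
    exact isDefinedOver_emb toComplex_three_injective one_ne_zero distinct_lines49.1 h3 (one_mem _)
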